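/- **Setting.** Let $d_1,d_2\ge 1$. Let $\boldsymbol u^{(1)},\boldsymbol u^{(2)},\dots$ be a Sobol' sequence (base 2, started at the origin) in dimension $d_1$: its first coordinate is the van der Corput sequence and its other coordinates are generated by pairwise distinct primitive polynomials over $\mathbb F_2$ with arbitrary admissible initial direction numbers. Let $\boldsymbol x^{(1)},\boldsymbol x^{(2)},\dots$ be a Sobol' sequence in dimension $d_2$. Let $\boldsymbol\tau$ be a random Owen scrambling (nested uniform scrambling in base 2) in dimension $d_1$ and put $\boldsymbol y^{(n)}=\boldsymbol\tau(\boldsymbol u^{(n)})$. Let $f:\mathbb R\to\mathbb R$, let $g_{h_0}$ be a real function of $(\boldsymbol y,\boldsymbol x)\in[0,1]^{d_1}\times[0,1]^{d_2}$, $h_0>0$, and let $M_0\ge1$, $N_0\ge 1$ be integers. Put $$\varphi(\boldsymbol y)=f\Big(\frac1{M_0}\sum_{m=1}^{M_0}g_{h_0}(\boldsymbol y,\boldsymbol x^{(m)})\Big),\qquad I_0=\frac1{N_0}\sum_{n=1}^{N_0}\varphi(\boldsymbol y^{(n)});$$ $I_0$ is the level-0 term of the multilevel double-loop quasi-Monte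 Carlo estimator with one randomization. **Boundary growth condition.** Suppose that, on $(0,1)^{d_1}$, the mixed first-order partial derivatives $\partial^u\varphi$ exist for all $u\subseteq\{1,\dots,d_1\}$ (independently of the order of differentiation), and that for some $0<b<\infty$ and real $A_1,\dots,A_{d_1}$ with $0<A_{\max}:=\max_iA_i<1/2$, $$|\partial^u\varphi(\boldsymbol y)|\le b\prod_{i=1}^{d_1}\min(y_i,1-y_i)^{-A_i-\mathbf 1_{\{i\in u\}}}\qquad\text{for all }\boldsymbol y\in(0,1)^{d_1},\ u\subseteq\{1,\dots,d_1\}.$$ **Proposition.** For every $d_1$ there are constants $B_A>0$, depending only on $d_1$ and $A=(A_1,\dots,A_{d_1})$, with $B_A\to\infty$ as $\min_iA_i\to0$, and for every Sobol' sequence in dimension $d_1$ there are constants $C_{\epsilon,d_1}>0$, depending only on $\epsilon$ and that sequence, with $C_{\epsilon,d_1}\to\infty$ as $\epsilon\downarrow0$, such that the following two claims hold for all $\epsilon>0$. 1. For all $N\ge1$, the star discrepancy satisfies $\mathbb E[D^*(\boldsymbol y^{(1)},\dots,\boldsymbol y^{(N)})]\le C_{\epsilon,d_1}N^{-(1-\epsilon)}$.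 2. For all $d_2,f,g,h_0,M_0,N_0$, all Sobol' sequences in dimension $d_2$, and all $b,A$ for which $\varphi$ satisfies the boundary growth condition, $I_0$ is square integrable and $$\mathbb V[I_0]\le\frac{b^2\,B_A^2\,C_{\epsilon,d_1}^2}{N_0^{\,2-2\epsilon-2A_{\max}}}.$$ -/

import Mathlib

open MeasureTheory ProbabilityTheory Filter Topology

namespace MLDLQMC

/-- A primitive polynomial over the field with two elements: an irreducible polynomial of some
degree `e` whose root generates the (cyclic, of order `2 ^ e - 1`) unit group of the quotient
field. -/
def IsPrimitivePoly (p : Polynomial (ZMod 2)) : Prop :=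
  Irreducible p ∧ orderOf (AdjoinRoot.root p) = 2 ^ p.natDegree - 1

/-- Data of a Sobol' sequence in dimension `d`.

`V j k r` is the `(r + 1)`-st binary digit after the point of the `(k + 1)`-st direction number
of coordinate `j`.  The first coordinate is the van der Corput sequence.  The other coordinates
belong to pairwise distinct primitive polynomials
`x ^ e + a₁ x ^ (e - 1) + ⋯ + a_(e - 1) x + a_e`; for such a coordinate the first `e` direction
numbers are free, except that the `(k + 1)`-st one is an odd integer below `2 ^ (k + 1)` divided
by `2 ^ (k + 1)`, and the later ones follow Sobol's recurrence
`v_k = a₁ v_(k - 1) ⊕ ⋯ ⊕ a_e v_(k - e) ⊕ (v_(k - e) / 2 ^ e)`. -/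
structure SobolData (d : ℕ) where
  poly : Fin d → Polynomial (ZMod 2)
  V : Fin d → ℕ → ℕ → ZMod 2
  first : ∀ j : Fin d, j.val = 0 → ∀ k r, V j k r = if r = k then 1 else 0
  primitive : ∀ j : Fin d, j.val ≠ 0 → IsPrimitivePoly (poly j)
  distinct : ∀ i j : Fin d, i.val ≠ 0 → j.val ≠ 0 → poly i = poly j → i = j
  init_one : ∀ j : Fin d, j.val ≠ 0 → ∀ k, k < (poly j).natDegree → V j k k = 1
  init_zero : ∀ j : Fin d, j.val ≠ 0 → ∀ k, k < (poly j).natDegree → ∀ r, k < r → V j k r = 0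
  recurrence : ∀ j : Fin d, j.val ≠ 0 → ∀ k, (poly j).natDegree ≤ k → ∀ r,
    V j k r =
      (∑ i ∈ Finset.Icc 1 (poly j).natDegree,
        (poly j).coeff ((poly j).natDegree - i) * V j (k - i) r)
      + (if (poly j).natDegree ≤ r then
          V j (k - (poly j).natDegree) (r - (poly j).natDegree) else 0)

/-- The real number `0.a₀a₁a₂…` in base two. -/
noncomputable def ofDigits (a : ℕ → ZMod 2) : ℝ :=
  ∑' r : ℕ, ((a r).val : ℝ) / 2 ^ (r + 1)

/-- Binary digits of coordinate `j` of the point with index `n = 0, 1, 2, …` of the Sobol'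
sequence: the digitwise sum modulo two of the direction numbers `v_(k + 1)` for which the `k`-th
binary digit of `n` is one.  (The cast of `n / 2 ^ k` to `ZMod 2` is that digit of `n`.) -/
def SobolData.digit {d : ℕ} (G : SobolData d) (n : ℕ) (j : Fin d) (r : ℕ) : ZMod 2 :=
  ∑ k ∈ Finset.range n.size, ((n / 2 ^ k : ℕ) : ZMod 2) * G.V j k r

/-- The point with index `n = 0, 1, 2, …` of the Sobol' sequence. -/
noncomputable def SobolData.point {d : ℕ} (G : SobolData d) (n : ℕ) : Fin d → ℝ :=
  fun j => ofDigits (G.digit n j)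

/-- Randomness of Owen's nested uniform scrambling in base two: one uniformly distributed random
permutation of `{0, 1}`, that is, addition of a uniform random bit, for each coordinate and each
finite string of leading digits, all of them independent. -/
structure IsOwenScrambling {Ω : Type*} [MeasurableSpace Ω] {d : ℕ}
    (ξ : Fin d × List (ZMod 2) → Ω → ZMod 2) (P : Measure Ω) : Prop where
  measurable : ∀ i, Measurable (ξ i)
  uniform : ∀ i a, P (ξ i ⁻¹' {a}) = 1 / 2
  indep : iIndepFun ξ P

/-- Owen's scrambling of the point with digits `a`: the digit `a j r` is permuted by the
permutation attached to coordinate `j` and the preceding digits `a j 0, …, a j (r - 1)`. -/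
noncomputable def scramble {Ω : Type*} {d : ℕ} (ξ : Fin d × List (ZMod 2) → Ω → ZMod 2)
    (a : Fin d → ℕ → ZMod 2) (ω : Ω) : Fin d → ℝ :=
  fun j => ofDigits fun r => a j r + ξ (j, (List.range r).map (a j)) ω

/-- The scrambled Sobol' point with index `n = 0, 1, 2, …`. -/
noncomputable def scrambledPoint {Ω : Type*} {d : ℕ} (G : SobolData d)
    (ξ : Fin d × List (ZMod 2) → Ω → ZMod 2) (n : ℕ) (ω : Ω) : Fin d → ℝ :=
  scramble ξ (G.digit n) ω

open Classical in
/-- Star discrepancy of the points `y 0, …, y (N - 1)` of the unit cube: supremum over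
`z ∈ [0, 1] ^ d` of the difference between the fraction of points in the box `[0, z)` and its
volume. -/
noncomputable def starDiscrepancy {d : ℕ} (N : ℕ) (y : ℕ → Fin d → ℝ) : ℝ :=
  ⨆ z : Set.Icc (0 : Fin d → ℝ) 1,
    |(((Finset.range N).filter fun n => ∀ i, 0 ≤ y n i ∧ y n i < z.1 i).card : ℝ) / N
      - ∏ i, z.1 i|

/-- The open unit cube. -/
def openCube (d : ℕ) : Set (Fin d → ℝ) := {y | ∀ i, 0 < y i ∧ y i < 1}

/-- `D u` is, on the open unit cube, the mixed first-order partial derivative of `φ` with respect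
to the variables in `u`, for every set `u` of variables. -/
def HasMixedPartials {d : ℕ} (φ : (Fin d → ℝ) → ℝ) (D : Finset (Fin d) → (Fin d → ℝ) → ℝ) : Prop :=
  (∀ y ∈ openCube d, D ∅ y = φ y) ∧
  ∀ (u : Finset (Fin d)) (j : Fin d), j ∉ u → ∀ y ∈ openCube d,
    HasDerivAt (fun t => D u (Function.update y j t)) (D (insert j u) y) (y j)

/-- The boundary growth condition with constant `b` and exponents `A`. -/
def BoundaryGrowth {d : ℕ} (φ : (Fin d → ℝ) → ℝ) (b : ℝ) (A : Fin d → ℝ) : Prop :=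
  ∃ D, HasMixedPartials φ D ∧ ∀ (u : Finset (Fin d)), ∀ y ∈ openCube d,
    |D u y| ≤ b * ∏ i, (min (y i) (1 - y i)) ^ (-A i - if i ∈ u then (1 : ℝ) else 0)

/-- The level-0 integrand `y ↦ f (M₀⁻¹ ∑ₘ g_{h₀} (y, x⁽ᵐ⁾))`, with deterministic inner Sobol'
points `x⁽ᵐ⁾`, `1 ≤ m ≤ M₀` (the indices `0, …, M₀ - 1` of the sequence). -/
noncomputable def levelZeroIntegrand {d₁ d₂ : ℕ} (H : SobolData d₂) (f : ℝ → ℝ)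
    (g : ℝ → (Fin d₁ → ℝ) → (Fin d₂ → ℝ) → ℝ) (h₀ : ℝ) (M₀ : ℕ) (y : Fin d₁ → ℝ) : ℝ :=
  f ((1 / (M₀ : ℝ)) * ∑ m ∈ Finset.range M₀, g h₀ y (H.point m))

/-- The level-0 term of the multilevel double-loop quasi-Monte Carlo estimator with a single
randomization: the average of the level-0 integrand over the first `N₀` scrambled Sobol' points. -/
noncomputable def levelZeroEstimator {Ω : Type*} {d₁ d₂ : ℕ} (G : SobolData d₁)
    (H : SobolData d₂) (ξ : Fin d₁ × List (ZMod 2) → Ω → ZMod 2) (f : ℝ → ℝ)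
    (g : ℝ → (Fin d₁ → ℝ) → (Fin d₂ → ℝ) → ℝ) (h₀ : ℝ) (M₀ N₀ : ℕ) (ω : Ω) : ℝ :=
  (1 / (N₀ : ℝ)) * ∑ n ∈ Finset.range N₀,
    levelZeroIntegrand H f g h₀ M₀ (scrambledPoint G ξ n ω)

end MLDLQMC

/-! The argument is a Haar analysis on the space of binary digits, where each scrambled point is
uniformly distributed. A function is split into components indexed by levels `κ`. The component of
level `κ` depends on the first `κ i` digits of coordinate `i` and changes sign when the last of them
is flipped (`sum_haar`, `haar_congr`, `haar_flip`).

Sobol' points enter through one algebraic fact, `rows_independent`. Sobol's recurrence says that the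
generating polynomial of a coordinate, evaluated at the shift, moves the row of digit `r` to the row
of digit `r - e`, with `e` the degree. Coprimality of the polynomials then makes the leading rows of
all coordinates jointly independent, up to a loss `t = ∑ (e - 1)` (`quality`). Hence a component of
level `κ` sums to zero over every aligned block of `2 ^ (|κ| + t)` indices (`sum_block_eq_zero`),
and only an incomplete block is left. In it two scrambled points are uncorrelated for this component
unless they share all digits but the last below `κ`, which only boundedly many do. So the second
moment of a sum of `N` terms is at most a constant times `min N (2 ^ |κ|)` times that of the
component (`integral_sq_sum_le`).

Boundary growth enters through the mixed differences whose means are the Haar components. If the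
initial run of equal digits of a coordinate has length `R`, its distance to the boundary is at least
`2 ^ (-(R + 1))`, while long runs are exponentially rare. With `a = A_max < 1/2` the second moment
of the component is thus of order `2 ^ ((2a - 1)|κ|)` (`GrowthBound.lintegral_haar_sq_le`). Since
`min N (2 ^ s) * 2 ^ ((2a - 1)s) ≤ N ^ (2(a + δ)) * 2 ^ (-2δs)`, the `L²` norms are summable over
`κ`, and division by `N` gives the rate `N ^ (a + ε - 1)`
(`GrowthBound.eLpNorm_scrambledAverage_le`).

The discrepancy bound needs no expectation. A Haar component of a dyadic box is supported on the
cells around the corner of the box, so an incomplete block contributes a bounded amount to each of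
the `(L + 1) ^ d` levels, for every scrambling (`abs_sum_boxFun_sub_le`). Taking `2 ^ L` of order
`N` leaves only a power of `log N`. -/

namespace MLDLQMC

/-! ### Fair coin spaces -/

/-- The uniform distribution on the two binary digits. -/
noncomputable def bitMeasure : Measure (ZMod 2) := (PMF.uniformOfFintype (ZMod 2)).toMeasure

instance : IsProbabilityMeasure bitMeasure := by unfold bitMeasure; infer_instance

lemma bitMeasure_singleton (a : ZMod 2) : bitMeasure {a} = 1 / 2 := by
  rw [bitMeasure, PMF.toMeasure_apply_singleton _ _ (measurableSet_singleton a)]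
  simp [ZMod.card]

lemma eq_bitMeasure {μ : Measure (ZMod 2)} (h : ∀ a, μ {a} = 1 / 2) : μ = bitMeasure :=
  Measure.ext_of_singleton fun a => by rw [h, bitMeasure_singleton]

lemma bitMeasure_map_add (c : ZMod 2) : bitMeasure.map (fun x => c + x) = bitMeasure := by
  refine eq_bitMeasure fun a => ?_
  rw [Measure.map_apply (by fun_prop) (measurableSet_singleton a), ← bitMeasure_singleton (a - c)]
  congr 1
  ext x
  exact (eq_sub_iff_add_eq'.symm : c + x = a ↔ x = a - c)

/-- The law of a family of independent fair bits. -/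
noncomputable def coins (ι : Type*) : Measure (ι → ZMod 2) :=
  Measure.infinitePi fun _ => bitMeasure

instance (ι : Type*) : IsProbabilityMeasure (coins ι) := by unfold coins; infer_instance

lemma coins_map_add {ι : Type*} (c : ι → ZMod 2) :
    (coins ι).map (fun x => c + x) = coins ι := by
  have := Measure.infinitePi_map_pi (μ := fun _ : ι => bitMeasure) (f := fun i x => c i + x)
    (fun i => by fun_prop)
  simp only [bitMeasure_map_add] at this
  exact this

lemma measurePreserving_coins_add {ι : Type*} (c : ι → ZMod 2) :
    MeasurePreserving (fun x => c + x) (coins ι) (coins ι) :=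
  ⟨by rw [measurable_pi_iff]; intro i; exact (measurable_pi_apply i).const_add _, coins_map_add c⟩

lemma coins_cylinder {ι : Type*} (s : Finset ι) (w : ι → ZMod 2) :
    coins ι {x | ∀ i ∈ s, x i = w i} = (1 / 2) ^ s.card := by
  have h := Measure.infinitePi_pi (fun _ : ι => bitMeasure) (s := s) (t := fun i => {w i})
    (fun i _ => measurableSet_singleton _)
  simp only [bitMeasure_singleton, Finset.prod_const] at h
  rw [← h]
  rfl

lemma coins_map_comp {ι α : Type*} {f : α → ι} (hf : Function.Injective f) :
    (coins ι).map (fun x a => x (f a)) = coins α :=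
  Measure.map_infinitePi_infinitePi_of_inj hf

/-- This transfers every statement about a scrambling on an arbitrary probability space to the
canonical space of fair bits. -/
lemma IsOwenScrambling.map_eq {Ω : Type*} [MeasurableSpace Ω] {d : ℕ}
    {ξ : Fin d × List (ZMod 2) → Ω → ZMod 2} {P : Measure Ω} (h : IsOwenScrambling ξ P) :
    P.map (fun ω i => ξ i ω) = coins (Fin d × List (ZMod 2)) := by
  rw [h.indep.map_fun_eq_infinitePi_map h.measurable, coins]
  congr 1
  ext1 i
  refine eq_bitMeasure fun a => ?_
  rw [Measure.map_apply (h.measurable i) (measurableSet_singleton a), h.uniform]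

lemma IsOwenScrambling.measurePreserving {Ω : Type*} [MeasurableSpace Ω] {d : ℕ}
    {ξ : Fin d × List (ZMod 2) → Ω → ZMod 2} {P : Measure Ω} (h : IsOwenScrambling ξ P) :
    MeasurePreserving (fun ω i => ξ i ω) P (coins (Fin d × List (ZMod 2))) :=
  ⟨measurable_pi_iff.2 h.measurable, h.map_eq⟩

variable {d : ℕ}

/-- The digits of the point with digits `a`, scrambled by the bits `η`. -/
def scr (a : Fin d → ℕ → ZMod 2) (η : Fin d × List (ZMod 2) → ZMod 2) : Fin d × ℕ → ZMod 2 :=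
  fun p => a p.1 p.2 + η (p.1, (List.range p.2).map (a p.1))

/-- The bits met along the path of one point are distinct, because prefixes of different lengths
differ. They are therefore independent fair bits, and adding fixed digits does not change their law.
-/
lemma measurePreserving_scr (a : Fin d → ℕ → ZMod 2) :
    MeasurePreserving (scr a) (coins (Fin d × List (ZMod 2))) (coins (Fin d × ℕ)) := by
  have hinj : Function.Injective
      (fun p : Fin d × ℕ => ((p.1, (List.range p.2).map (a p.1)) : Fin d × List (ZMod 2))) := by
    rintro ⟨i, r⟩ ⟨j, s⟩ h
    simp only [Prod.mk.injEq] at h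
    have := congrArg List.length h.2
    simp at this
    simp [h.1, this]
  have h1 : MeasurePreserving
      (fun (η : Fin d × List (ZMod 2) → ZMod 2) (p : Fin d × ℕ) =>
        η (p.1, (List.range p.2).map (a p.1)))
      (coins (Fin d × List (ZMod 2))) (coins (Fin d × ℕ)) :=
    ⟨by fun_prop, coins_map_comp hinj⟩
  exact (measurePreserving_coins_add fun p : Fin d × ℕ => a p.1 p.2).comp h1

/-- The digits of `y` below the levels `κ`, followed by the digits of `z`. -/
def merge (κ : Fin d → ℕ) (y z : Fin d × ℕ → ZMod 2) : Fin d × ℕ → ZMod 2 :=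
  fun p => if p.2 < κ p.1 then y p else z p

lemma measurable_merge (κ : Fin d → ℕ) :
    Measurable fun q : (Fin d × ℕ → ZMod 2) × (Fin d × ℕ → ZMod 2) => merge κ q.1 q.2 := by
  rw [measurable_pi_iff]
  intro p
  unfold merge
  split_ifs <;> fun_prop

/-- Each digit is taken from exactly one of two independent families, so a cylinder pulls back to a
product of two cylinders. -/
lemma measurePreserving_merge (κ : Fin d → ℕ) :
    MeasurePreserving
      (fun q : (Fin d × ℕ → ZMod 2) × (Fin d × ℕ → ZMod 2) => merge κ q.1 q.2)
      ((coins (Fin d × ℕ)).prod (coins (Fin d × ℕ))) (coins (Fin d × ℕ)) := by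
  refine ⟨measurable_merge κ, Measure.eq_infinitePi _ fun s t ht => ?_⟩
  have hm : ∀ u : Finset (Fin d × ℕ), MeasurableSet (Set.pi (u : Set (Fin d × ℕ)) t) := fun u =>
    MeasurableSet.pi u.countable_toSet fun i _ => ht i
  rw [Measure.map_apply (measurable_merge κ) (hm s)]
  have : (fun q : (Fin d × ℕ → ZMod 2) × (Fin d × ℕ → ZMod 2) => merge κ q.1 q.2) ⁻¹'
      Set.pi s t = (Set.pi (s.filter fun p => p.2 < κ p.1 : Finset (Fin d × ℕ)) t) ×ˢ
        (Set.pi (s.filter fun p => ¬ p.2 < κ p.1 : Finset (Fin d × ℕ)) t) := by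
    ext ⟨y, z⟩
    simp only [Set.mem_preimage, Set.mem_pi, Set.mem_prod, Finset.coe_filter, Set.mem_ofPred_eq,
      merge, Finset.mem_coe]
    constructor
    · intro h
      exact ⟨fun i hi => by simpa [hi.2] using h i hi.1, fun i hi => by simpa [hi.2] using h i hi.1⟩
    · rintro ⟨h1, h2⟩ i hi
      by_cases hk : i.2 < κ i.1
      · simpa [hk] using h1 i ⟨hi, hk⟩
      · simpa [hk] using h2 i ⟨hi, hk⟩
  rw [this, Measure.prod_prod, coins, Measure.infinitePi_pi _ fun i _ => ht i,
    Measure.infinitePi_pi _ fun i _ => ht i, Finset.prod_filter_mul_prod_filter_not]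

lemma lintegral_coins_prod (H : Fin d → (ℕ → ZMod 2) → ENNReal) (hH : ∀ i, Measurable (H i)) :
    ∫⁻ x, ∏ i, H i (fun r => x (i, r)) ∂coins (Fin d × ℕ) = ∏ i, ∫⁻ x, H i x ∂coins ℕ := by
  have h1 : MeasurePreserving (fun (x : Fin d × ℕ → ZMod 2) i r => x (i, r))
      (coins (Fin d × ℕ)) (Measure.infinitePi fun _ : Fin d => coins ℕ) :=
    ⟨by fun_prop, Measure.infinitePi_map_curry (fun (_ : Fin d) (_ : ℕ) => bitMeasure)⟩
  have h2 := lintegral_prod_eq_prod_lintegral_of_indepFun Finset.univ _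
    (iIndepFun_infinitePi (P := fun _ : Fin d => coins ℕ) (X := H) hH) (by fun_prop)
  rw [h1.lintegral_comp (f := fun x => ∏ i, H i (x i)) (by fun_prop), h2]
  refine Finset.prod_congr rfl fun i _ => ?_
  exact (measurePreserving_eval_infinitePi (fun _ : Fin d => coins ℕ) i).lintegral_comp (hH i)

end MLDLQMC

namespace MLDLQMC

/-! ### Sobol' sequences are digital sequences of finite quality parameter -/

section Sequences

open Polynomial

lemma zmod_two_eq_one {x : ZMod 2} : x ≠ 0 → x = 1 := by revert x; decide

lemma monic_of_ne_zero {p : (ZMod 2)[X]} (hp : p ≠ 0) : p.Monic :=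
  zmod_two_eq_one (leadingCoeff_ne_zero.2 hp)

/-- The shift of binary sequences. -/
def shift : Module.End (ZMod 2) (ℕ → ZMod 2) := LinearMap.funLeft (ZMod 2) (ZMod 2) Nat.succ

lemma shift_pow_apply (l : ℕ) (s : ℕ → ZMod 2) (k : ℕ) : (shift ^ l) s k = s (k + l) := by
  induction l generalizing k with
  | zero => simp
  | succ l ih =>
    rw [pow_succ', Module.End.mul_apply]
    change (shift ^ l) s (k + 1) = _
    rw [ih]
    congr 1
    omega

lemma aeval_shift_apply (p : (ZMod 2)[X]) (s : ℕ → ZMod 2) (k : ℕ) :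
    aeval shift p s k = ∑ l ∈ Finset.range (p.natDegree + 1), p.coeff l * s (k + l) := by
  rw [aeval_eq_sum_range, LinearMap.sum_apply, Finset.sum_apply]
  refine Finset.sum_congr rfl fun l _ => ?_
  rw [LinearMap.smul_apply, Pi.smul_apply, shift_pow_apply, smul_eq_mul]

/-- A linearly recurrent sequence vanishes as soon as its initial values vanish. -/
lemma eq_zero_of_aeval_shift_eq_zero {p : (ZMod 2)[X]} (hp : p.Monic) {m : ℕ}
    (hm : p.natDegree ≤ m) {s : ℕ → ZMod 2} (hs : aeval shift p s = 0)
    (h0 : ∀ k < m, s k = 0) : s = 0 := by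
  funext k
  induction k using Nat.strong_induction_on with
  | _ k ih =>
    by_cases hk : k < m
    · exact h0 k hk
    have h := congrFun hs (k - p.natDegree)
    rw [aeval_shift_apply, Finset.sum_range_succ, Finset.sum_eq_zero, hp.coeff_natDegree,
      Nat.sub_add_cancel (by omega)] at h
    · simpa using h
    · intro l hl
      rw [Finset.mem_range] at hl
      rw [ih _ (by omega), Pi.zero_apply, mul_zero]

variable {d : ℕ} (G : SobolData d)

/-- The polynomial that governs a coordinate; it is `X` for the van der Corput sequence. -/
noncomputable def SobolData.gen (j : Fin d) : (ZMod 2)[X] := if j.val = 0 then X else G.poly j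

/-- The root of `X` is zero, and order `2 ^ 1 - 1 = 1` would force `0 = 1`. This keeps `X`, attached
to the van der Corput coordinate, distinct from all other generating polynomials. -/
lemma not_isPrimitivePoly_X : ¬ IsPrimitivePoly (X : (ZMod 2)[X]) := by
  rintro ⟨-, h⟩
  have h0 : AdjoinRoot.root (X : (ZMod 2)[X]) = 0 := AdjoinRoot.mk_self
  rw [natDegree_X, h0] at h
  have : Nontrivial (AdjoinRoot (X : (ZMod 2)[X])) :=
    AdjoinRoot.nontrivial _ (by simp)
  have h1 := orderOf_eq_one_iff.1 (h.trans (by norm_num))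
  exact zero_ne_one h1

namespace SobolData

lemma gen_irreducible (j : Fin d) : Irreducible (G.gen j) := by
  unfold gen
  split_ifs with h
  · exact irreducible_X
  · exact (G.primitive j h).1

lemma gen_monic (j : Fin d) : (G.gen j).Monic := monic_of_ne_zero (G.gen_irreducible j).ne_zero

lemma gen_natDegree_pos (j : Fin d) : 0 < (G.gen j).natDegree := (G.gen_irreducible j).natDegree_pos

lemma gen_injective : Function.Injective G.gen := by
  intro i j h
  unfold gen at h
  split_ifs at h with hi hj hj
  · exact Fin.ext (by omega)
  · exact absurd (h ▸ G.primitive j hj) not_isPrimitivePoly_X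
  · exact absurd (h ▸ G.primitive i hi) not_isPrimitivePoly_X
  · exact G.distinct i j hi hj h

lemma gen_isCoprime {i j : Fin d} (hij : i ≠ j) : IsCoprime (G.gen i) (G.gen j) := by
  by_contra hc
  have h := (EuclideanDomain.dvd_or_coprime _ (G.gen j) (G.gen_irreducible i)).resolve_right hc
  exact absurd (eq_of_monic_of_associated (G.gen_monic i) (G.gen_monic j)
    ((G.gen_irreducible i).associated_of_dvd (G.gen_irreducible j) h))
    fun h => hij (G.gen_injective h)

/-- The sequence formed by the digit `r` of all direction numbers of coordinate `j`. -/
def row (j : Fin d) (r k : ℕ) : ZMod 2 := G.V j k r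

lemma row_diag (j : Fin d) {k : ℕ} (hk : k < (G.gen j).natDegree) : G.row j k k = 1 := by
  unfold gen at hk
  split_ifs at hk with h
  · simp [row, G.first j h]
  · exact G.init_one j h k hk

lemma row_upper (j : Fin d) {k r : ℕ} (hk : k < (G.gen j).natDegree) (hr : k < r) :
    G.row j r k = 0 := by
  unfold gen at hk
  split_ifs at hk with h
  · simp [row, G.first j h, hr.ne']
  · exact G.init_zero j h k hk r hr

/-- This is Sobol's recurrence with all direction numbers moved to one side; what remains is the
term divided by `2 ^ e`, which lowers the digit index by `e`. -/
lemma aeval_gen_row (j : Fin d) (r : ℕ) :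
    aeval shift (G.gen j) (G.row j r) =
      if (G.gen j).natDegree ≤ r then G.row j (r - (G.gen j).natDegree) else 0 := by
  funext k
  by_cases h : j.val = 0
  · rw [gen, if_pos h, aeval_X, natDegree_X]
    change G.V j (k + 1) r = _
    rw [G.first j h]
    split_ifs with h1 h2 h2
    · simp [row, G.first j h, h1]
    · omega
    · simp only [row, G.first j h]
      rw [if_neg (by omega)]
    · rfl
  · rw [aeval_shift_apply, Finset.sum_range_succ, (G.gen_monic j).coeff_natDegree]
    simp only [gen, if_neg h]
    have hrec := G.recurrence j h (k + (G.poly j).natDegree) (by omega) r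
    rw [Nat.add_sub_cancel] at hrec
    have hsum : ∑ i ∈ Finset.Icc 1 (G.poly j).natDegree,
        (G.poly j).coeff ((G.poly j).natDegree - i) * G.V j (k + (G.poly j).natDegree - i) r =
        ∑ l ∈ Finset.range (G.poly j).natDegree, (G.poly j).coeff l * G.row j r (k + l) := by
      refine Finset.sum_nbij' (fun i => (G.poly j).natDegree - i)
        (fun l => (G.poly j).natDegree - l) ?_ ?_ ?_ ?_ ?_
      · intro i hi; simp only [Finset.mem_Icc] at hi; simp only [Finset.mem_range]; omega
      · intro i hi; simp only [Finset.mem_range] at hi; simp only [Finset.mem_Icc]; omega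
      · intro i hi; simp only [Finset.mem_Icc] at hi; omega
      · intro i hi; simp only [Finset.mem_range] at hi; omega
      · intro i hi
        simp only [Finset.mem_Icc] at hi
        rw [row, Nat.add_sub_assoc hi.2]
    rw [hsum] at hrec
    rw [one_mul, row, hrec, ← add_assoc, CharTwo.add_self_eq_zero, zero_add]
    split_ifs <;> rfl

lemma aeval_gen_pow_row (j : Fin d) (n r : ℕ) :
    aeval shift (G.gen j ^ n) (G.row j r) =
      if n * (G.gen j).natDegree ≤ r then G.row j (r - n * (G.gen j).natDegree) else 0 := by
  induction n with
  | zero => simp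
  | succ n ih =>
    rw [pow_succ', map_mul, Module.End.mul_apply, ih, add_mul, one_mul]
    split_ifs with h1 h2 h2
    · rw [aeval_gen_row, if_pos (by omega), Nat.sub_sub]
    · rw [aeval_gen_row, if_neg (by omega)]
    · omega
    · rw [map_zero]

/-- The initial direction numbers form a triangular matrix with unit diagonal, so the coefficients
vanish one after another. -/
lemma coeff_eq_zero_of_sum_row_eq_zero_init (j : Fin d) {c : ℕ → ZMod 2}
    (hc : ∑ r ∈ Finset.range (G.gen j).natDegree, c r • G.row j r = 0) :
    ∀ r < (G.gen j).natDegree, c r = 0 := by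
  intro k
  induction k using Nat.strong_induction_on with
  | _ k ih =>
    intro hk
    have h := congrFun hc k
    rw [Finset.sum_apply, Finset.sum_eq_single k] at h
    · simpa [G.row_diag j hk] using h
    · intro r hr hrk
      rw [Finset.mem_range] at hr
      rw [Pi.smul_apply, smul_eq_mul]
      rcases lt_or_gt_of_ne hrk with h1 | h1
      · rw [ih r h1 hr, zero_mul]
      · rw [G.row_upper j hk h1, mul_zero]
    · intro h1
      exact absurd (Finset.mem_range.2 hk) h1

/-- The `n`-th power of the generating polynomial kills the first `n` groups of `e` rows and carries
the last group to the initial one. The highest coefficients therefore vanish first. -/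
lemma coeff_eq_zero_of_sum_row_eq_zero_mul (j : Fin d) (n : ℕ) {c : ℕ → ZMod 2}
    (hc : ∑ r ∈ Finset.range (n * (G.gen j).natDegree), c r • G.row j r = 0) :
    ∀ r < n * (G.gen j).natDegree, c r = 0 := by
  induction n with
  | zero => simp
  | succ n ih =>
    rw [add_mul, one_mul] at hc ⊢
    rw [Finset.sum_range_add] at hc
    have h := congrArg (aeval shift (G.gen j ^ n)) hc
    rw [map_add, map_sum, map_sum, map_zero, Finset.sum_eq_zero, zero_add] at h
    · have h0 := G.coeff_eq_zero_of_sum_row_eq_zero_init j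
        (c := fun s => c (n * (G.gen j).natDegree + s)) (by
          rw [← h]
          refine Finset.sum_congr rfl fun s _ => ?_
          rw [map_smul, aeval_gen_pow_row, if_pos (by omega), Nat.add_sub_cancel_left])
      rw [Finset.sum_eq_zero (s := Finset.range (G.gen j).natDegree), add_zero] at hc
      · intro r hr
        by_cases hr' : r < n * (G.gen j).natDegree
        · exact ih hc r hr'
        · have := h0 (r - n * (G.gen j).natDegree) (by omega)
          rwa [Nat.add_sub_cancel' (by omega)] at this
      · intro s hs
        rw [h0 s (Finset.mem_range.1 hs), zero_smul]
    · intro r hr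
      rw [map_smul, aeval_gen_pow_row, if_neg (by simpa using hr), smul_zero]

lemma coeff_eq_zero_of_sum_row_eq_zero (j : Fin d) (κ : ℕ) {c : ℕ → ZMod 2}
    (hc : ∑ r ∈ Finset.range κ, c r • G.row j r = 0) : ∀ r < κ, c r = 0 := by
  have hle : κ ≤ κ * (G.gen j).natDegree := Nat.le_mul_of_pos_right _ (G.gen_natDegree_pos j)
  intro r hr
  -- The combination is padded with zero coefficients up to a multiple of the degree.
  have := G.coeff_eq_zero_of_sum_row_eq_zero_mul j κ (c := fun r => if r < κ then c r else 0) (by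
    rw [← hc]
    refine (Finset.sum_subset_zero_on_sdiff (Finset.range_subset_range.2 hle) ?_ ?_).symm
    · intro x hx
      simp only [Finset.mem_sdiff, Finset.mem_range] at hx
      simp [hx.2]
    · intro x hx
      simp [Finset.mem_range.1 hx]) r (by omega)
  simpa [hr] using this

/-- The quality parameter of a Sobol' sequence. -/
noncomputable def quality : ℕ := ∑ j, ((G.gen j).natDegree - 1)

/-- The rows of the generating matrices are linearly independent. -/
lemma rows_independent (κ : Fin d → ℕ) {m : ℕ} (hm : ∑ j, κ j + G.quality ≤ m)
    {c : Fin d → ℕ → ZMod 2}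
    (hc : ∀ k < m, ∑ j, ∑ r ∈ Finset.range (κ j), c j r * G.V j k r = 0) :
    ∀ j, ∀ r < κ j, c j r = 0 := by
  set f : Fin d → ℕ → ZMod 2 := fun j => ∑ r ∈ Finset.range (κ j), c j r • G.row j r with hf
  set e : Fin d → ℕ := fun j => (G.gen j).natDegree with he
  have hepos : ∀ j, 0 < e j := G.gen_natDegree_pos
  -- `n j` is `κ j / e j` rounded up. The power `n j` of the generating polynomial kills the first
  -- `κ j` rows, and its degree exceeds `κ j` by at most `e j - 1`; these excesses add up to
  -- `quality`.
  set n : Fin d → ℕ := fun j => (κ j + (e j - 1)) / e j with hn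
  have hn1 : ∀ j, n j * e j ≤ κ j + (e j - 1) := fun j => Nat.div_mul_le_self _ _
  have hn2 : ∀ j, κ j ≤ n j * e j := fun j => by
    have h1 := Nat.lt_div_mul_add (a := κ j + (e j - 1)) (hepos j)
    have h2 := hepos j
    simp only [hn]
    omega
  have hkill : ∀ j, aeval shift (G.gen j ^ n j) (f j) = 0 := by
    intro j
    rw [hf, map_sum]
    refine Finset.sum_eq_zero fun r hr => ?_
    have h1 := hn2 j
    rw [Finset.mem_range] at hr
    rw [map_smul, aeval_gen_pow_row, if_neg (by change ¬ n j * e j ≤ r; omega), smul_zero]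
  have hkill' : ∀ (s : Finset (Fin d)), ∀ j ∈ s,
      aeval shift (∏ i ∈ s, G.gen i ^ n i) (f j) = 0 := by
    intro s j hj
    rw [← Finset.prod_erase_mul _ _ hj, map_mul, Module.End.mul_apply, hkill, map_zero]
  have hsum : ∑ j, f j = 0 := by
    refine eq_zero_of_aeval_shift_eq_zero (p := ∏ i, G.gen i ^ n i) (m := m)
      (monic_prod_of_monic _ _ fun i _ => (G.gen_monic i).pow _) ?_ ?_ ?_
    · rw [natDegree_prod_of_monic _ _ fun i _ => (G.gen_monic i).pow _]
      refine le_trans ?_ hm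
      rw [quality, ← Finset.sum_add_distrib]
      refine Finset.sum_le_sum fun j _ => ?_
      rw [(G.gen_monic j).natDegree_pow]
      exact hn1 j
    · rw [map_sum]
      exact Finset.sum_eq_zero fun j _ => hkill' _ j (Finset.mem_univ j)
    · intro k hk
      rw [← hc k hk, Finset.sum_apply]
      refine Finset.sum_congr rfl fun j _ => ?_
      simp only [hf, Finset.sum_apply]
      rfl
  intro j
  refine G.coeff_eq_zero_of_sum_row_eq_zero j (κ j) ?_
  change f j = 0
  -- Since the `f i` sum to zero, `f j` is killed by its own polynomial power and also by the
  -- product of all the others. Coprime polynomials in the shift have disjoint kernels, so `f j =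
  -- 0`.
  have hcop : IsCoprime (G.gen j ^ n j) (∏ i ∈ Finset.univ.erase j, G.gen i ^ n i) :=
    IsCoprime.prod_right fun i hi =>
      (G.gen_isCoprime (Finset.ne_of_mem_erase hi).symm).pow
  have h2 : aeval shift (∏ i ∈ Finset.univ.erase j, G.gen i ^ n i) (f j) = 0 := by
    have : f j = - ∑ i ∈ Finset.univ.erase j, f i := by
      rw [eq_neg_iff_add_eq_zero, Finset.add_sum_erase _ _ (Finset.mem_univ j), hsum]
    rw [this, map_neg, map_sum, Finset.sum_eq_zero (fun i hi => hkill' _ i hi), neg_zero]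
  exact Submodule.disjoint_def.1 (disjoint_ker_aeval_of_isCoprime shift hcop) _ (hkill j) h2

end SobolData

end Sequences

end MLDLQMC

namespace MLDLQMC

/-! ### Counting points of a Sobol' sequence in elementary boxes -/

lemma natCast_xor_div (a b k : ℕ) :
    (((a ^^^ b) / 2 ^ k : ℕ) : ZMod 2) = ((a / 2 ^ k : ℕ) : ZMod 2) + ((b / 2 ^ k : ℕ) : ZMod 2) := by
  rw [← Nat.shiftRight_eq_div_pow, Nat.shiftRight_xor_distrib, Nat.shiftRight_eq_div_pow,
    Nat.shiftRight_eq_div_pow, ← Nat.cast_add]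
  exact (ZMod.natCast_eq_natCast_iff' _ _ _).2 (Nat.xor_mod_two_eq)

/-- The aligned block of `2 ^ m` consecutive indices with number `c`. -/
def block (m c : ℕ) : Finset ℕ := Finset.Ico (c * 2 ^ m) ((c + 1) * 2 ^ m)

lemma mem_block {m c n : ℕ} : n ∈ block m c ↔ n / 2 ^ m = c := by
  rw [block, Finset.mem_Ico, Nat.div_eq_iff (by positivity)]
  have : 0 < 2 ^ m := by positivity
  rw [add_mul, one_mul]
  omega

lemma card_block (m c : ℕ) : (block m c).card = 2 ^ m := by
  rw [block, Nat.card_Ico, add_mul, one_mul, Nat.add_sub_cancel_left]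

lemma xor_mem_block {m c n l : ℕ} (hn : n ∈ block m c) (hl : l < 2 ^ m) :
    n ^^^ l ∈ block m c := by
  rw [mem_block] at hn ⊢
  rw [← Nat.shiftRight_eq_div_pow, Nat.shiftRight_xor_distrib, Nat.shiftRight_eq_div_pow,
    Nat.shiftRight_eq_div_pow, hn, Nat.div_eq_of_lt hl, Nat.xor_zero]

namespace SobolData

variable {d : ℕ} (G : SobolData d)

lemma digit_eq_sum {n M : ℕ} (hn : n < 2 ^ M) (j : Fin d) (r : ℕ) :
    G.digit n j r = ∑ k ∈ Finset.range M, ((n / 2 ^ k : ℕ) : ZMod 2) * G.V j k r := by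
  rw [digit]
  refine Finset.sum_subset (Finset.range_subset_range.2 (Nat.size_le.2 hn)) fun k _ hk => ?_
  rw [Finset.mem_range, not_lt] at hk
  rw [Nat.div_eq_of_lt (Nat.size_le.1 hk), Nat.cast_zero, zero_mul]

/-- Exclusive or of indices is addition of their binary digit vectors, and the digits of the points
depend linearly on these. -/
lemma digit_xor (a b : ℕ) (j : Fin d) (r : ℕ) :
    G.digit (a ^^^ b) j r = G.digit a j r + G.digit b j r := by
  obtain ⟨M, ha, hb⟩ : ∃ M, a < 2 ^ M ∧ b < 2 ^ M :=
    ⟨max a.size b.size, Nat.size_le.1 (le_max_left _ _), Nat.size_le.1 (le_max_right _ _)⟩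
  rw [G.digit_eq_sum ha, G.digit_eq_sum hb, G.digit_eq_sum (Nat.xor_lt_two_pow ha hb),
    ← Finset.sum_add_distrib]
  refine Finset.sum_congr rfl fun k _ => ?_
  rw [natCast_xor_div, add_mul]

/-- Every pattern of leading digits is attained. -/
lemma exists_digit_eq (κ : Fin d → ℕ) {m : ℕ} (hm : ∑ j, κ j + G.quality ≤ m)
    (w : Fin d → ℕ → ZMod 2) : ∃ l < 2 ^ m, ∀ j, ∀ r < κ j, G.digit l j r = w j r := by
  let M : (Fin m → ZMod 2) →ₗ[ZMod 2] ((Σ j, Fin (κ j)) → ZMod 2) :=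
    LinearMap.pi fun p => ∑ k : Fin m, (G.V p.1 k p.2) • LinearMap.proj k
  have hM : ∀ x p, M x p = ∑ k : Fin m, x k * G.V p.1 k p.2 := fun x p => by
    simp [M, mul_comm]
  have hsurj : LinearMap.range M = ⊤ := by
    by_contra hne
    -- A proper range lies in the kernel of a nonzero functional, whose coefficients would be a
    -- linear dependence between the rows.
    obtain ⟨f, hf0, hf⟩ := Submodule.exists_le_ker_of_lt_top _ (lt_top_iff_ne_top.2 hne)
    apply hf0
    have hfx : ∀ x, f x = ∑ p, x p * f (Pi.single p 1) := fun x => by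
      conv_lhs => rw [pi_eq_sum_univ' x]
      simp [map_sum]
    have h0 := G.rows_independent κ hm
      (c := fun j r => if h : r < κ j then f (Pi.single ⟨j, ⟨r, h⟩⟩ 1) else 0) (by
        intro k hk
        have h1 : f (M (Pi.single ⟨k, hk⟩ 1)) = 0 := hf (LinearMap.mem_range_self _ _)
        rw [hfx, Fintype.sum_sigma] at h1
        rw [← h1]
        refine Finset.sum_congr rfl fun j _ => ?_
        rw [Finset.sum_range]
        refine Finset.sum_congr rfl fun r _ => ?_
        rw [hM, dif_pos r.2, Finset.sum_eq_single ⟨k, hk⟩ (by simp +contextual)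
          (by simp), Pi.single_eq_same, one_mul, mul_comm])
    ext x
    simp only [LinearMap.comp_apply, LinearMap.zero_apply, LinearMap.coe_single]
    obtain ⟨j, r⟩ := x
    simpa using h0 j r r.2
  obtain ⟨x, hx⟩ := LinearMap.range_eq_top.1 hsurj fun p => w p.1 p.2
  refine ⟨Nat.ofBits fun k => decide (x k = 1), Nat.ofBits_lt_two_pow _, fun j r hr => ?_⟩
  rw [G.digit_eq_sum (Nat.ofBits_lt_two_pow _), Finset.sum_range]
  have := congrFun hx ⟨j, ⟨r, hr⟩⟩
  rw [hM] at this
  rw [← this]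
  refine Finset.sum_congr rfl fun k _ => ?_
  congr 1
  have h1 := Nat.testBit_ofBits_lt (fun k => decide (x k = 1)) k k.2
  rw [Nat.testBit_eq_decide_div_mod_eq] at h1
  have h2 : ∀ a : ℕ, ∀ y : ZMod 2, decide (a % 2 = 1) = decide (y = 1) → (a : ZMod 2) = y := by
    intro a y h
    rw [decide_eq_decide] at h
    rw [← ZMod.natCast_mod]
    rcases Nat.mod_two_eq_zero_or_one a with h' | h' <;> rw [h'] at h ⊢ <;>
      revert h <;> revert y <;> decide
  exact h2 _ _ h1

open Classical in
/-- In an aligned block, at most the expected number of points have given leading digits. -/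
lemma card_filter_digit_le (κ : Fin d → ℕ) {m : ℕ} (hm : ∑ j, κ j + G.quality ≤ m) (c : ℕ)
    (w : Fin d → ℕ → ZMod 2) :
    2 ^ (∑ j, κ j) * ((block m c).filter fun n => ∀ j, ∀ r < κ j, G.digit n j r = w j r).card
      ≤ 2 ^ m := by
  let W := (j : Fin d) → Fin (κ j) → ZMod 2
  have hW : Fintype.card W = 2 ^ (∑ j, κ j) := by
    simp [W, ZMod.card, Finset.prod_pow_eq_pow_sum]
  let g : ℕ → W := fun n j r => G.digit n j r
  have h1 := Finset.card_eq_sum_card_fiberwise (f := g) (s := block m c) (t := Finset.univ)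
    (fun _ _ => Finset.mem_coe.2 (Finset.mem_univ _))
  rw [card_block] at h1
  rw [h1, ← hW, ← smul_eq_mul, ← Finset.card_univ]
  -- The fibres over all digit patterns partition the block. Exclusive or with a suitable `l`
  -- injects the points of pattern `w` into the fibre of any other pattern `v`.
  refine Finset.card_nsmul_le_sum _ _ _ fun v _ => ?_
  obtain ⟨l, hl, hlw⟩ := G.exists_digit_eq κ hm
    fun j r => (if h : r < κ j then v j ⟨r, h⟩ else 0) - w j r
  refine Finset.card_le_card_of_injOn (fun n => n ^^^ l) ?_ ?_
  · intro n hn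
    simp only [Finset.coe_filter, Set.mem_ofPred_eq] at hn ⊢
    refine ⟨xor_mem_block hn.1 hl, ?_⟩
    funext j r
    simp only [g]
    rw [digit_xor, hn.2 j r r.2, hlw j r r.2, dif_pos r.2]
    abel
  · intro a _ b _ hab
    simpa using hab

end SobolData

end MLDLQMC

namespace MLDLQMC

/-! ### Haar components of a function of binary digits -/

variable {d : ℕ}

/-- Binary digits of a point of the unit cube. -/
abbrev Digits (d : ℕ) := Fin d × ℕ → ZMod 2

/-- The mean of `f` over the elementary box of level `κ` that contains `y`. -/
noncomputable def cellMean (f : Digits d → ℝ) (κ : Fin d → ℕ) (y : Digits d) : ℝ :=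
  ∫ z, f (merge κ y z) ∂coins (Fin d × ℕ)

/-- The coordinates in which the level is positive. -/
def levelSupport (κ : Fin d → ℕ) : Finset (Fin d) := Finset.univ.filter fun i => κ i ≠ 0

@[simp] lemma mem_levelSupport {κ : Fin d → ℕ} {i : Fin d} : i ∈ levelSupport κ ↔ κ i ≠ 0 := by
  simp [levelSupport]

/-- The level `κ` lowered by one in the coordinates of `v`. -/
def lower (κ : Fin d → ℕ) (v : Finset (Fin d)) : Fin d → ℕ :=
  fun i => if i ∈ v then κ i - 1 else κ i

/-- The component of `f` of level `κ` in the tensor product Haar decomposition. -/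
noncomputable def haar (f : Digits d → ℝ) (κ : Fin d → ℕ) (y : Digits d) : ℝ :=
  ∑ v ∈ (levelSupport κ).powerset, (-1) ^ v.card * cellMean f (lower κ v) y

/-- The sum telescopes. Indexed by `μ = lower κ v`, the admissible `v` are all subsets of the
coordinates with `μ i < L`, and their alternating sum vanishes unless there is no such coordinate.
-/
lemma sum_mixed_difference (F : (Fin d → ℕ) → ℝ) (L : ℕ) :
    ∑ κ ∈ Fintype.piFinset fun _ : Fin d => Finset.range (L + 1),
      ∑ v ∈ (levelSupport κ).powerset, (-1) ^ v.card * F (lower κ v) = F fun _ => L := by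
  have h : ∑ κ ∈ Fintype.piFinset fun _ : Fin d => Finset.range (L + 1),
      ∑ v ∈ (levelSupport κ).powerset, (-1) ^ v.card * F (lower κ v) =
      ∑ μ ∈ Fintype.piFinset fun _ : Fin d => Finset.range (L + 1),
      ∑ v ∈ (Finset.univ.filter fun i => μ i < L).powerset, (-1) ^ v.card * F μ := by
    rw [Finset.sum_sigma', Finset.sum_sigma']
    refine Finset.sum_nbij' (fun p => ⟨lower p.1 p.2, p.2⟩)
      (fun p => ⟨fun i => if i ∈ p.2 then p.1 i + 1 else p.1 i, p.2⟩) ?_ ?_ ?_ ?_ ?_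
    · rintro ⟨κ, v⟩ h
      simp only [Finset.mem_sigma, Fintype.mem_piFinset, Finset.mem_range, Finset.mem_powerset,
        Finset.subset_iff, mem_levelSupport] at h ⊢
      refine ⟨fun i => ?_, fun i hi => Finset.mem_filter.2 ⟨Finset.mem_univ i, ?_⟩⟩
      · have := h.1 i
        unfold lower
        split_ifs <;> omega
      · have := h.1 i
        have := h.2 hi
        simp only [lower, if_pos hi]
        omega
    · rintro ⟨κ, v⟩ h
      simp only [Finset.mem_sigma, Fintype.mem_piFinset, Finset.mem_range, Finset.mem_powerset,
        Finset.subset_iff, mem_levelSupport, Finset.mem_filter, Finset.mem_univ, true_and] at h ⊢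
      refine ⟨fun i => ?_, fun i hi => by simp [hi]⟩
      have := h.1 i
      split_ifs with hi
      · have := h.2 hi
        omega
      · omega
    · rintro ⟨κ, v⟩ h
      simp only [Finset.mem_sigma, Finset.mem_powerset, Finset.subset_iff, mem_levelSupport] at h
      simp only [lower, Sigma.mk.injEq, heq_eq_eq, and_true]
      funext i
      split_ifs with hi
      · have := h.2 hi
        omega
      · rfl
    · rintro ⟨κ, v⟩ h
      simp only [Sigma.mk.injEq, heq_eq_eq, and_true]
      funext i
      unfold lower
      by_cases hi : i ∈ v <;> simp [hi]
    · rintro ⟨κ, v⟩ h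
      rfl
  rw [h, Finset.sum_eq_single fun _ => L]
  · simp
  · intro μ hμ hne
    rw [← Finset.sum_mul]
    have hZ := Finset.sum_powerset_neg_one_pow_card (x := Finset.univ.filter fun i => μ i < L)
    rw [if_neg] at hZ
    · have : ∑ v ∈ (Finset.univ.filter fun i => μ i < L).powerset, (-1 : ℝ) ^ v.card = 0 := by
        exact_mod_cast congrArg (Int.cast : ℤ → ℝ) hZ
      rw [this, zero_mul]
    · intro h0
      apply hne
      funext i
      have h1 : i ∉ Finset.univ.filter fun i => μ i < L := by simp [h0]
      simp only [Fintype.mem_piFinset, Finset.mem_range] at hμ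
      have := hμ i
      simp only [Finset.mem_filter, Finset.mem_univ, true_and] at h1
      omega
  · intro h0
    simp at h0

lemma sum_haar (f : Digits d → ℝ) (L : ℕ) (y : Digits d) :
    ∑ κ ∈ Fintype.piFinset fun _ : Fin d => Finset.range (L + 1), haar f κ y =
      cellMean f (fun _ => L) y :=
  sum_mixed_difference (fun κ => cellMean f κ y) L

lemma haar_zero (f : Digits d → ℝ) (y : Digits d) :
    haar f (fun _ => 0) y = ∫ z, f z ∂coins (Fin d × ℕ) := by
  have : levelSupport (fun _ : Fin d => 0) = ∅ := by ext; simp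
  simp only [haar, this, Finset.powerset_empty, Finset.sum_singleton, Finset.card_empty, pow_zero,
    one_mul, cellMean]
  rfl

lemma cellMean_congr (f : Digits d → ℝ) {κ : Fin d → ℕ} {y y' : Digits d}
    (h : ∀ p : Fin d × ℕ, p.2 < κ p.1 → y p = y' p) : cellMean f κ y = cellMean f κ y' := by
  unfold cellMean
  congr with z
  congr 1
  funext p
  unfold merge
  split_ifs with hp
  · exact h p hp
  · rfl

lemma lower_le (κ : Fin d → ℕ) (v : Finset (Fin d)) (i : Fin d) : lower κ v i ≤ κ i := by
  unfold lower
  split_ifs <;> omega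

lemma haar_congr (f : Digits d → ℝ) {κ : Fin d → ℕ} {y y' : Digits d}
    (h : ∀ p : Fin d × ℕ, p.2 < κ p.1 → y p = y' p) : haar f κ y = haar f κ y' := by
  refine Finset.sum_congr rfl fun v _ => ?_
  rw [cellMean_congr f fun p hp => h p (hp.trans_le (lower_le κ v p.1))]

/-- Fubini gives this for almost every `y`. The integrand depends on finitely many digits of `y`
only, and the cylinder that fixes them has positive measure, so the claim holds for every `y`. -/
lemma integrable_merge {f : Digits d → ℝ} (hf : Integrable f (coins (Fin d × ℕ)))
    (κ : Fin d → ℕ) (y : Digits d) :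
    Integrable (fun z => f (merge κ y z)) (coins (Fin d × ℕ)) := by
  have h1 : Integrable (fun q : Digits d × Digits d => f (merge κ q.1 q.2))
      ((coins (Fin d × ℕ)).prod (coins (Fin d × ℕ))) :=
    (measurePreserving_merge κ).integrable_comp_of_integrable hf
  have h2 := h1.prod_right_ae
  let s : Finset (Fin d × ℕ) := Finset.univ.biUnion fun i => (Finset.range (κ i)).map
    ⟨fun r => (i, r), fun a b h => by simpa using h⟩
  have hs : ∀ p : Fin d × ℕ, p ∈ s ↔ p.2 < κ p.1 := by
    rintro ⟨i, r⟩
    simp only [s, Finset.mem_biUnion, Finset.mem_univ, true_and, Finset.mem_map, Finset.mem_range]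
    constructor
    · rintro ⟨j, a, h, h'⟩
      cases h'
      exact h
    · intro h
      exact ⟨i, r, h, rfl⟩
  have h3 : coins (Fin d × ℕ) {x | ∀ p ∈ s, x p = y p} ≠ 0 := by
    rw [coins_cylinder]
    simp
  obtain ⟨y', hy', hi⟩ := (h2.and_frequently (frequently_ae_iff.2 h3)).exists
  convert hy' using 2 with z
  congr 1
  funext p
  unfold merge
  split_ifs with hp
  · exact (hi p ((hs p).2 hp)).symm
  · rfl

/-- The flip of the digit of index `k` in coordinate `i`. -/
def flipAt (i : Fin d) (k : ℕ) : Digits d := Pi.single (i, k) 1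

/-- The mean over a cell is the average of the means over its two halves in direction `i`, and the
flip exchanges the halves. -/
lemma cellMean_flip {f : Digits d → ℝ} (hf : Integrable f (coins (Fin d × ℕ)))
    {κ μ : Fin d → ℕ} {i : Fin d} (hi : κ i = μ i + 1) (hμ : ∀ j, j ≠ i → κ j = μ j)
    (y : Digits d) :
    cellMean f κ (flipAt i (μ i) + y) = 2 * cellMean f μ y - cellMean f κ y := by
  have h1 : cellMean f μ y = ∫ z, f (merge μ y (flipAt i (μ i) + z)) ∂coins (Fin d × ℕ) := by
    have h := (measurePreserving_coins_add (flipAt i (μ i))).map_eq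
    unfold cellMean
    conv_lhs => rw [← h]
    rw [integral_map (measurePreserving_coins_add _).measurable.aemeasurable]
    rw [h]
    exact (integrable_merge hf μ y).aestronglyMeasurable
  have h1' : Integrable (fun z => f (merge μ y (flipAt i (μ i) + z))) (coins (Fin d × ℕ)) :=
    (measurePreserving_coins_add (flipAt i (μ i))).integrable_comp_of_integrable
      (integrable_merge hf μ y)
  rw [eq_sub_iff_add_eq, two_mul]
  nth_rewrite 2 [h1]
  unfold cellMean
  rw [← integral_add (integrable_merge hf _ _) (integrable_merge hf _ _),
    ← integral_add (integrable_merge hf _ _) h1']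
  congr with z
  have hout : ∀ p : Fin d × ℕ, p ≠ (i, μ i) → flipAt i (μ i) p = 0 := fun p hp => by
    simp [flipAt, hp]
  have hκμ : ∀ p : Fin d × ℕ, p ≠ (i, μ i) → (p.2 < κ p.1 ↔ p.2 < μ p.1) := by
    rintro ⟨j, r⟩ hp
    by_cases hj : j = i
    · subst hj
      have : r ≠ μ j := fun h => hp (by rw [h])
      simp only [hi]
      omega
    · simp only [hμ j hj]
  have hin : flipAt i (μ i) (i, μ i) = 1 := by simp [flipAt]
  have hb : ∀ a b : ZMod 2, a = b ∨ a = 1 + b := by decide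
  have hb' : ∀ a : ZMod 2, 1 + (1 + a) = a := by decide
  -- The two points on the left are the two on the right, in an order that depends on whether `y`
  -- and `z` agree at the flipped digit.
  rcases hb (y (i, μ i)) (z (i, μ i)) with h | h
  · have e1 : merge κ (flipAt i (μ i) + y) z = merge μ y (flipAt i (μ i) + z) := by
      funext p
      by_cases hp : p = (i, μ i)
      · subst hp
        simp [merge, hi, h]
      · simp [merge, hout p hp, hκμ p hp]
    have e2 : merge κ y z = merge μ y z := by
      funext p
      by_cases hp : p = (i, μ i)
      · subst hp
        simp [merge, hi, h]
      · simp [merge, hκμ p hp]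
    rw [e1, e2, add_comm]
  · have e1 : merge κ (flipAt i (μ i) + y) z = merge μ y z := by
      funext p
      by_cases hp : p = (i, μ i)
      · subst hp
        simp [merge, hi, h, hin, hb']
      · simp [merge, hout p hp, hκμ p hp]
    have e2 : merge κ y z = merge μ y (flipAt i (μ i) + z) := by
      funext p
      by_cases hp : p = (i, μ i)
      · subst hp
        simp [merge, hi, h, hin]
      · simp [merge, hout p hp, hκμ p hp]
    rw [e1, e2]

lemma lower_insert_self (κ : Fin d → ℕ) (v : Finset (Fin d)) (i : Fin d) :
    lower κ (insert i v) i = κ i - 1 := by simp [lower]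

lemma lower_insert_of_ne (κ : Fin d → ℕ) (v : Finset (Fin d)) {i j : Fin d} (h : j ≠ i) :
    lower κ (insert i v) j = lower κ v j := by simp [lower, h]

lemma haar_eq_sum_erase (f : Digits d → ℝ) {κ : Fin d → ℕ} {i : Fin d} (hi : κ i ≠ 0)
    (y : Digits d) :
    haar f κ y = ∑ v ∈ ((levelSupport κ).erase i).powerset, (-1) ^ v.card *
      (cellMean f (lower κ v) y - cellMean f (lower κ (insert i v)) y) := by
  unfold haar
  conv_lhs => rw [← Finset.insert_erase (mem_levelSupport.2 hi)]
  rw [Finset.sum_powerset_insert (Finset.notMem_erase _ _), ← Finset.sum_add_distrib]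
  refine Finset.sum_congr rfl fun v hv => ?_
  have : i ∉ v := fun h => by simpa using Finset.mem_powerset.1 hv h
  rw [Finset.card_insert_of_notMem this, pow_succ]
  ring

/-- In each pair `v`, `insert i v` the coarser mean ignores the flipped digit, and the flip reflects
the finer mean about the coarser one. -/
lemma haar_flip {f : Digits d → ℝ} (hf : Integrable f (coins (Fin d × ℕ))) {κ : Fin d → ℕ}
    {i : Fin d} (hi : κ i ≠ 0) (y : Digits d) :
    haar f κ (flipAt i (κ i - 1) + y) = - haar f κ y := by
  rw [haar_eq_sum_erase f hi, haar_eq_sum_erase f hi, ← Finset.sum_neg_distrib]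
  refine Finset.sum_congr rfl fun v hv => ?_
  have hiv : i ∉ v := fun h => by simpa using Finset.mem_powerset.1 hv h
  have h1 := cellMean_flip hf (κ := lower κ v) (μ := lower κ (insert i v)) (i := i)
    (by rw [lower_insert_self]; simp only [lower, if_neg hiv]; omega)
    (fun j hj => (lower_insert_of_ne κ v hj).symm) y
  rw [lower_insert_self] at h1
  have h2 : cellMean f (lower κ (insert i v)) (flipAt i (κ i - 1) + y) =
      cellMean f (lower κ (insert i v)) y := by
    refine cellMean_congr f fun p hp => ?_
    have : p ≠ (i, κ i - 1) := by
      rintro rfl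
      simp [lower_insert_self] at hp
    simp [flipAt, this]
  rw [h1, h2]
  ring

end MLDLQMC

namespace MLDLQMC

/-! ### Sums of one Haar component over a scrambled Sobol' sequence -/

variable {d : ℕ}

/-- `ψ` depends only on the digits below the levels `κ`, and changes sign under a flip of the last
of these digits in each coordinate: the properties of a Haar component of level `κ`. -/
structure IsHaar (ψ : Digits d → ℝ) (κ : Fin d → ℕ) : Prop where
  congr : ∀ y y' : Digits d, (∀ p : Fin d × ℕ, p.2 < κ p.1 → y p = y' p) → ψ y = ψ y'
  odd : ∀ i, κ i ≠ 0 → ∀ y, ψ (flipAt i (κ i - 1) + y) = - ψ y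

lemma isHaar_haar {f : Digits d → ℝ} (hf : Integrable f (coins (Fin d × ℕ))) (κ : Fin d → ℕ) :
    IsHaar (haar f κ) κ :=
  ⟨fun _ _ h => haar_congr f h, fun _ hi y => haar_flip hf hi y⟩

/-- The sum over the first `N` terms agrees with a sum over a part of an aligned block, for all
sequences whose sums over aligned blocks vanish. -/
lemma exists_remainder (m N : ℕ) : ∃ c, ∃ J ⊆ block m c, J.card ≤ N ∧ J.card ≤ 2 ^ m ∧
    ∀ g : ℕ → ℝ, (∀ c, ∑ n ∈ block m c, g n = 0) →
      ∑ n ∈ Finset.range N, g n = ∑ n ∈ J, g n := by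
  have hle : N / 2 ^ m * 2 ^ m ≤ N := Nat.div_mul_le_self _ _
  have hlt : N < (N / 2 ^ m + 1) * 2 ^ m := by
    rw [add_mul, one_mul]
    exact Nat.lt_div_mul_add (by positivity)
  refine ⟨N / 2 ^ m, Finset.Ico (N / 2 ^ m * 2 ^ m) N, Finset.Ico_subset_Ico_right hlt.le, ?_, ?_,
    fun g hg => ?_⟩
  · rw [Nat.card_Ico]
    omega
  · rw [Nat.card_Ico]
    rw [add_mul, one_mul] at hlt
    omega
  · rw [← Finset.sum_range_add_sum_Ico _ hle]
    have : ∀ q : ℕ, ∑ n ∈ Finset.range (q * 2 ^ m), g n = 0 := by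
      intro q
      induction q with
      | zero => simp
      | succ q ih =>
        rw [← Finset.sum_range_add_sum_Ico _ (Nat.mul_le_mul_right _ (Nat.le_succ q)), ih, zero_add]
        exact hg q
    rw [this, zero_add]

variable (G : SobolData d)

/-- The points of an aligned block are balanced at low levels. -/
lemma sum_block_eq_zero {ψ : Digits d → ℝ} {κ : Fin d → ℕ} (hψ : IsHaar ψ κ) {i : Fin d}
    (hi : κ i ≠ 0) {m : ℕ} (hm : ∑ j, κ j + G.quality ≤ m) (c : ℕ)
    (η : Fin d × List (ZMod 2) → ZMod 2) :
    ∑ n ∈ block m c, ψ (scr (G.digit n) η) = 0 := by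
  -- All digits of the point `l` below `κ` vanish except the last one in coordinate `i`. Exclusive
  -- or with `l` thus keeps the prefixes that select the scrambling bits, and flips just the digit
  -- in which `ψ` is odd.
  obtain ⟨l, hl, hlw⟩ := G.exists_digit_eq κ hm fun j r => flipAt i (κ i - 1) (j, r)
  have key : ∀ n, ψ (scr (G.digit (n ^^^ l)) η) = - ψ (scr (G.digit n) η) := by
    intro n
    rw [← hψ.odd i hi]
    refine hψ.congr _ _ fun p hp => ?_
    obtain ⟨j, r⟩ := p
    simp only at hp
    have hpre : (List.range r).map (G.digit (n ^^^ l) j) = (List.range r).map (G.digit n j) := by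
      refine List.map_congr_left fun s hs => ?_
      rw [List.mem_range] at hs
      rw [G.digit_xor, hlw j s (by omega)]
      have : (j, s) ≠ (i, κ i - 1) := by
        rintro ⟨⟩
        omega
      simp [flipAt, this]
    simp only [scr, Pi.add_apply]
    rw [hpre, G.digit_xor, hlw j r hp]
    ring
  refine Finset.sum_involution (fun n _ => n ^^^ l) ?_ ?_ ?_ ?_
  · intro n _
    rw [key, add_neg_cancel]
  · intro n _ h0 h
    have h1 := key n
    rw [h] at h1
    exact h0 (by linarith)
  · intro n hn
    exact xor_mem_block hn hl
  · intro n _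
    rw [Nat.xor_assoc, Nat.xor_self, Nat.xor_zero]

/-- The changed bit sits at the node that `a` visits at depth `k` in coordinate `i`, and `a` uses
this bit for one digit only. -/
lemma scr_add_single {a : Fin d → ℕ → ZMod 2} (i : Fin d) (k : ℕ)
    (η : Fin d × List (ZMod 2) → ZMod 2) :
    scr a (Pi.single (i, (List.range k).map (a i)) 1 + η) = flipAt i k + scr a η := by
  funext ⟨j, r⟩
  simp only [scr, Pi.add_apply, flipAt]
  by_cases h : (j, r) = (i, k)
  · obtain ⟨rfl, rfl⟩ := Prod.mk.inj h
    simp only [Pi.single_eq_same]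
    ring
  · have h' : (j, (List.range r).map (a j)) ≠ (i, (List.range k).map (a i)) := by
      intro h1
      obtain ⟨rfl, h2⟩ := Prod.mk.inj h1
      have := congrArg List.length h2
      simp at this
      exact h (by rw [this])
    rw [Pi.single_eq_of_ne h, Pi.single_eq_of_ne h']
    ring

/-- A point that has left the path of `a` before depth `k` never meets the changed bit. -/
lemma scr_add_single_of_ne {a a' : Fin d → ℕ → ZMod 2} {i : Fin d} {k s : ℕ} (hs : s < k)
    (h : a i s ≠ a' i s) (η : Fin d × List (ZMod 2) → ZMod 2) :
    scr a' (Pi.single (i, (List.range k).map (a i)) 1 + η) = scr a' η := by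
  funext ⟨j, r⟩
  simp only [scr, Pi.add_apply]
  have h' : (j, (List.range r).map (a' j)) ≠ (i, (List.range k).map (a i)) := by
    intro h1
    obtain ⟨rfl, h2⟩ := Prod.mk.inj h1
    have h3 := congrArg List.length h2
    simp only [List.length_map, List.length_range] at h3
    subst h3
    have h4 := List.map_inj_left.1 h2 s (List.mem_range.2 hs)
    exact h h4.symm
  rw [Pi.single_eq_of_ne h', zero_add]

lemma memLp_scr {ψ : Digits d → ℝ} (hL : MemLp ψ 2 (coins (Fin d × ℕ)))
    (a : Fin d → ℕ → ZMod 2) :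
    MemLp (fun η => ψ (scr a η)) 2 (coins (Fin d × List (ZMod 2))) :=
  hL.comp_measurePreserving (measurePreserving_scr a)

lemma integral_sq_scr {ψ : Digits d → ℝ} (hL : MemLp ψ 2 (coins (Fin d × ℕ)))
    (a : Fin d → ℕ → ZMod 2) :
    ∫ η, ψ (scr a η) ^ 2 ∂coins (Fin d × List (ZMod 2)) = ∫ y, ψ y ^ 2 ∂coins (Fin d × ℕ) := by
  have h := measurePreserving_scr a
  conv_rhs => rw [← h.map_eq]
  rw [integral_map h.measurable.aemeasurable]
  rw [h.map_eq]
  exact hL.aestronglyMeasurable.pow 2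

/-- Flipping the bit that scrambles the last relevant digit of `a` preserves the law, reverses the
sign of the first factor and leaves the second unchanged. -/
lemma covariance_eq_zero {ψ : Digits d → ℝ} {κ : Fin d → ℕ} (hψ : IsHaar ψ κ)
    (hL : MemLp ψ 2 (coins (Fin d × ℕ))) {a a' : Fin d → ℕ → ZMod 2} {i : Fin d} {s : ℕ}
    (hs : s < κ i - 1) (h : a i s ≠ a' i s) :
    ∫ η, ψ (scr a η) * ψ (scr a' η) ∂coins (Fin d × List (ZMod 2)) = 0 := by
  have hp := measurePreserving_coins_add
    (Pi.single (i, (List.range (κ i - 1)).map (a i)) 1 : Fin d × List (ZMod 2) → ZMod 2)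
  have hi : κ i ≠ 0 := by omega
  have h1 : ∫ η, ψ (scr a η) * ψ (scr a' η) ∂coins (Fin d × List (ZMod 2)) =
      - ∫ η, ψ (scr a η) * ψ (scr a' η) ∂coins (Fin d × List (ZMod 2)) := by
    conv_lhs => rw [← hp.map_eq]
    rw [integral_map hp.measurable.aemeasurable, ← integral_neg]
    · congr with η
      rw [scr_add_single, scr_add_single_of_ne hs h, hψ.odd i hi, neg_mul]
    · rw [hp.map_eq]
      exact (memLp_scr hL a).aestronglyMeasurable.mul (memLp_scr hL a').aestronglyMeasurable
  linarith

open Classical in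
/-- In an aligned block, few points agree with a given point in all but the last of the digits
below the level `κ`. -/
lemma card_filter_parent_le (κ : Fin d → ℕ) (c : ℕ) (w : Fin d → ℕ → ZMod 2) :
    ((block (∑ j, κ j + G.quality) c).filter
      fun n => ∀ j, ∀ r < κ j - 1, G.digit n j r = w j r).card ≤ 2 ^ (G.quality + d) := by
  have hsum : ∑ j, κ j ≤ ∑ j, (κ j - 1) + d := by
    calc ∑ j, κ j ≤ ∑ j : Fin d, ((κ j - 1) + 1) := Finset.sum_le_sum fun j _ => by omega
      _ = _ := by simp [Finset.sum_add_distrib]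
  have h := G.card_filter_digit_le (fun j => κ j - 1) (m := ∑ j, κ j + G.quality)
    (add_le_add_left (Finset.sum_le_sum fun j _ => Nat.sub_le _ _) _) c w
  have h2 : 2 ^ (∑ j, κ j + G.quality) ≤ 2 ^ (∑ j, (κ j - 1)) * 2 ^ (G.quality + d) := by
    rw [← pow_add]
    exact Nat.pow_le_pow_right (by norm_num) (by omega)
  exact Nat.le_of_mul_le_mul_left (h.trans h2) (by positivity)

/-- The second moment of the sum of a Haar component over a scrambled Sobol' sequence. -/
lemma integral_sq_sum_le {ψ : Digits d → ℝ} {κ : Fin d → ℕ} (hψ : IsHaar ψ κ)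
    (hL : MemLp ψ 2 (coins (Fin d × ℕ))) {i : Fin d} (hi : κ i ≠ 0) (N : ℕ) :
    ∫ η, (∑ n ∈ Finset.range N, ψ (scr (G.digit n) η)) ^ 2 ∂coins (Fin d × List (ZMod 2)) ≤
      min (N : ℝ) (2 ^ (∑ j, κ j + G.quality)) * 2 ^ (G.quality + d) *
        ∫ y, ψ y ^ 2 ∂coins (Fin d × ℕ) := by
  classical
  obtain ⟨c, J, hJ, hJ1, hJ2, hsum⟩ := exists_remainder (∑ j, κ j + G.quality) N
  have hmul : ∀ n n', Integrable (fun η => ψ (scr (G.digit n) η) * ψ (scr (G.digit n') η))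
      (coins (Fin d × List (ZMod 2))) := fun n n' =>
    (memLp_scr hL _).integrable_mul (memLp_scr hL _)
  set I := ∫ y, ψ y ^ 2 ∂coins (Fin d × ℕ) with hI
  have hI0 : 0 ≤ I := integral_nonneg fun _ => sq_nonneg _
  have hpair : ∀ n n', ∫ η, ψ (scr (G.digit n) η) * ψ (scr (G.digit n') η)
      ∂coins (Fin d × List (ZMod 2)) ≤
        if ∀ j, ∀ r < κ j - 1, G.digit n' j r = G.digit n j r then I else 0 := by
    intro n n'
    split_ifs with h
    · have hi1 : ∀ n, Integrable (fun η => ψ (scr (G.digit n) η) ^ 2)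
        (coins (Fin d × List (ZMod 2))) := fun n => (memLp_scr hL _).integrable_sq
      -- The product is at most half the sum of the squares, and each square has integral `I`
      -- because a single scrambled point is uniform.
      calc _ ≤ ∫ η, (1 / 2 * ψ (scr (G.digit n) η) ^ 2 + 1 / 2 * ψ (scr (G.digit n') η) ^ 2)
            ∂coins (Fin d × List (ZMod 2)) := by
            refine integral_mono (hmul n n') (((hi1 n).const_mul _).add ((hi1 n').const_mul _))
              fun η => ?_
            simp only
            nlinarith [sq_nonneg (ψ (scr (G.digit n) η) - ψ (scr (G.digit n') η))]
        _ = I := by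
            rw [integral_add ((hi1 n).const_mul _) ((hi1 n').const_mul _), integral_const_mul,
              integral_const_mul, integral_sq_scr hL, integral_sq_scr hL]
            ring
    · push Not at h
      obtain ⟨j, r, hr, hne⟩ := h
      exact (covariance_eq_zero hψ hL hr hne.symm).le
  calc ∫ η, (∑ n ∈ Finset.range N, ψ (scr (G.digit n) η)) ^ 2 ∂coins (Fin d × List (ZMod 2))
      = ∫ η, ∑ n ∈ J, ∑ n' ∈ J, ψ (scr (G.digit n) η) * ψ (scr (G.digit n') η)
          ∂coins (Fin d × List (ZMod 2)) := by
        congr with η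
        rw [hsum (fun n => ψ (scr (G.digit n) η)) fun c => sum_block_eq_zero G hψ hi le_rfl c η,
          sq, Finset.sum_mul_sum]
    _ = ∑ n ∈ J, ∑ n' ∈ J, ∫ η, ψ (scr (G.digit n) η) * ψ (scr (G.digit n') η)
          ∂coins (Fin d × List (ZMod 2)) := by
        rw [integral_finsetSum _ fun n _ => integrable_finsetSum _ fun n' _ => hmul n n']
        refine Finset.sum_congr rfl fun n _ => ?_
        rw [integral_finsetSum _ fun n' _ => hmul n n']
    _ ≤ ∑ n ∈ J, (2 : ℝ) ^ (G.quality + d) * I := by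
        refine Finset.sum_le_sum fun n _ => ?_
        refine (Finset.sum_le_sum fun n' _ => hpair n n').trans ?_
        rw [← Finset.sum_filter, Finset.sum_const, nsmul_eq_mul]
        refine mul_le_mul_of_nonneg_right ?_ hI0
        have := (Finset.card_le_card (Finset.filter_subset_filter
          (fun n' => ∀ j, ∀ r < κ j - 1, G.digit n' j r = G.digit n j r) hJ)).trans
          (card_filter_parent_le G κ c (G.digit n))
        exact_mod_cast this
    _ = J.card * 2 ^ (G.quality + d) * I := by
        rw [Finset.sum_const, nsmul_eq_mul, mul_assoc]
    _ ≤ _ := by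
        refine mul_le_mul_of_nonneg_right (mul_le_mul_of_nonneg_right ?_ (by positivity)) hI0
        exact le_min (by exact_mod_cast hJ1) (by exact_mod_cast hJ2)

end MLDLQMC

namespace MLDLQMC

/-! ### Binary expansions -/

/-- The integer with the binary digits `x 0, …, x (k - 1)`, the most significant one first. -/
def num (x : ℕ → ZMod 2) : ℕ → ℕ
  | 0 => 0
  | k + 1 => 2 * num x k + (x k).val

lemma val_le_one (a : ZMod 2) : a.val ≤ 1 := Nat.le_of_lt_succ (ZMod.val_lt a)

lemma num_div (x : ℕ → ZMod 2) {k L : ℕ} (h : k ≤ L) : num x L / 2 ^ (L - k) = num x k := by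
  induction L, h using Nat.le_induction with
  | base => simp
  | succ L h ih =>
    have := val_le_one (x L)
    rw [Nat.succ_sub h, pow_succ', ← Nat.div_div_eq_div_mul, num,
      (by omega : (2 * num x L + (x L).val) / 2 = num x L), ih]

lemma num_congr {x y : ℕ → ZMod 2} {k : ℕ} (h : ∀ r < k, x r = y r) : num x k = num y k := by
  induction k with
  | zero => rfl
  | succ k ih => rw [num, num, ih fun r hr => h r (by omega), h k (by omega)]

lemma eq_of_num_eq {x y : ℕ → ZMod 2} {k : ℕ} (h : num x k = num y k) : ∀ r < k, x r = y r := by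
  induction k with
  | zero => simp
  | succ k ih =>
    have h1 := val_le_one (x k)
    have h2 := val_le_one (y k)
    rw [num, num] at h
    intro r hr
    rcases Nat.lt_succ_iff_lt_or_eq.1 hr with h' | rfl
    · exact ih (by omega) r h'
    · exact ZMod.val_injective 2 (by omega)

lemma summable_digits (x : ℕ → ZMod 2) :
    Summable fun r : ℕ => ((x r).val : ℝ) / 2 ^ (r + 1) := by
  refine Summable.of_nonneg_of_le (fun r => by positivity) (fun r => ?_)
    (summable_geometric_two.mul_left (1 / 2))
  have : ((x r).val : ℝ) ≤ 1 := by exact_mod_cast val_le_one (x r)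
  rw [one_div, inv_pow, ← mul_inv, ← pow_succ', ← one_div]
  gcongr

lemma ofDigits_nonneg (x : ℕ → ZMod 2) : 0 ≤ ofDigits x := tsum_nonneg fun r => by positivity

lemma ofDigits_add_compl (x : ℕ → ZMod 2) : ofDigits x + ofDigits (fun r => 1 + x r) = 1 := by
  rw [ofDigits, ofDigits, ← (summable_digits _).tsum_add (summable_digits _)]
  rw [← tsum_geometric_two' 1]
  congr with r
  have : ∀ a : ZMod 2, a.val + (1 + a).val = 1 := by decide
  have h : ((x r).val : ℝ) + ((1 + x r).val : ℝ) = 1 := by exact_mod_cast this (x r)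
  rw [← add_div, h, pow_succ', div_div]

lemma ofDigits_le_one (x : ℕ → ZMod 2) : ofDigits x ≤ 1 := by
  have := ofDigits_add_compl x
  have := ofDigits_nonneg fun r => 1 + x r
  linarith

lemma ofDigits_ge {x : ℕ → ZMod 2} {r : ℕ} (h : x r = 1) : (1 / 2 : ℝ) ^ (r + 1) ≤ ofDigits x := by
  have := (summable_digits x).le_tsum r fun s _ => by positivity
  simpa [h, ZMod.val_one, ofDigits] using this

lemma ofDigits_eq_head (x : ℕ → ZMod 2) :
    ofDigits x = ((x 0).val : ℝ) / 2 + ofDigits (fun r => x (r + 1)) / 2 := by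
  rw [ofDigits, (summable_digits x).tsum_eq_zero_add, ofDigits, ← tsum_div_const]
  congr 1
  · simp
  · congr with r
    rw [pow_succ 2 (r + 1), div_div]

lemma two_pow_mul_ofDigits (x : ℕ → ZMod 2) (k : ℕ) :
    2 ^ k * ofDigits x = num x k + ofDigits fun r => x (r + k) := by
  induction k with
  | zero => simp [num]
  | succ k ih =>
    rw [pow_succ', mul_assoc, ih, ofDigits_eq_head, num]
    push_cast
    simp only [zero_add, add_assoc, add_comm 1 k]
    ring

lemma abs_ofDigits_sub_le {x y : ℕ → ZMod 2} {k : ℕ} (h : ∀ r < k, x r = y r) :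
    |ofDigits x - ofDigits y| ≤ (1 / 2 : ℝ) ^ k := by
  have hx := two_pow_mul_ofDigits x k
  have hy := two_pow_mul_ofDigits y k
  rw [num_congr h] at hx
  have h0 := ofDigits_nonneg fun r => x (r + k)
  have h1 := ofDigits_nonneg fun r => y (r + k)
  have h2 := ofDigits_le_one fun r => x (r + k)
  have h3 := ofDigits_le_one fun r => y (r + k)
  have : (2 : ℝ) ^ k * |ofDigits x - ofDigits y| ≤ 1 := by
    rw [← abs_of_pos (by positivity : (0 : ℝ) < 2 ^ k), ← abs_mul, abs_le, mul_sub]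
    constructor <;> linarith
  rw [one_div, inv_pow, ← one_div, le_div_iff₀ (by positivity), mul_comm]
  exact this

lemma measurable_ofDigits : Measurable ofDigits := by
  have h : ∀ x, Tendsto (fun n => ∑ r ∈ Finset.range n, ((x r).val : ℝ) / 2 ^ (r + 1)) atTop
      (𝓝 (ofDigits x)) := fun x => (summable_digits x).hasSum.tendsto_sum_nat
  refine measurable_of_tendsto_metrizable (fun n => ?_) (tendsto_pi_nhds.2 h)
  refine Finset.measurable_sum _ fun r _ => Measurable.div_const ?_ _
  exact (measurable_of_countable fun a : ZMod 2 => ((a.val : ℕ) : ℝ)).comp (measurable_pi_apply r)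

/-- The length of the initial run of equal digits. -/
noncomputable def runLength (x : ℕ → ZMod 2) : ℕ := sInf {r | x r ≠ x 0}

lemma eq_of_lt_runLength {x : ℕ → ZMod 2} {r : ℕ} (h : r < runLength x) : x r = x 0 := by
  by_contra hne
  exact Nat.notMem_of_lt_sInf h hne

lemma ne_runLength {x : ℕ → ZMod 2} (h : ∃ r, x r ≠ x 0) : x (runLength x) ≠ x 0 := Nat.sInf_mem h

/-- Among two different digits one is a one, which keeps the point away from `0`, and the other is a
one after complementing all digits, which keeps it away from `1`. -/
lemma min_ofDigits_ge {x : ℕ → ZMod 2} {R : ℕ} (h : x R ≠ x 0) :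
    (1 / 2 : ℝ) ^ (R + 1) ≤ min (ofDigits x) (1 - ofDigits x) := by
  have key : ∀ x : ℕ → ZMod 2, (x 0 = 1 ∨ x R = 1) → (1 / 2 : ℝ) ^ (R + 1) ≤ ofDigits x := by
    rintro x (h | h)
    · exact (pow_le_pow_of_le_one (by norm_num) (by norm_num) (by omega)).trans (ofDigits_ge h)
    · exact ofDigits_ge h
  have hb : ∀ a b : ZMod 2, a ≠ b → (b = 1 ∨ a = 1) ∧ (1 + b = 1 ∨ 1 + a = 1) := by decide
  have h1 := key x (hb _ _ h).1
  have h2 := key (fun r => 1 + x r) (hb _ _ h).2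
  have h3 := ofDigits_add_compl x
  exact le_min h1 (by linarith)

/-! ### Differences of functions that grow at the boundary of the unit interval -/

/-- `ω` bounds the differences between `p` and `q` of functions on the unit interval that grow at
the boundary at most like the power with exponent `-a`, relative to the constant of that growth. -/
def SegBound (a p q ω : ℝ) : Prop :=
  ∀ (g g' : ℝ → ℝ) (K : ℝ), 0 ≤ K → (∀ t ∈ Set.Ioo (0 : ℝ) 1, HasDerivAt g (g' t) t) →
    (∀ t ∈ Set.Ioo (0 : ℝ) 1, |g t| ≤ K * min t (1 - t) ^ (-a)) →
    (∀ t ∈ Set.Ioo (0 : ℝ) 1, |g' t| ≤ K * min t (1 - t) ^ (-a - 1)) → |g p - g q| ≤ K * ω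

lemma SegBound.symm {a p q ω : ℝ} (h : SegBound a p q ω) : SegBound a q p ω := by
  intro g g' K hK h1 h2 h3
  rw [abs_sub_comm]
  exact h g g' K hK h1 h2 h3

lemma SegBound.mono {a p q ω ω' : ℝ} (h : SegBound a p q ω) (hω : ω ≤ ω') : SegBound a p q ω' :=
  fun g g' K hK h1 h2 h3 => (h g g' K hK h1 h2 h3).trans (mul_le_mul_of_nonneg_left hω hK)

lemma mem_Ioo_of_min {c t : ℝ} (hc : 0 < c) (h : c ≤ min t (1 - t)) : t ∈ Set.Ioo (0 : ℝ) 1 := by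
  have := le_min_iff.1 h
  exact ⟨by linarith, by linarith⟩

lemma segBound_of_min_ge {a p q c : ℝ} (ha : 0 ≤ a) (hc : 0 < c) (hp : c ≤ min p (1 - p))
    (hq : c ≤ min q (1 - q)) : SegBound a p q (c ^ (-a - 1) * |p - q|) := by
  intro g g' K hK h1 _ h3
  have hsub : Set.Icc c (1 - c) ⊆ Set.Ioo (0 : ℝ) 1 := fun t ht =>
    ⟨by linarith [ht.1], by linarith [ht.2]⟩
  have hmem : ∀ t, c ≤ min t (1 - t) → t ∈ Set.Icc c (1 - c) := fun t ht => by
    have := le_min_iff.1 ht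
    exact ⟨this.1, by linarith [this.2]⟩
  have := Convex.norm_image_sub_le_of_norm_hasDerivWithin_le (f := g) (f' := g')
    (s := Set.Icc c (1 - c)) (C := K * c ^ (-a - 1)) (x := q) (y := p)
    (fun t ht => (h1 t (hsub ht)).hasDerivWithinAt) (fun t ht => by
      rw [Real.norm_eq_abs]
      refine (h3 t (hsub ht)).trans (mul_le_mul_of_nonneg_left ?_ hK)
      exact Real.rpow_le_rpow_of_nonpos hc (le_min ht.1 (by linarith [ht.2])) (by linarith))
    (convex_Icc _ _) (hmem q hq) (hmem p hp)
  rw [Real.norm_eq_abs, Real.norm_eq_abs, mul_assoc] at this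
  exact this

lemma segBound_add {a p q c c' : ℝ} (ha : 0 ≤ a) (hc : 0 < c) (hc' : 0 < c')
    (hp : c ≤ min p (1 - p)) (hq : c' ≤ min q (1 - q)) :
    SegBound a p q (c ^ (-a) + c' ^ (-a)) := by
  intro g g' K hK _ h2 _
  refine (abs_sub _ _).trans ?_
  rw [mul_add]
  refine add_le_add ((h2 p (mem_Ioo_of_min hc hp)).trans (mul_le_mul_of_nonneg_left ?_ hK))
    ((h2 q (mem_Ioo_of_min hc' hq)).trans (mul_le_mul_of_nonneg_left ?_ hK))
  · exact Real.rpow_le_rpow_of_nonpos hc hp (by linarith)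
  · exact Real.rpow_le_rpow_of_nonpos hc' hq (by linarith)

/-- The size of a Haar component of level `k` at points with an initial run of length `r`. -/
noncomputable def runWeight (a : ℝ) (k r : ℕ) : ℝ :=
  2 ^ (a * (r + 1 : ℕ)) * (1 / 2) ^ (k - (r + 1))

lemma runWeight_pos (a : ℝ) (k r : ℕ) : 0 < runWeight a k r := by
  unfold runWeight
  positivity

lemma half_pow_rpow_neg (a : ℝ) (n : ℕ) : ((1 / 2 : ℝ) ^ n) ^ (-a) = 2 ^ (a * n) := by
  rw [one_div, inv_pow, Real.inv_rpow (by positivity), Real.rpow_neg (by positivity), inv_inv,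
    ← Real.rpow_natCast, ← Real.rpow_mul (by norm_num), mul_comm]

/-- When the run ends before the changed digit, both points have the same run and hence the same
lower bound for the distance to the boundary. The mean value theorem applies over a gap of at most
`2 ^ (-k)`. -/
lemma segBound_runWeight_of_lt {a : ℝ} (ha : 0 ≤ a) {x x' : ℕ → ZMod 2} {k : ℕ}
    (h : ∀ r, r ≠ k → x r = x' r) (hx : ∃ r, x r ≠ x 0) (hlt : runLength x < k) :
    SegBound a (ofDigits x) (ofDigits x') (2 * runWeight a (k + 1) (runLength x)) := by
  have h1 := min_ofDigits_ge (ne_runLength hx)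
  have h2 : (1 / 2 : ℝ) ^ (runLength x + 1) ≤ min (ofDigits x') (1 - ofDigits x') := by
    refine min_ofDigits_ge ?_
    rw [← h _ hlt.ne, ← h 0 (by omega)]
    exact ne_runLength hx
  refine (segBound_of_min_ge ha (by positivity) h1 h2).mono ?_
  have h3 := abs_ofDigits_sub_le (x := x) (y := x') (k := k) fun r hr => h r hr.ne
  refine (mul_le_mul_of_nonneg_left h3 (by positivity)).trans (le_of_eq ?_)
  rw [runWeight, sub_eq_add_neg, ← neg_add, half_pow_rpow_neg, add_mul, one_mul,
    Real.rpow_add (by norm_num), Real.rpow_natCast]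
  obtain ⟨j, hj⟩ : ∃ j, k = runLength x + 1 + j := ⟨k - (runLength x + 1), by omega⟩
  rw [(by omega : k + 1 - (runLength x + 1) = j + 1), hj, pow_add (1 / 2 : ℝ) (runLength x + 1) j]
  have : (2 : ℝ) ^ (runLength x + 1) * (1 / 2) ^ (runLength x + 1) = 1 := by
    rw [← mul_pow]
    norm_num
  rw [pow_succ (1 / 2 : ℝ) j]
  linear_combination (2 ^ (a * ((runLength x + 1 : ℕ) : ℝ)) * (1 / 2) ^ j) * this

/-- If a run ends before the changed digit, the mean value bound is available. Otherwise both points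
may be very close to the boundary and the two values are bounded separately; the truncated exponent
in `runWeight` is then zero. -/
lemma segBound_runWeight {a : ℝ} (ha : 0 ≤ a) {x x' : ℕ → ZMod 2} {k : ℕ}
    (h : ∀ r, r ≠ k → x r = x' r) (hx : ∃ r, x r ≠ x 0) (hx' : ∃ r, x' r ≠ x' 0) :
    SegBound a (ofDigits x) (ofDigits x')
      (2 * (runWeight a (k + 1) (runLength x) + runWeight a (k + 1) (runLength x'))) := by
  have p1 := runWeight_pos a (k + 1) (runLength x)
  have p2 := runWeight_pos a (k + 1) (runLength x')
  by_cases h1 : runLength x < k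
  · exact (segBound_runWeight_of_lt ha h hx h1).mono (by linarith)
  by_cases h2 : runLength x' < k
  · exact (segBound_runWeight_of_lt ha (fun r hr => (h r hr).symm) hx' h2).symm.mono (by linarith)
  refine (segBound_add ha (by positivity) (by positivity) (min_ofDigits_ge (ne_runLength hx))
    (min_ofDigits_ge (ne_runLength hx'))).mono ?_
  have e : ∀ R, ¬ R < k → ((1 / 2 : ℝ) ^ (R + 1)) ^ (-a) = runWeight a (k + 1) R := fun R hR => by
    rw [half_pow_rpow_neg, runWeight, (by omega : k + 1 - (R + 1) = 0), pow_zero, mul_one]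
  rw [e _ h1, e _ h2]
  linarith

lemma min_rpow_le_runWeight {a : ℝ} (ha : 0 ≤ a) {x : ℕ → ZMod 2} (hx : ∃ r, x r ≠ x 0) :
    min (ofDigits x) (1 - ofDigits x) ^ (-a) ≤ runWeight a 0 (runLength x) := by
  refine (Real.rpow_le_rpow_of_nonpos (by positivity) (min_ofDigits_ge (ne_runLength hx))
    (by linarith)).trans (le_of_eq ?_)
  rw [half_pow_rpow_neg, runWeight, Nat.zero_sub, pow_zero, mul_one]

/-! ### The second moment of the run weights -/

/-- The sequences whose initial run has at least the length `r`. -/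
def runSet (r : ℕ) : Set (ℕ → ZMod 2) := {x | ∀ s ∈ Finset.range r, x s = x 0}

lemma measurableSet_runSet (r : ℕ) : MeasurableSet (runSet r) := by
  have : runSet r = ⋂ s ∈ Finset.range r, {x | x s = x 0} := by
    ext x
    simp [runSet]
  rw [this]
  exact Finset.measurableSet_biInter _ fun s _ =>
    measurableSet_eq_fun (measurable_pi_apply s) (measurable_pi_apply 0)

/-- A run of length `r` starts with one of two constant strings. -/
lemma coins_runSet_le (r : ℕ) : coins ℕ (runSet r) ≤ ENNReal.ofReal (2 * (1 / 2) ^ r) := by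
  have hsub : runSet r ⊆ ⋃ c : ZMod 2, {x | ∀ s ∈ Finset.range r, x s = (fun _ => c) s} := by
    intro x hx
    exact Set.mem_iUnion.2 ⟨x 0, hx⟩
  refine (measure_mono hsub).trans ((measure_iUnion_le _).trans ?_)
  simp only [coins_cylinder, Finset.card_range]
  rw [tsum_fintype, Finset.sum_const, Finset.card_univ, ZMod.card, nsmul_eq_mul,
    ENNReal.ofReal_mul (by norm_num), ENNReal.ofReal_pow (by norm_num),
    ENNReal.ofReal_div_of_pos (by norm_num)]
  simp

/-- A measurable majorant of the square of the run weight. -/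
noncomputable def runBound (a : ℝ) (k : ℕ) (x : ℕ → ZMod 2) : ENNReal :=
  -- The term with `r` equal to the run length already gives the majorant, so no measurability of
  -- `runLength` is involved.
  ∑' r, (runSet r).indicator (fun _ => ENNReal.ofReal (runWeight a k r ^ 2)) x

lemma measurable_runBound (a : ℝ) (k : ℕ) : Measurable (runBound a k) :=
  Measurable.tsum fun r => measurable_const.indicator (measurableSet_runSet r)

lemma le_runBound (a : ℝ) (k : ℕ) (x : ℕ → ZMod 2) :
    ENNReal.ofReal (runWeight a k (runLength x) ^ 2) ≤ runBound a k x := by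
  refine le_trans (le_of_eq ?_) (ENNReal.le_tsum (runLength x))
  rw [Set.indicator_of_mem]
  intro s hs
  exact eq_of_lt_runLength (Finset.mem_range.1 hs)

/-- The rate of decay of the variances of the Haar components. -/
noncomputable def decay (a : ℝ) : ℝ := 2 ^ (2 * a - 1)

lemma decay_pos (a : ℝ) : 0 < decay a := by
  unfold decay
  positivity

lemma decay_lt_one {a : ℝ} (ha : a < 1 / 2) : decay a < 1 :=
  Real.rpow_lt_one_of_one_lt_of_neg (by norm_num) (by linarith)

lemma half_le_decay {a : ℝ} (ha : 0 ≤ a) : 1 / 2 ≤ decay a := by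
  have : (2 : ℝ) ^ (-1 : ℝ) ≤ decay a :=
    Real.rpow_le_rpow_of_exponent_le (by norm_num) (by linarith)
  rwa [Real.rpow_neg_one, ← one_div] at this

/-- With `θ = decay a` the left side is `4 * θ ^ (r + 1) * (1 / 4) ^ (k - (r + 1))`. As `1 / 4 ≤ θ ^
2`, the exponents combine to `k` plus the distance from `k` to `r + 1`, whichever is larger, and
this is summable over `r`. -/
lemma runWeight_sq_mul_le {a : ℝ} (ha : 0 ≤ a) (k r : ℕ) :
    runWeight a k r ^ 2 * (2 * (1 / 2) ^ r) ≤
      4 * decay a ^ k * (decay a ^ (k - (r + 1)) * decay a ^ (r + 1 - k)) := by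
  have e : runWeight a k r ^ 2 * (2 * (1 / 2) ^ r) =
      4 * (decay a ^ (r + 1) * (1 / 4) ^ (k - (r + 1))) := by
    have h1 : decay a ^ (r + 1) = ((2 : ℝ) ^ (a * (r + 1 : ℕ))) ^ 2 * (1 / 2) ^ (r + 1) := by
      rw [decay, ← Real.rpow_natCast, ← Real.rpow_natCast, ← Real.rpow_natCast,
        ← Real.rpow_mul (by norm_num), ← Real.rpow_mul (by norm_num), one_div,
        Real.inv_rpow (by norm_num), ← Real.rpow_neg (by norm_num), ← Real.rpow_add (by norm_num)]
      congr 1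
      push_cast
      ring
    have h2 : ((1 / 4 : ℝ)) ^ (k - (r + 1)) = ((1 / 2) ^ (k - (r + 1))) ^ 2 := by
      rw [← pow_mul, mul_comm, pow_mul]
      norm_num
    rw [h1, h2, runWeight, pow_succ (1 / 2 : ℝ) r]
    ring
  rw [e, mul_assoc]
  refine mul_le_mul_of_nonneg_left ?_ (by norm_num)
  have hd := decay_pos a
  have h4 : (1 / 4 : ℝ) ≤ decay a ^ 2 := by
    have := half_le_decay ha
    nlinarith
  have h5 : (1 / 4 : ℝ) ^ (k - (r + 1)) ≤ decay a ^ (2 * (k - (r + 1))) := by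
    rw [pow_mul]
    gcongr
  refine (mul_le_mul_of_nonneg_left h5 (by positivity)).trans (le_of_eq ?_)
  rw [← pow_add, ← pow_add, ← pow_add]
  congr 1
  omega

lemma sum_decay_le {θ : ℝ} (h0 : 0 < θ) (h1 : θ < 1) (k n : ℕ) :
    ∑ r ∈ Finset.range n, θ ^ (k - (r + 1)) * θ ^ (r + 1 - k) ≤ 2 / (1 - θ) := by
  have hgeo : ∀ m, ∑ r ∈ Finset.range m, θ ^ r ≤ 1 / (1 - θ) := fun m => by
    rw [one_div, ← tsum_geometric_of_lt_one h0.le h1]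
    exact (summable_geometric_of_lt_one h0.le h1).sum_le_tsum _ fun _ _ => by positivity
  calc ∑ r ∈ Finset.range n, θ ^ (k - (r + 1)) * θ ^ (r + 1 - k)
      ≤ ∑ r ∈ Finset.range (k + n), θ ^ (k - (r + 1)) * θ ^ (r + 1 - k) :=
        Finset.sum_le_sum_of_subset_of_nonneg (Finset.range_subset_range.2 (by omega))
          fun _ _ _ => by positivity
    _ = ∑ r ∈ Finset.range k, θ ^ (k - 1 - r) + ∑ r ∈ Finset.range n, θ ^ (r + 1) := by
        rw [Finset.sum_range_add]
        congr 1
        · refine Finset.sum_congr rfl fun r hr => ?_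
          rw [Finset.mem_range] at hr
          rw [(by omega : r + 1 - k = 0), pow_zero, mul_one, Nat.sub_sub, add_comm]
        · refine Finset.sum_congr rfl fun r _ => ?_
          rw [(by omega : k - (k + r + 1) = 0), pow_zero, one_mul]
          congr 1
          omega
    _ ≤ 1 / (1 - θ) + 1 / (1 - θ) := by
        refine add_le_add ?_ ?_
        · rw [Finset.sum_range_reflect (fun r => θ ^ r) k]
          exact hgeo k
        · refine (Finset.sum_le_sum fun r _ => ?_).trans (hgeo n)
          exact pow_le_pow_of_le_one h0.le h1.le (by omega)
    _ = 2 / (1 - θ) := by ring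

lemma lintegral_runBound_le {a : ℝ} (ha : 0 ≤ a) (ha' : a < 1 / 2) (k : ℕ) :
    ∫⁻ x, runBound a k x ∂coins ℕ ≤ ENNReal.ofReal (8 / (1 - decay a) * decay a ^ k) := by
  unfold runBound
  rw [lintegral_tsum fun r =>
    (measurable_const.indicator (measurableSet_runSet r)).aemeasurable]
  refine ENNReal.tsum_le_of_sum_range_le fun n => ?_
  have hd := decay_pos a
  have hd' := decay_lt_one ha'
  calc ∑ r ∈ Finset.range n,
        ∫⁻ x, (runSet r).indicator (fun _ => ENNReal.ofReal (runWeight a k r ^ 2)) x ∂coins ℕ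
      ≤ ∑ r ∈ Finset.range n, ENNReal.ofReal
          (4 * decay a ^ k * (decay a ^ (k - (r + 1)) * decay a ^ (r + 1 - k))) := by
        refine Finset.sum_le_sum fun r _ => ?_
        rw [lintegral_indicator_const (measurableSet_runSet r)]
        refine (mul_le_mul_right (coins_runSet_le r) _).trans ?_
        rw [← ENNReal.ofReal_mul (by positivity)]
        exact ENNReal.ofReal_le_ofReal (runWeight_sq_mul_le ha k r)
    _ = ENNReal.ofReal (4 * decay a ^ k * ∑ r ∈ Finset.range n,
          (decay a ^ (k - (r + 1)) * decay a ^ (r + 1 - k))) := by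
        rw [Finset.mul_sum, ENNReal.ofReal_sum_of_nonneg fun r _ => by positivity]
    _ ≤ _ := by
        refine ENNReal.ofReal_le_ofReal ?_
        refine (mul_le_mul_of_nonneg_left (sum_decay_le hd hd' k n) (by positivity)).trans
          (le_of_eq ?_)
        ring

end MLDLQMC

namespace MLDLQMC

/-! ### Functions with boundary growth -/

variable {d : ℕ}

/-- The mixed first-order partial derivatives `D` of `φ` grow at the boundary of the unit cube at
most like powers with exponents `-a` and `-a - 1`. -/
structure GrowthBound (φ : (Fin d → ℝ) → ℝ) (D : Finset (Fin d) → (Fin d → ℝ) → ℝ) (b a : ℝ) :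
    Prop where
  partials : HasMixedPartials φ D
  nonneg : 0 ≤ b
  bound : ∀ u, ∀ y ∈ openCube d,
    |D u y| ≤ b * ∏ i, min (y i) (1 - y i) ^ (-a - if i ∈ u then (1 : ℝ) else 0)

lemma min_pos_of_mem {y : Fin d → ℝ} (hy : y ∈ openCube d) (i : Fin d) :
    0 < min (y i) (1 - y i) := lt_min (hy i).1 (by linarith [(hy i).2])

/-- Distances to the boundary are below one, so replacing each exponent by the largest one only
weakens the bound. -/
lemma BoundaryGrowth.growthBound {φ : (Fin d → ℝ) → ℝ} {b : ℝ} {A : Fin d → ℝ} (hb : 0 ≤ b)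
    (h : BoundaryGrowth φ b A) : ∃ D, GrowthBound φ D b (⨆ i, A i) := by
  obtain ⟨D, h1, h2⟩ := h
  refine ⟨D, h1, hb, fun u y hy => (h2 u y hy).trans (mul_le_mul_of_nonneg_left ?_ hb)⟩
  refine Finset.prod_le_prod (fun i _ => (Real.rpow_pos_of_pos (min_pos_of_mem hy i) _).le)
    fun i _ => ?_
  refine Real.rpow_le_rpow_of_exponent_ge (min_pos_of_mem hy i)
    ((min_le_left _ _).trans (hy i).2.le) ?_
  have := le_ciSup (Set.finite_range A).bddAbove i
  linarith

lemma update_mem_openCube {y : Fin d → ℝ} (hy : y ∈ openCube d) (j : Fin d) {t : ℝ}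
    (ht : t ∈ Set.Ioo (0 : ℝ) 1) : Function.update y j t ∈ openCube d := by
  intro i
  by_cases h : i = j
  · subst h
    simpa using ht
  · simpa [h] using hy i

lemma piecewise_mem_openCube {p q : Fin d → ℝ} (hp : p ∈ openCube d) (hq : q ∈ openCube d)
    (v : Finset (Fin d)) : v.piecewise q p ∈ openCube d := by
  intro i
  by_cases h : i ∈ v
  · simpa [h] using hq i
  · simpa [h] using hp i

variable {φ : (Fin d → ℝ) → ℝ} {D : Finset (Fin d) → (Fin d → ℝ) → ℝ} {b a : ℝ}

lemma GrowthBound.hasDerivAt_update (h : GrowthBound φ D b a) {w : Finset (Fin d)} {j : Fin d}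
    (hj : j ∉ w) {y : Fin d → ℝ} (hy : y ∈ openCube d) {t : ℝ} (ht : t ∈ Set.Ioo (0 : ℝ) 1) :
    HasDerivAt (fun s => D w (Function.update y j s)) (D (insert j w) (Function.update y j t)) t := by
  have := h.partials.2 w j hj _ (update_mem_openCube hy j ht)
  simpa using this

/-- Bound for mixed differences in the coordinates of `u`. -/
lemma GrowthBound.abs_mixed_difference_le (h : GrowthBound φ D b a) {q : Fin d → ℝ}
    (hq : q ∈ openCube d) {ω : Fin d → ℝ} (hω : ∀ i, 0 ≤ ω i) (u : Finset (Fin d)) :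
    -- The induction moves one coordinate of `p` and adds it to the set `w` of differentiated
    -- variables, so both stay general.
    ∀ (p : Fin d → ℝ), p ∈ openCube d → (∀ i ∈ u, SegBound a (p i) (q i) (ω i)) →
      ∀ w : Finset (Fin d), Disjoint u w →
      |∑ v ∈ u.powerset, (-1) ^ v.card * D w (v.piecewise q p)| ≤
        b * ∏ i, if i ∈ u then ω i
          else min (p i) (1 - p i) ^ (-a - if i ∈ w then (1 : ℝ) else 0) := by
  induction u using Finset.induction_on with
  | empty =>
    intro p hp _ w _
    simpa using h.bound w p hp
  | insert j u hju ih =>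
    intro p hp hseg w hw
    have hjw : j ∉ w := fun hj => Finset.disjoint_left.1 hw (Finset.mem_insert_self _ _) hj
    have huw : Disjoint u w := hw.mono_left (Finset.subset_insert _ _)
    have huw' : Disjoint u (insert j w) := Finset.disjoint_insert_right.2 ⟨hju, huw⟩
    have hpw : ∀ v ∈ u.powerset, ∀ t,
        v.piecewise q (Function.update p j t) = Function.update (v.piecewise q p) j t := by
      intro v hv t
      exact (Finset.update_piecewise_of_notMem _ _ _
        (fun hj => hju (Finset.mem_powerset.1 hv hj)) _).symm
    set g : Finset (Fin d) → ℝ → ℝ := fun w t => ∑ v ∈ u.powerset,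
      (-1) ^ v.card * D w (v.piecewise q (Function.update p j t)) with hg
    set K := b * ∏ i ∈ Finset.univ.erase j, (if i ∈ u then ω i
      else min (p i) (1 - p i) ^ (-a - if i ∈ w then (1 : ℝ) else 0)) with hK
    have hK0 : 0 ≤ K := by
      refine mul_nonneg h.nonneg (Finset.prod_nonneg fun i _ => ?_)
      split_ifs
      · exact hω i
      all_goals exact (Real.rpow_pos_of_pos (min_pos_of_mem hp i) _).le
    have hbound : ∀ w' : Finset (Fin d), Disjoint u w' → (∀ i, i ≠ j → (i ∈ w' ↔ i ∈ w)) →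
        ∀ t ∈ Set.Ioo (0 : ℝ) 1,
        |g w' t| ≤ K * min t (1 - t) ^ (-a - if j ∈ w' then (1 : ℝ) else 0) := by
      intro w' hd hw' t ht
      refine (ih (Function.update p j t) (update_mem_openCube hp j ht) (fun i hi => ?_) w' hd).trans
        (le_of_eq ?_)
      · rw [Function.update_of_ne (by rintro rfl; exact hju hi)]
        exact hseg i (Finset.mem_insert_of_mem hi)
      · rw [hK, ← Finset.prod_erase_mul _ _ (Finset.mem_univ j), mul_assoc, if_neg hju,
          Function.update_self]
        congr 2
        refine Finset.prod_congr rfl fun i hi => ?_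
        rw [Function.update_of_ne (Finset.ne_of_mem_erase hi)]
        simp only [hw' i (Finset.ne_of_mem_erase hi)]
    -- As functions of coordinate `j`, the mixed difference in `u` of `D w` has as derivative that
    -- of `D (insert j w)`. The induction hypothesis bounds both, with the factors of the other
    -- coordinates collected in `K`.
    have hmain := hseg j (Finset.mem_insert_self _ _) (g w) (g (insert j w)) K hK0 ?_ ?_ ?_
    · have e : ∑ v ∈ (insert j u).powerset, (-1) ^ v.card * D w (v.piecewise q p) =
          g w (p j) - g w (q j) := by
        rw [Finset.sum_powerset_insert hju, hg, sub_eq_add_neg, ← Finset.sum_neg_distrib]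
        congr 1
        · simp only [Function.update_eq_self]
        · refine Finset.sum_congr rfl fun v hv => ?_
          rw [Finset.card_insert_of_notMem (fun hj => hju (Finset.mem_powerset.1 hv hj)),
            Finset.piecewise_insert, hpw v hv, pow_succ]
          ring
      rw [e]
      refine hmain.trans (le_of_eq ?_)
      rw [hK, ← Finset.prod_erase_mul _ _ (Finset.mem_univ j), mul_assoc,
        if_pos (Finset.mem_insert_self _ _)]
      congr 2
      refine Finset.prod_congr rfl fun i hi => ?_
      simp only [Finset.mem_insert, Finset.ne_of_mem_erase hi, false_or]
    · intro t ht
      refine HasDerivAt.fun_sum fun v hv => HasDerivAt.const_mul _ ?_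
      simp only [hpw v hv]
      exact h.hasDerivAt_update hjw (piecewise_mem_openCube hp hq v) ht
    · intro t ht
      have := hbound w huw (fun _ _ => Iff.rfl) t ht
      rwa [if_neg hjw, sub_zero] at this
    · intro t ht
      have := hbound (insert j w) huw'
        (fun i hi => by simp [hi]) t ht
      rwa [if_pos (Finset.mem_insert_self _ _)] at this

lemma isOpen_openCube : IsOpen (openCube d) := by
  have : openCube d = Set.pi Set.univ fun _ => Set.Ioo (0 : ℝ) 1 := by
    ext y
    simp [openCube]
  rw [this]
  exact isOpen_set_pi Set.finite_univ fun _ _ => isOpen_Ioo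

/-- The first partial derivatives are locally bounded, so changing the coordinates one at a time
gives a local Lipschitz bound. Continuity yields measurability and the pointwise convergence of cell
means. -/
lemma GrowthBound.continuousOn (ha : 0 ≤ a) (h : GrowthBound φ D b a) :
    ContinuousOn φ (openCube d) := by
  refine fun y hy => ContinuousAt.continuousWithinAt ?_
  obtain ⟨δ, hδ, hδy⟩ : ∃ δ > 0, ∀ i, 2 * δ ≤ min (y i) (1 - y i) := by
    have hne : ∀ᶠ δ in 𝓝[>] (0 : ℝ), ∀ i, 2 * δ ≤ min (y i) (1 - y i) := by
      refine eventually_all.2 fun i => ?_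
      have : Tendsto (fun δ : ℝ => 2 * δ) (𝓝[>] 0) (𝓝 0) := by
        have h0 : Continuous fun δ : ℝ => 2 * δ := by fun_prop
        simpa using (h0.tendsto 0).mono_left nhdsWithin_le_nhds
      exact this.eventually (ge_mem_nhds (min_pos_of_mem hy i))
    obtain ⟨δ, h1, h2⟩ := (hne.and self_mem_nhdsWithin).exists
    exact ⟨δ, h2, h1⟩
  set M := b * (min δ 1 ^ (-a - 1)) ^ d with hM
  have hδ1 : 0 < min δ 1 := lt_min hδ one_pos
  have hM0 : 0 ≤ M := mul_nonneg h.nonneg (pow_nonneg (Real.rpow_nonneg hδ1.le _) _)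
  have hball : ∀ x : Fin d → ℝ, (∀ i, |x i - y i| ≤ δ) → ∀ i, δ ≤ min (x i) (1 - x i) := by
    intro x hx i
    have h1 := abs_le.1 (hx i)
    have h2 := le_min_iff.1 (hδy i)
    exact le_min (by linarith) (by linarith)
  have hmem : ∀ x : Fin d → ℝ, (∀ i, |x i - y i| ≤ δ) → x ∈ openCube d := fun x hx i =>
    mem_Ioo_of_min hδ (hball x hx i)
  have hD : ∀ u, ∀ x : Fin d → ℝ, (∀ i, |x i - y i| ≤ δ) → |D u x| ≤ M := by
    intro u x hx
    refine (h.bound u x (hmem x hx)).trans (mul_le_mul_of_nonneg_left ?_ h.nonneg)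
    calc ∏ i, min (x i) (1 - x i) ^ (-a - if i ∈ u then (1 : ℝ) else 0)
        ≤ ∏ _i : Fin d, min δ 1 ^ (-a - 1) := by
          refine Finset.prod_le_prod
            (fun i _ => Real.rpow_nonneg (min_pos_of_mem (hmem x hx) i).le _) fun i _ => ?_
          have hexp : -a - 1 ≤ -a - if i ∈ u then (1 : ℝ) else 0 := by split_ifs <;> linarith
          have hexp' : -a - (if i ∈ u then (1 : ℝ) else 0) ≤ 0 := by split_ifs <;> linarith
          exact (Real.rpow_le_rpow_of_nonpos hδ1 ((min_le_left _ _).trans (hball x hx i))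
            hexp').trans (Real.rpow_le_rpow_of_exponent_ge hδ1 (min_le_right _ _) hexp)
      _ = _ := by simp
  have hlip : ∀ x : Fin d → ℝ, (∀ i, |x i - y i| ≤ δ) → ∀ s : Finset (Fin d),
      |D ∅ (s.piecewise x y) - D ∅ y| ≤ M * ∑ i ∈ s, |x i - y i| := by
    intro x hx s
    induction s using Finset.induction_on with
    | empty => simp
    | insert j s hj ih =>
      set z := s.piecewise x y with hz
      have hzj : z j = y j := by simp [hz, hj]
      have hzδ : ∀ i, |z i - y i| ≤ δ := by
        intro i
        by_cases hi : i ∈ s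
        · simpa [hz, hi] using hx i
        · simp [hz, hi, hδ.le]
      have hup : ∀ t ∈ Set.Icc (y j - δ) (y j + δ), ∀ i, |Function.update z j t i - y i| ≤ δ := by
        intro t ht i
        by_cases hi : i = j
        · subst hi
          rw [Function.update_self, abs_le]
          exact ⟨by linarith [ht.1], by linarith [ht.2]⟩
        · rw [Function.update_of_ne hi]
          exact hzδ i
      have h1 := Convex.norm_image_sub_le_of_norm_hasDerivWithin_le
        (f := fun t => D ∅ (Function.update z j t))
        (f' := fun t => D (insert j ∅) (Function.update z j t))
        (s := Set.Icc (y j - δ) (y j + δ)) (C := M) (x := y j) (y := x j)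
        (fun t ht => by
          have := h.hasDerivAt_update (w := ∅) (j := j) (by simp) (hmem z hzδ) (t := t) (by
            have := hmem _ (hup t ht) j
            rwa [Function.update_self] at this)
          exact this.hasDerivWithinAt)
        (fun t ht => hD _ _ (hup t ht)) (convex_Icc _ _)
        ⟨by linarith, by linarith⟩
        (by
          have := abs_le.1 (hx j)
          exact ⟨by linarith, by linarith⟩)
      have hupdz : Function.update z j (y j) = z := by rw [← hzj, Function.update_eq_self]
      simp only [hupdz, Real.norm_eq_abs] at h1
      rw [Finset.piecewise_insert, Finset.sum_insert hj, mul_add]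
      refine (abs_sub_le _ (D ∅ z) _).trans (add_le_add h1 ih)
  have hφ : ∀ᶠ x in 𝓝 y, |φ x - φ y| ≤ M * ∑ i, |x i - y i| := by
    have hev : ∀ᶠ x in 𝓝 y, ∀ i, |x i - y i| ≤ δ := by
      refine eventually_all.2 fun i => ?_
      have : Tendsto (fun x : Fin d → ℝ => |x i - y i|) (𝓝 y) (𝓝 0) := by
        have h0 : Continuous fun x : Fin d → ℝ => |x i - y i| := by fun_prop
        simpa using h0.tendsto y
      exact this.eventually (ge_mem_nhds hδ)
    filter_upwards [hev] with x hx
    rw [← h.partials.1 x (hmem x hx), ← h.partials.1 y hy]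
    simpa using hlip x hx Finset.univ
  have hlim : Tendsto (fun x : Fin d → ℝ => M * ∑ i, |x i - y i|) (𝓝 y) (𝓝 0) := by
    have h0 : Continuous fun x : Fin d → ℝ => M * ∑ i, |x i - y i| := by fun_prop
    simpa using h0.tendsto y
  refine tendsto_iff_norm_sub_tendsto_zero.2 (squeeze_zero' (Eventually.of_forall fun _ =>
    norm_nonneg _) ?_ hlim)
  exact hφ

end MLDLQMC

namespace MLDLQMC

/-! ### Haar components of functions with boundary growth -/

variable {d : ℕ}

/-- The point of the unit cube with given binary digits. -/
noncomputable def realPoint (x : Digits d) : Fin d → ℝ := fun j => ofDigits fun r => x (j, r)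

lemma measurable_coord (i : Fin d) : Measurable fun (x : Digits d) (r : ℕ) => x (i, r) := by
  fun_prop

lemma measurable_realPoint : Measurable (realPoint (d := d)) :=
  measurable_pi_iff.2 fun i => measurable_ofDigits.comp (measurable_coord i)

/-- Both digits occur infinitely often in every coordinate. -/
def IsGeneric (x : Digits d) : Prop := ∀ (i : Fin d) (n : ℕ) (c : ZMod 2), ∃ r ≥ n, x (i, r) = c

lemma ae_isGeneric : ∀ᵐ x ∂coins (Fin d × ℕ), IsGeneric x := by
  refine ae_all_iff.2 fun i => ae_all_iff.2 fun n => ae_all_iff.2 fun c => ?_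
  rw [ae_iff]
  have hle : ∀ M : ℕ, coins (Fin d × ℕ) {x | ¬ ∃ r ≥ n, x (i, r) = c} ≤ (1 / 2) ^ M := by
    intro M
    have h := coins_cylinder ((Finset.Ico n (n + M)).map
      ⟨fun r => (i, r), fun a b h => by simpa using h⟩ : Finset (Fin d × ℕ)) fun _ => 1 + c
    rw [Finset.card_map, Nat.card_Ico, Nat.add_sub_cancel_left] at h
    rw [← h]
    refine measure_mono fun x hx p hp => ?_
    have hb : ∀ a c : ZMod 2, a ≠ c → a = 1 + c := by decide
    obtain ⟨r, hr, rfl⟩ := Finset.mem_map.1 hp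
    refine hb _ _ fun hc => hx ⟨r, (Finset.mem_Ico.1 hr).1, hc⟩
  have hlim : Tendsto (fun M : ℕ => (1 / 2 : ENNReal) ^ M) atTop (𝓝 0) :=
    ENNReal.tendsto_pow_atTop_nhds_zero_of_lt_one (by
      rw [one_div]
      exact ENNReal.inv_lt_one.2 (by norm_num))
  exact le_antisymm (ge_of_tendsto' hlim hle) zero_le

lemma IsGeneric.merge {z : Digits d} (hz : IsGeneric z) (κ : Fin d → ℕ) (y : Digits d) :
    IsGeneric (merge κ y z) := by
  intro i n c
  obtain ⟨r, hr, h⟩ := hz i (max n (κ i)) c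
  refine ⟨r, (le_max_left _ _).trans hr, ?_⟩
  have : ¬ r < κ i := not_lt.2 ((le_max_right _ _).trans hr)
  simpa [MLDLQMC.merge, this] using h

lemma IsGeneric.exists_ne {x : Digits d} (hx : IsGeneric x) (i : Fin d) :
    ∃ r, (fun r => x (i, r)) r ≠ (fun r => x (i, r)) 0 := by
  obtain ⟨r, -, h⟩ := hx i 0 (1 + x (i, 0))
  refine ⟨r, ?_⟩
  have hb : ∀ a : ZMod 2, 1 + a ≠ a := by decide
  simp only [h]
  exact hb _

lemma IsGeneric.realPoint_mem {x : Digits d} (hx : IsGeneric x) : realPoint x ∈ openCube d :=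
  fun i => mem_Ioo_of_min (by positivity) (min_ofDigits_ge (ne_runLength (hx.exists_ne i)))

/-- A function on the open unit cube as a function of binary digits. -/
noncomputable def digitFun (φ : (Fin d → ℝ) → ℝ) (x : Digits d) : ℝ :=
  (openCube d).indicator φ (realPoint x)

lemma IsGeneric.digitFun_eq {x : Digits d} (hx : IsGeneric x) (φ : (Fin d → ℝ) → ℝ) :
    digitFun φ x = φ (realPoint x) := Set.indicator_of_mem hx.realPoint_mem φ

variable {φ : (Fin d → ℝ) → ℝ} {D : Finset (Fin d) → (Fin d → ℝ) → ℝ} {b a : ℝ}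

lemma GrowthBound.measurable_digitFun (ha : 0 ≤ a) (h : GrowthBound φ D b a) :
    Measurable (digitFun φ) := by
  classical
  refine Measurable.comp (g := (openCube d).indicator φ) ?_ measurable_realPoint
  have := (h.continuousOn ha).measurable_piecewise (g := 0) continuousOn_const
    isOpen_openCube.measurableSet
  rwa [Set.piecewise_eq_indicator] at this

/-- The mixed difference whose mean over `z` is the Haar component of level `κ` at `y`. -/
noncomputable def mixedDiff (f : Digits d → ℝ) (κ : Fin d → ℕ) (y z : Digits d) : ℝ :=
  ∑ v ∈ (levelSupport κ).powerset, (-1) ^ v.card * f (merge (lower κ v) y z)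

/-- The points of the mixed difference are the corners of a box spanned by two points that differ,
in each coordinate of positive level, at most in the digit `κ i - 1`. -/
lemma realPoint_merge_lower (κ : Fin d → ℕ) (v : Finset (Fin d)) (y z : Digits d) :
    realPoint (merge (lower κ v) y z) =
      v.piecewise (realPoint (merge (lower κ Finset.univ) y z)) (realPoint (merge κ y z)) := by
  funext i
  by_cases hi : i ∈ v <;> simp [realPoint, merge, lower, hi]

/-- A coordinate of positive level contributes the bound for changing one digit; a coordinate of
level zero contributes the growth of the function itself. -/
lemma GrowthBound.abs_mixedDiff_le (ha : 0 ≤ a) (h : GrowthBound φ D b a) (κ : Fin d → ℕ)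
    (y : Digits d) {z : Digits d} (hz : IsGeneric z) :
    |mixedDiff (digitFun φ) κ y z| ≤ b * ∏ i,
      (2 * (runWeight a (κ i) (runLength fun r => merge κ y z (i, r)) +
        runWeight a (κ i) (runLength fun r => merge (lower κ Finset.univ) y z (i, r)))) := by
  have hx := hz.merge κ y
  have hx' := hz.merge (lower κ Finset.univ) y
  set ω : Fin d → ℝ := fun i =>
    2 * (runWeight a (κ i) (runLength fun r => merge κ y z (i, r)) +
        runWeight a (κ i) (runLength fun r => merge (lower κ Finset.univ) y z (i, r))) with hω
  have hω0 : ∀ i, 0 ≤ ω i := fun i => by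
    have h1 := runWeight_pos a (κ i) (runLength fun r => merge κ y z (i, r))
    have h2 := runWeight_pos a (κ i)
      (runLength fun r => merge (lower κ Finset.univ) y z (i, r))
    simp only [hω]
    positivity
  have h1 := h.abs_mixed_difference_le hx'.realPoint_mem hω0 (levelSupport κ) _
    hx.realPoint_mem (fun i hi => ?_) ∅ (Finset.disjoint_empty_right _)
  · have e : mixedDiff (digitFun φ) κ y z = ∑ v ∈ (levelSupport κ).powerset,
        (-1) ^ v.card * D ∅ (v.piecewise (realPoint (merge (lower κ Finset.univ) y z))
          (realPoint (merge κ y z))) := by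
      refine Finset.sum_congr rfl fun v _ => ?_
      rw [← realPoint_merge_lower, (hz.merge _ y).digitFun_eq,
        h.partials.1 _ (hz.merge _ y).realPoint_mem]
    rw [e]
    refine h1.trans (mul_le_mul_of_nonneg_left (Finset.prod_le_prod (fun i _ => ?_) fun i _ => ?_)
      h.nonneg)
    · split_ifs
      · exact hω0 i
      all_goals exact (Real.rpow_pos_of_pos (min_pos_of_mem hx.realPoint_mem i) _).le
    · by_cases hi : i ∈ levelSupport κ
      · rw [if_pos hi]
      · rw [if_neg hi, if_neg (Finset.notMem_empty i), sub_zero]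
        have hκ : κ i = 0 := by simpa using hi
        refine (min_rpow_le_runWeight ha (hx.exists_ne i)).trans ?_
        have h1 := runWeight_pos a 0 (runLength fun r => merge κ y z (i, r))
        have h2 := runWeight_pos a 0
          (runLength fun r => merge (lower κ Finset.univ) y z (i, r))
        simp only [hκ]
        linarith
  · have hκ : κ i ≠ 0 := by simpa using hi
    have := segBound_runWeight ha (x := fun r => merge κ y z (i, r))
      (x' := fun r => merge (lower κ Finset.univ) y z (i, r)) (k := κ i - 1) (fun r hr => by
        simp only [MLDLQMC.merge, lower, if_pos (Finset.mem_univ i)]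
        split_ifs <;> first | rfl | omega) (hx.exists_ne i) (hx'.exists_ne i)
    rwa [Nat.sub_add_cancel (Nat.pos_of_ne_zero hκ)] at this

/-- Expanding the product over subsets `v` makes each term a function of the single point `merge
(lower κ v) y z`, which is uniformly distributed. -/
lemma GrowthBound.enorm_mixedDiff_sq_le (ha : 0 ≤ a) (h : GrowthBound φ D b a) (κ : Fin d → ℕ)
    (y : Digits d) {z : Digits d} (hz : IsGeneric z) :
    ‖mixedDiff (digitFun φ) κ y z‖ₑ ^ 2 ≤ ENNReal.ofReal (b ^ 2 * 8 ^ d) *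
      ∑ v : Finset (Fin d), ∏ i, runBound a (κ i) fun r => merge (lower κ v) y z (i, r) := by
  have h1 := h.abs_mixedDiff_le ha κ y hz
  rw [Real.enorm_eq_ofReal_abs, ← ENNReal.ofReal_pow (abs_nonneg _)]
  set p : Fin d → ℝ := fun i => runWeight a (κ i) (runLength fun r => merge κ y z (i, r)) with hp
  set q : Fin d → ℝ := fun i =>
    runWeight a (κ i) (runLength fun r => merge (lower κ Finset.univ) y z (i, r)) with hq
  have h2 : |mixedDiff (digitFun φ) κ y z| ^ 2 ≤ b ^ 2 * 8 ^ d * ∏ i, (q i ^ 2 + p i ^ 2) := by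
    refine (pow_le_pow_left₀ (abs_nonneg _) h1 2).trans ?_
    rw [mul_pow, mul_assoc]
    refine mul_le_mul_of_nonneg_left ?_ (sq_nonneg b)
    have e : (8 : ℝ) ^ d * ∏ i, (q i ^ 2 + p i ^ 2) = ∏ i, (8 * (q i ^ 2 + p i ^ 2)) := by
      rw [Finset.prod_mul_distrib, Finset.prod_const, Finset.card_univ, Fintype.card_fin]
    rw [e, ← Finset.prod_pow]
    refine Finset.prod_le_prod (fun i _ => sq_nonneg _) fun i _ => ?_
    change (2 * (p i + q i)) ^ 2 ≤ _
    nlinarith [sq_nonneg (p i - q i)]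
  refine (ENNReal.ofReal_le_ofReal h2).trans ?_
  rw [ENNReal.ofReal_mul (by positivity), ENNReal.ofReal_prod_of_nonneg fun i _ => by positivity]
  refine mul_le_mul_right ?_ _
  calc ∏ i, ENNReal.ofReal (q i ^ 2 + p i ^ 2)
      ≤ ∏ i, (runBound a (κ i) (fun r => merge (lower κ Finset.univ) y z (i, r)) +
          runBound a (κ i) fun r => merge κ y z (i, r)) := by
        refine Finset.prod_le_prod' fun i _ => ?_
        rw [ENNReal.ofReal_add (sq_nonneg _) (sq_nonneg _)]
        exact add_le_add (le_runBound _ _ _) (le_runBound _ _ _)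
    _ = ∑ v : Finset (Fin d), ∏ i, runBound a (κ i) fun r => merge (lower κ v) y z (i, r) := by
        rw [Finset.prod_add, Finset.powerset_univ]
        refine Finset.sum_congr rfl fun v _ => ?_
        rw [← Finset.prod_sdiff (Finset.subset_univ v), mul_comm]
        congr 1
        · refine Finset.prod_congr rfl fun i hi => ?_
          have hi' : i ∉ v := (Finset.mem_sdiff.1 hi).2
          simp [merge, lower, hi']
        · refine Finset.prod_congr rfl fun i hi => ?_
          simp [merge, lower, hi]

/-- The constant in the bound for the variances of the Haar components. -/
noncomputable def haarConst (a : ℝ) : ℝ := 128 / (1 - decay a)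

lemma measurable_mixedDiff {f : Digits d → ℝ} (hf : Measurable f) (κ : Fin d → ℕ) :
    Measurable fun q : Digits d × Digits d => mixedDiff f κ q.1 q.2 :=
  Finset.measurable_sum _ fun _ _ => (hf.comp (measurable_merge _)).const_mul _

lemma GrowthBound.lintegral_mixedDiff_le (ha : 0 ≤ a) (ha' : a < 1 / 2) (h : GrowthBound φ D b a)
    (κ : Fin d → ℕ) :
    ∫⁻ y, ∫⁻ z, ‖mixedDiff (digitFun φ) κ y z‖ₑ ^ 2 ∂coins (Fin d × ℕ) ∂coins (Fin d × ℕ) ≤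
      ENNReal.ofReal (b ^ 2 * haarConst a ^ d * decay a ^ ∑ i, κ i) := by
  have hd := decay_pos a
  have hd' := decay_lt_one ha'
  have hpos : 0 < 8 / (1 - decay a) := div_pos (by norm_num) (by linarith)
  have hmeas : Measurable fun x : Digits d => ∏ i, runBound a (κ i) fun r => x (i, r) :=
    Finset.measurable_prod _ fun i _ => (measurable_runBound a (κ i)).comp (measurable_coord i)
  have hmeas' : ∀ v : Finset (Fin d), Measurable fun p : Digits d × Digits d =>
      ∏ i, runBound a (κ i) fun r => merge (lower κ v) p.1 p.2 (i, r) := fun v =>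
    hmeas.comp (measurable_merge (lower κ v))
  calc _ ≤ ∫⁻ y, ∫⁻ z, ENNReal.ofReal (b ^ 2 * 8 ^ d) * ∑ v : Finset (Fin d),
          ∏ i, runBound a (κ i) fun r => merge (lower κ v) y z (i, r)
            ∂coins (Fin d × ℕ) ∂coins (Fin d × ℕ) := by
        refine lintegral_mono fun y => lintegral_mono_ae ?_
        filter_upwards [ae_isGeneric] with z hz
        exact h.enorm_mixedDiff_sq_le ha κ y hz
    _ = ∫⁻ p, ENNReal.ofReal (b ^ 2 * 8 ^ d) * ∑ v : Finset (Fin d),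
          ∏ i, runBound a (κ i) fun r => merge (lower κ v) p.1 p.2 (i, r)
            ∂((coins (Fin d × ℕ)).prod (coins (Fin d × ℕ))) := by
        exact (lintegral_prod (fun p : Digits d × Digits d => ENNReal.ofReal (b ^ 2 * 8 ^ d) *
          ∑ v : Finset (Fin d), ∏ i, runBound a (κ i) fun r => merge (lower κ v) p.1 p.2 (i, r))
          ((Finset.measurable_sum _ fun v _ => hmeas' v).const_mul _).aemeasurable).symm
    _ = ENNReal.ofReal (b ^ 2 * 8 ^ d) * ∑ v : Finset (Fin d),
          ∏ i, ∫⁻ x, runBound a (κ i) x ∂coins ℕ := by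
        rw [lintegral_const_mul _ (Finset.measurable_sum _ fun v _ => hmeas' v),
          lintegral_finsetSum _ fun v _ => hmeas' v]
        congr 1
        refine Finset.sum_congr rfl fun v _ => ?_
        rw [← lintegral_coins_prod _ fun i => measurable_runBound a (κ i)]
        exact (measurePreserving_merge (lower κ v)).lintegral_comp hmeas
    _ ≤ ENNReal.ofReal (b ^ 2 * 8 ^ d) * ∑ v : Finset (Fin d),
          ∏ i, ENNReal.ofReal (8 / (1 - decay a) * decay a ^ κ i) := by
        gcongr with v _ i _
        exact lintegral_runBound_le ha ha' (κ i)
    _ = _ := by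
        rw [Finset.sum_const, Finset.card_univ, Fintype.card_finset, Fintype.card_fin,
          ← ENNReal.ofReal_prod_of_nonneg fun i _ => by positivity, nsmul_eq_mul,
          Finset.prod_mul_distrib, Finset.prod_const, Finset.card_univ, Fintype.card_fin,
          Finset.prod_pow_eq_pow_sum, ← ENNReal.ofReal_natCast, ← ENNReal.ofReal_mul (by positivity),
          ← ENNReal.ofReal_mul (by positivity)]
        congr 1
        -- The factors are `8` from squaring a doubled sum, `2` per coordinate from the number of
        -- subsets, and `8 / (1 - decay a)` from the run weights.
        have e : haarConst a = 8 * (2 * (8 / (1 - decay a))) := by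
          rw [haarConst]
          ring
        rw [e, mul_pow, mul_pow]
        push_cast
        ring

lemma eLpNorm_two_sq {α : Type*} [MeasurableSpace α] (μ : Measure α) (f : α → ℝ) :
    eLpNorm f 2 μ ^ 2 = ∫⁻ x, ‖f x‖ₑ ^ 2 ∂μ := by
  have := eLpNorm_nnreal_pow_eq_lintegral (f := f) (μ := μ) (p := 2) (by norm_num)
  simpa using this

lemma enorm_integral_sq_le {α : Type*} [MeasurableSpace α] {μ : Measure α} [IsProbabilityMeasure μ]
    {f : α → ℝ} (hf : AEStronglyMeasurable f μ) :
    ‖∫ x, f x ∂μ‖ₑ ^ 2 ≤ ∫⁻ x, ‖f x‖ₑ ^ 2 ∂μ := by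
  rw [← eLpNorm_two_sq]
  gcongr
  refine (enorm_integral_le_lintegral_enorm f).trans ?_
  rw [← eLpNorm_one_eq_lintegral_enorm]
  exact eLpNorm_le_eLpNorm_of_exponent_le (by norm_num) hf

lemma memLp_two_of_lintegral_le {α : Type*} [MeasurableSpace α] {μ : Measure α} {f : α → ℝ}
    (hf : AEStronglyMeasurable f μ) {c : ℝ} (h : ∫⁻ x, ‖f x‖ₑ ^ 2 ∂μ ≤ ENNReal.ofReal c) :
    MemLp f 2 μ := by
  refine ⟨hf, ?_⟩
  rw [← eLpNorm_two_sq] at h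
  by_contra htop
  rw [not_lt, top_le_iff] at htop
  rw [htop] at h
  simp at h

lemma integral_sq_le_of_lintegral_le {α : Type*} [MeasurableSpace α] {μ : Measure α} {f : α → ℝ}
    (hf : AEStronglyMeasurable f μ) {c : ℝ} (hc : 0 ≤ c)
    (h : ∫⁻ x, ‖f x‖ₑ ^ 2 ∂μ ≤ ENNReal.ofReal c) : ∫ x, f x ^ 2 ∂μ ≤ c := by
  rw [integral_eq_lintegral_of_nonneg_ae (Eventually.of_forall fun _ => sq_nonneg _) (hf.pow 2)]
  refine ENNReal.toReal_le_of_le_ofReal hc (le_trans (le_of_eq (lintegral_congr fun x => ?_)) h)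
  rw [Real.enorm_eq_ofReal_abs, ← ENNReal.ofReal_pow (abs_nonneg _), sq_abs]

lemma eLpNorm_two_le {α : Type*} [MeasurableSpace α] {μ : Measure α} {f : α → ℝ}
    (hf : MemLp f 2 μ) {c : ℝ} (hc : 0 ≤ c) (h : ∫ x, f x ^ 2 ∂μ ≤ c ^ 2) :
    eLpNorm f 2 μ ≤ ENNReal.ofReal c := by
  have h1 : eLpNorm f 2 μ ^ 2 ≤ ENNReal.ofReal c ^ 2 := by
    rw [eLpNorm_two_sq, ← ENNReal.ofReal_pow hc]
    refine le_trans (le_of_eq ?_) (ENNReal.ofReal_le_ofReal h)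
    rw [ofReal_integral_eq_lintegral_ofReal hf.integrable_sq
      (Eventually.of_forall fun _ => sq_nonneg _)]
    refine lintegral_congr fun x => ?_
    rw [Real.enorm_eq_ofReal_abs, ← ENNReal.ofReal_pow (abs_nonneg _), sq_abs]
  exact (ENNReal.pow_le_pow_left_iff two_ne_zero).1 h1

lemma mixedDiff_zero (f : Digits d → ℝ) (y z : Digits d) : mixedDiff f (fun _ => 0) y z = f z := by
  have : levelSupport (fun _ : Fin d => 0) = ∅ := by ext; simp
  simp only [mixedDiff, this, Finset.powerset_empty, Finset.sum_singleton, Finset.card_empty,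
    pow_zero, one_mul]
  rfl

lemma GrowthBound.memLp_digitFun (ha : 0 ≤ a) (ha' : a < 1 / 2) (h : GrowthBound φ D b a) :
    MemLp (digitFun φ) 2 (coins (Fin d × ℕ)) := by
  have h1 := h.lintegral_mixedDiff_le ha ha' fun _ => 0
  simp only [mixedDiff_zero, lintegral_const, measure_univ, mul_one] at h1
  exact memLp_two_of_lintegral_le (h.measurable_digitFun ha).aestronglyMeasurable h1

lemma haar_eq_integral {f : Digits d → ℝ} (hf : Integrable f (coins (Fin d × ℕ))) (κ : Fin d → ℕ)
    (y : Digits d) : haar f κ y = ∫ z, mixedDiff f κ y z ∂coins (Fin d × ℕ) := by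
  unfold mixedDiff haar cellMean
  rw [integral_finsetSum _ fun v _ => (integrable_merge hf _ y).const_mul _]
  simp only [integral_const_mul]

lemma measurable_haar {f : Digits d → ℝ} (hf : Measurable f) (κ : Fin d → ℕ) :
    Measurable (haar f κ) := by
  refine Finset.measurable_sum _ fun v _ => Measurable.const_mul ?_ _
  have h : StronglyMeasurable (Function.uncurry fun y z => f (merge (lower κ v) y z)) :=
    (hf.comp (measurable_merge (lower κ v))).stronglyMeasurable
  exact h.integral_prod_right.measurable

/-- A Haar component is the mean of `mixedDiff` over `z`, so Jensen's inequality applies. -/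
lemma GrowthBound.lintegral_haar_sq_le (ha : 0 ≤ a) (ha' : a < 1 / 2) (h : GrowthBound φ D b a)
    (κ : Fin d → ℕ) :
    ∫⁻ y, ‖haar (digitFun φ) κ y‖ₑ ^ 2 ∂coins (Fin d × ℕ) ≤
      ENNReal.ofReal (b ^ 2 * haarConst a ^ d * decay a ^ ∑ i, κ i) := by
  refine (lintegral_mono fun y => ?_).trans (h.lintegral_mixedDiff_le ha ha' κ)
  rw [haar_eq_integral ((h.memLp_digitFun ha ha').integrable one_le_two)]
  exact enorm_integral_sq_le ((measurable_mixedDiff (h.measurable_digitFun ha) κ).comp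
    measurable_prodMk_left).aestronglyMeasurable

lemma measurable_merge_right (κ : Fin d → ℕ) (y : Digits d) :
    Measurable fun z : Digits d => merge κ y z :=
  (measurable_merge κ).comp measurable_prodMk_left

/-- The Haar decomposition converges at generic points. -/
lemma GrowthBound.tendsto_cellMean (ha : 0 ≤ a) (h : GrowthBound φ D b a) {y : Digits d}
    (hy : IsGeneric y) :
    Tendsto (fun L : ℕ => cellMean (digitFun φ) (fun _ => L) y) atTop (𝓝 (digitFun φ y)) := by
  have hlim : digitFun φ y = ∫ _z, digitFun φ y ∂coins (Fin d × ℕ) := by simp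
  rw [hlim]
  have hcont : ContinuousAt φ (realPoint y) :=
    (h.continuousOn ha).continuousAt (isOpen_openCube.mem_nhds hy.realPoint_mem)
  refine tendsto_integral_filter_of_dominated_convergence
    -- Once `L` exceeds all initial runs of `y`, the merged points inherit these runs, and with them
    -- a fixed lower bound for the distance to the boundary.
    (fun _ => b * ∏ i, 2 ^ (a * ((runLength (fun r => y (i, r)) + 1 : ℕ) : ℝ))) ?_ ?_ ?_ ?_
  · refine Eventually.of_forall fun L => Measurable.aestronglyMeasurable ?_
    exact (h.measurable_digitFun ha).comp (measurable_merge_right (fun _ => L) y)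
  · have hL : ∀ᶠ L : ℕ in atTop, ∀ i : Fin d, runLength (fun r => y (i, r)) < L :=
      eventually_all.2 fun i => eventually_gt_atTop _
    filter_upwards [hL] with L hL
    filter_upwards [ae_isGeneric] with z hz
    have hg := hz.merge (fun _ => L) y
    rw [Real.norm_eq_abs, hg.digitFun_eq, ← h.partials.1 _ hg.realPoint_mem]
    refine (h.bound ∅ _ hg.realPoint_mem).trans (mul_le_mul_of_nonneg_left
      (Finset.prod_le_prod (fun i _ => ?_) fun i _ => ?_) h.nonneg)
    · exact Real.rpow_nonneg (min_pos_of_mem hg.realPoint_mem i).le _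
    · rw [if_neg (Finset.notMem_empty i), sub_zero, ← half_pow_rpow_neg]
      refine Real.rpow_le_rpow_of_nonpos (by positivity) (min_ofDigits_ge ?_) (by linarith)
      have h1 := ne_runLength (hy.exists_ne i)
      have h2 := hL i
      simp only [merge, if_pos h2, if_pos (Nat.zero_lt_of_lt h2)]
      exact h1
  · exact integrable_const _
  · filter_upwards [ae_isGeneric] with z hz
    rw [hy.digitFun_eq]
    have e : ∀ L : ℕ, digitFun φ (merge (fun _ => L) y z) =
        φ (realPoint (merge (fun _ => L) y z)) := fun L => (hz.merge _ y).digitFun_eq φ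
    simp only [e]
    refine hcont.tendsto.comp (tendsto_pi_nhds.2 fun i => ?_)
    refine tendsto_iff_norm_sub_tendsto_zero.2 (squeeze_zero (fun _ => norm_nonneg _) (fun L => ?_)
      (tendsto_pow_atTop_nhds_zero_of_lt_one (r := (1 / 2 : ℝ)) (by norm_num) (by norm_num)))
    exact abs_ofDigits_sub_le fun r hr => by simp [merge, hr]

end MLDLQMC

namespace MLDLQMC

/-! ### The variance of averages over scrambled Sobol' points -/

variable {d : ℕ}

/-- The sum of the powers of `2 ^ (-δ)`. -/
noncomputable def geo (δ : ℝ) : ℝ := (1 - 2 ^ (-δ))⁻¹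

lemma two_rpow_neg_lt_one {δ : ℝ} (hδ : 0 < δ) : (2 : ℝ) ^ (-δ) < 1 :=
  Real.rpow_lt_one_of_one_lt_of_neg (by norm_num) (by linarith)

lemma one_le_geo {δ : ℝ} (hδ : 0 < δ) : 1 ≤ geo δ := by
  have h1 := two_rpow_neg_lt_one hδ
  have h2 : (0 : ℝ) < 2 ^ (-δ) := by positivity
  exact (one_le_inv₀ (by linarith)).2 (by linarith)

lemma sum_range_le_geo {δ : ℝ} (hδ : 0 < δ) (n : ℕ) :
    ∑ k ∈ Finset.range n, ((2 : ℝ) ^ (-δ)) ^ k ≤ geo δ := by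
  rw [geo, ← tsum_geometric_of_lt_one (by positivity) (two_rpow_neg_lt_one hδ)]
  exact (summable_geometric_of_lt_one (by positivity) (two_rpow_neg_lt_one hδ)).sum_le_tsum _
    fun _ _ => by positivity

lemma sum_piFinset_le_geo {δ : ℝ} (hδ : 0 < δ) (n : ℕ) :
    ∑ κ ∈ Fintype.piFinset fun _ : Fin d => Finset.range n, ((2 : ℝ) ^ (-δ)) ^ ∑ i, κ i ≤
      geo δ ^ d := by
  simp only [← Finset.prod_pow_eq_pow_sum]
  rw [← Finset.prod_univ_sum (fun _ => Finset.range n) fun (_ : Fin d) k => ((2 : ℝ) ^ (-δ)) ^ k]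
  refine (Finset.prod_le_prod (fun _ _ => Finset.sum_nonneg fun _ _ => by positivity)
    fun _ _ => sum_range_le_geo hδ n).trans ?_
  simp

/-- A minimum is at most any weighted geometric mean; the weight `2 * (a + δ)` on `N` leaves the
decay `2 ^ (-2 * δ * s)` after multiplication by `decay a ^ s`. -/
lemma min_mul_decay_le {a δ N : ℝ} (hδ : 0 ≤ δ) (ha : 0 ≤ a) (haδ : a + δ ≤ 1 / 2) (hN : 1 ≤ N)
    (s : ℕ) : min N (2 ^ s) * decay a ^ s ≤ (N ^ (a + δ) * ((2 : ℝ) ^ (-δ)) ^ s) ^ 2 := by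
  set y : ℝ := 2 ^ s with hy
  have hy0 : 0 < y := by positivity
  have hN0 : 0 < N := by linarith
  have e1 : decay a ^ s = y ^ (2 * a - 1) := by
    rw [decay, hy, ← Real.rpow_natCast, ← Real.rpow_natCast, ← Real.rpow_mul (by norm_num),
      ← Real.rpow_mul (by norm_num), mul_comm]
  have e2 : ((2 : ℝ) ^ (-δ)) ^ s = y ^ (-δ) := by
    rw [hy, ← Real.rpow_natCast, ← Real.rpow_natCast, ← Real.rpow_mul (by norm_num),
      ← Real.rpow_mul (by norm_num), mul_comm]
  have e3 : min N y ≤ N ^ (2 * (a + δ)) * y ^ (1 - 2 * (a + δ)) := by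
    have hτ : 0 ≤ 1 - 2 * (a + δ) := by linarith
    have hsplit : ∀ x : ℝ, 0 < x → x = x ^ (2 * (a + δ)) * x ^ (1 - 2 * (a + δ)) := fun x hx => by
      rw [← Real.rpow_add hx, add_sub_cancel, Real.rpow_one]
    rcases le_total N y with h | h
    · rw [min_eq_left h]
      conv_lhs => rw [hsplit N hN0]
      gcongr
    · rw [min_eq_right h]
      conv_lhs => rw [hsplit y hy0]
      gcongr
  rw [e1, e2]
  refine (mul_le_mul_of_nonneg_right e3 (by positivity)).trans (le_of_eq ?_)
  rw [mul_pow, ← Real.rpow_natCast (N ^ (a + δ)), ← Real.rpow_natCast (y ^ (-δ)),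
    ← Real.rpow_mul hN0.le, ← Real.rpow_mul hy0.le, mul_assoc, ← Real.rpow_add hy0]
  push_cast
  ring_nf

lemma one_le_haarConst {a : ℝ} (ha : a < 1 / 2) : 1 ≤ haarConst a := by
  have h1 := decay_pos a
  have h2 := decay_lt_one ha
  rw [haarConst, le_div_iff₀ (by linarith)]
  linarith

variable {φ : (Fin d → ℝ) → ℝ} {D : Finset (Fin d) → (Fin d → ℝ) → ℝ} {b a : ℝ}

lemma GrowthBound.memLp_haar (ha : 0 ≤ a) (ha' : a < 1 / 2) (h : GrowthBound φ D b a)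
    (κ : Fin d → ℕ) : MemLp (haar (digitFun φ) κ) 2 (coins (Fin d × ℕ)) :=
  memLp_two_of_lintegral_le (measurable_haar (h.measurable_digitFun ha) κ).aestronglyMeasurable
    (h.lintegral_haar_sq_le ha ha' κ)

lemma GrowthBound.eLpNorm_sum_haar_le (G : SobolData d) (ha : 0 ≤ a) (ha' : a < 1 / 2)
    (h : GrowthBound φ D b a) {κ : Fin d → ℕ} {i : Fin d} (hi : κ i ≠ 0) {N : ℕ} (hN : 1 ≤ N)
    {δ : ℝ} (hδ : 0 ≤ δ) (haδ : a + δ ≤ 1 / 2) :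
    eLpNorm (fun η => ∑ n ∈ Finset.range N, haar (digitFun φ) κ (scr (G.digit n) η)) 2
        (coins (Fin d × List (ZMod 2))) ≤
      ENNReal.ofReal (b * haarConst a ^ d * 2 ^ (G.quality + d) * (N : ℝ) ^ (a + δ) *
        ((2 : ℝ) ^ (-δ)) ^ ∑ i, κ i) := by
  have hL := h.memLp_haar ha ha' κ
  have hb := h.nonneg
  have hc := one_le_haarConst ha'
  have hd := decay_pos a
  have hN' : (1 : ℝ) ≤ N := by exact_mod_cast hN
  refine eLpNorm_two_le (memLp_finsetSum _ fun n _ => memLp_scr hL _) (by positivity) ?_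
  refine (integral_sq_sum_le G (isHaar_haar ((h.memLp_digitFun ha ha').integrable one_le_two) κ)
    hL hi N).trans ?_
  set s := ∑ i, κ i with hs
  have h1 : ∫ y, haar (digitFun φ) κ y ^ 2 ∂coins (Fin d × ℕ) ≤
      b ^ 2 * haarConst a ^ d * decay a ^ s :=
    integral_sq_le_of_lintegral_le hL.aestronglyMeasurable (by positivity)
      (h.lintegral_haar_sq_le ha ha' κ)
  have h2 : min (N : ℝ) (2 ^ (s + G.quality)) ≤ 2 ^ G.quality * min (N : ℝ) (2 ^ s) := by
    have hq : (1 : ℝ) ≤ 2 ^ G.quality := one_le_pow₀ (by norm_num)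
    rw [mul_min_of_nonneg _ _ (by positivity), pow_add, mul_comm ((2 : ℝ) ^ s)]
    exact min_le_min_right _ (le_mul_of_one_le_left (by positivity) hq)
  have h3 := min_mul_decay_le hδ ha haδ hN' s
  calc min (N : ℝ) (2 ^ (s + G.quality)) * 2 ^ (G.quality + d) *
        ∫ y, haar (digitFun φ) κ y ^ 2 ∂coins (Fin d × ℕ)
      ≤ (2 ^ G.quality * min (N : ℝ) (2 ^ s)) * 2 ^ (G.quality + d) *
          (b ^ 2 * haarConst a ^ d * decay a ^ s) := by
        gcongr
    _ = b ^ 2 * haarConst a ^ d * (2 ^ G.quality * 2 ^ (G.quality + d)) *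
          (min (N : ℝ) (2 ^ s) * decay a ^ s) := by ring
    _ ≤ b ^ 2 * (haarConst a ^ d * haarConst a ^ d) * (2 ^ (G.quality + d) * 2 ^ (G.quality + d)) *
          ((N : ℝ) ^ (a + δ) * ((2 : ℝ) ^ (-δ)) ^ s) ^ 2 := by
        gcongr
        · exact le_mul_of_one_le_left (by positivity) (one_le_pow₀ hc)
        · norm_num
        · omega
    _ = _ := by ring

/-- Subtracting the mean removes level zero. The other levels are added by the triangle inequality
in `L²`, so no orthogonality between levels is needed. -/
lemma GrowthBound.eLpNorm_sum_cellMean_le (G : SobolData d) (ha : 0 ≤ a) (ha' : a < 1 / 2)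
    (h : GrowthBound φ D b a) {N : ℕ} (hN : 1 ≤ N) {δ : ℝ} (hδ : 0 < δ) (haδ : a + δ ≤ 1 / 2)
    (L : ℕ) :
    eLpNorm (fun η => ∑ n ∈ Finset.range N, cellMean (digitFun φ) (fun _ => L) (scr (G.digit n) η)
        - N * ∫ z, digitFun φ z ∂coins (Fin d × ℕ)) 2 (coins (Fin d × List (ZMod 2))) ≤
      ENNReal.ofReal (b * haarConst a ^ d * 2 ^ (G.quality + d) * (N : ℝ) ^ (a + δ) *
        geo δ ^ d) := by
  have hc := one_le_haarConst ha'
  have hb := h.nonneg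
  set box := Fintype.piFinset fun _ : Fin d => Finset.range (L + 1) with hbox
  have h0 : (fun _ => 0) ∈ box := by simp [hbox]
  have e : (fun η => ∑ n ∈ Finset.range N,
      cellMean (digitFun φ) (fun _ => L) (scr (G.digit n) η)
        - N * ∫ z, digitFun φ z ∂coins (Fin d × ℕ)) =
      ∑ κ ∈ box.erase fun _ => 0,
        fun η => ∑ n ∈ Finset.range N, haar (digitFun φ) κ (scr (G.digit n) η) := by
    funext η
    rw [Finset.sum_apply, Finset.sum_comm]
    have : ∀ n, ∑ κ ∈ box.erase fun _ => 0, haar (digitFun φ) κ (scr (G.digit n) η) =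
        cellMean (digitFun φ) (fun _ => L) (scr (G.digit n) η) -
          ∫ z, digitFun φ z ∂coins (Fin d × ℕ) := fun n => by
      rw [← sum_haar, ← Finset.sum_erase_add _ _ h0, haar_zero, add_sub_cancel_right]
    simp only [this, Finset.sum_sub_distrib, Finset.sum_const, Finset.card_range, nsmul_eq_mul]
  rw [e]
  refine (eLpNorm_sum_le (fun κ _ => (memLp_finsetSum _ fun n _ =>
    memLp_scr (h.memLp_haar ha ha' κ) _).aestronglyMeasurable) one_le_two).trans ?_
  calc _ ≤ ∑ κ ∈ box.erase fun _ => 0, ENNReal.ofReal (b * haarConst a ^ d *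
          2 ^ (G.quality + d) * (N : ℝ) ^ (a + δ) * ((2 : ℝ) ^ (-δ)) ^ ∑ i, κ i) := by
        refine Finset.sum_le_sum fun κ hκ => ?_
        obtain ⟨i, hi⟩ := Function.ne_iff.1 (Finset.ne_of_mem_erase hκ)
        exact h.eLpNorm_sum_haar_le G ha ha' hi hN hδ.le haδ
    _ = ENNReal.ofReal (b * haarConst a ^ d * 2 ^ (G.quality + d) * (N : ℝ) ^ (a + δ) *
          ∑ κ ∈ box.erase fun _ => 0, ((2 : ℝ) ^ (-δ)) ^ ∑ i, κ i) := by
        rw [Finset.mul_sum, ENNReal.ofReal_sum_of_nonneg fun κ _ => by positivity]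
    _ ≤ _ := by
        refine ENNReal.ofReal_le_ofReal (mul_le_mul_of_nonneg_left ?_ (by positivity))
        exact (Finset.sum_le_sum_of_subset_of_nonneg (Finset.erase_subset _ _)
          fun _ _ _ => by positivity).trans (sum_piFinset_le_geo hδ _)

lemma GrowthBound.eLpNorm_sum_digitFun_le (G : SobolData d) (ha : 0 ≤ a) (ha' : a < 1 / 2)
    (h : GrowthBound φ D b a) {N : ℕ} (hN : 1 ≤ N) {ε : ℝ} (hε : 0 < ε) :
    eLpNorm (fun η => ∑ n ∈ Finset.range N, digitFun φ (scr (G.digit n) η)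
        - N * ∫ z, digitFun φ z ∂coins (Fin d × ℕ)) 2 (coins (Fin d × List (ZMod 2))) ≤
      ENNReal.ofReal (b * (haarConst a * geo (1 / 2 - a)) ^ d * (2 ^ (G.quality + d) * geo ε ^ d) *
        (N : ℝ) ^ (a + ε)) := by
  have hc := one_le_haarConst ha'
  have hb := h.nonneg
  -- The interpolation requires `a + δ ≤ 1 / 2`. With this choice `geo δ` is at most the product of
  -- a factor depending on `a` and one depending on `ε`, which separates the two constants.
  set δ := min ε (1 / 2 - a) with hδ
  have hδ0 : 0 < δ := lt_min hε (by linarith)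
  have hδ1 : a + δ ≤ 1 / 2 := by linarith [min_le_right ε (1 / 2 - a)]
  have hg1 := one_le_geo hε
  have hg2 := one_le_geo (by linarith : 0 < 1 / 2 - a)
  have hgeo : geo δ ≤ geo (1 / 2 - a) * geo ε := by
    rcases min_choice ε (1 / 2 - a) with h' | h'
    · rw [hδ, h']
      exact le_mul_of_one_le_left (by linarith) hg2
    · rw [hδ, h']
      exact le_mul_of_one_le_right (by linarith) hg1
  have hgδ : 0 ≤ geo δ := by linarith [one_le_geo hδ0]
  -- The bound is uniform in `L`, so Fatou's lemma passes it to the almost sure limit.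
  have hmain := Lp.eLpNorm_lim_le_liminf_eLpNorm (p := 2) (μ := coins (Fin d × List (ZMod 2)))
    (f := fun L η => ∑ n ∈ Finset.range N,
      cellMean (digitFun φ) (fun _ => L) (scr (G.digit n) η)
        - N * ∫ z, digitFun φ z ∂coins (Fin d × ℕ)) ?_
    (fun η => ∑ n ∈ Finset.range N, digitFun φ (scr (G.digit n) η)
        - N * ∫ z, digitFun φ z ∂coins (Fin d × ℕ)) ?_
  · refine hmain.trans ((liminf_le_liminf (Eventually.of_forall fun L =>
      h.eLpNorm_sum_cellMean_le G ha ha' hN hδ0 hδ1 L)).trans ?_)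
    rw [liminf_const]
    refine ENNReal.ofReal_le_ofReal ?_
    have hN' : (1 : ℝ) ≤ N := by exact_mod_cast hN
    calc b * haarConst a ^ d * 2 ^ (G.quality + d) * (N : ℝ) ^ (a + δ) * geo δ ^ d
        ≤ b * haarConst a ^ d * 2 ^ (G.quality + d) * (N : ℝ) ^ (a + ε) *
            (geo (1 / 2 - a) * geo ε) ^ d := by
          gcongr
          exact min_le_left _ _
      _ = _ := by ring
  · intro L
    refine Measurable.aestronglyMeasurable (Measurable.sub_const (Finset.measurable_sum _
      fun n _ => ?_) _)
    have h1 : StronglyMeasurable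
        (Function.uncurry fun y z => digitFun φ (merge (fun _ : Fin d => L) y z)) :=
      ((h.measurable_digitFun ha).comp (measurable_merge _)).stronglyMeasurable
    exact h1.integral_prod_right.measurable.comp (measurePreserving_scr _).measurable
  · have hgen : ∀ᵐ η ∂coins (Fin d × List (ZMod 2)), ∀ n, IsGeneric (scr (G.digit n) η) :=
      ae_all_iff.2 fun n => (measurePreserving_scr (G.digit n)).quasiMeasurePreserving.ae
        ae_isGeneric
    filter_upwards [hgen] with η hη
    exact (tendsto_finsetSum _ fun n _ => h.tendsto_cellMean ha (hη n)).sub_const _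

lemma variance_le_of_eLpNorm_le {α : Type*} [MeasurableSpace α] {μ : Measure α}
    [IsProbabilityMeasure μ] {X : α → ℝ} (hX : AEStronglyMeasurable X μ) (m : ℝ) {c : ℝ}
    (hc : 0 ≤ c) (h : eLpNorm (fun x => X x - m) 2 μ ≤ ENNReal.ofReal c) :
    variance X μ ≤ c ^ 2 := by
  rw [← variance_sub_const hX m]
  refine (variance_le_expectation_sq (hX.sub aestronglyMeasurable_const)).trans ?_
  refine integral_sq_le_of_lintegral_le (hX.sub aestronglyMeasurable_const) (by positivity) ?_
  rw [← eLpNorm_two_sq, ENNReal.ofReal_pow hc]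
  exact pow_le_pow_left' h 2

/-- The average of a function on the open unit cube over scrambled Sobol' points, as a function of
the random bits of the scrambling. -/
noncomputable def scrambledAverage (G : SobolData d) (φ : (Fin d → ℝ) → ℝ) (N : ℕ)
    (η : Fin d × List (ZMod 2) → ZMod 2) : ℝ :=
  (1 / (N : ℝ)) * ∑ n ∈ Finset.range N, digitFun φ (scr (G.digit n) η)

lemma GrowthBound.memLp_scrambledAverage (G : SobolData d) (ha : 0 ≤ a) (ha' : a < 1 / 2)
    (h : GrowthBound φ D b a) (N : ℕ) :
    MemLp (scrambledAverage G φ N) 2 (coins (Fin d × List (ZMod 2))) :=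
  (memLp_finsetSum _ fun _ _ => memLp_scr (h.memLp_digitFun ha ha') _).const_mul _

lemma GrowthBound.eLpNorm_scrambledAverage_le (G : SobolData d) (ha : 0 ≤ a) (ha' : a < 1 / 2)
    (h : GrowthBound φ D b a) {N : ℕ} (hN : 1 ≤ N) {ε : ℝ} (hε : 0 < ε) :
    eLpNorm (fun η => scrambledAverage G φ N η - ∫ z, digitFun φ z ∂coins (Fin d × ℕ)) 2
      (coins (Fin d × List (ZMod 2))) ≤ ENNReal.ofReal
      (b * (haarConst a * geo (1 / 2 - a)) ^ d * (2 ^ (G.quality + d) * geo ε ^ d) *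
        (N : ℝ) ^ (a + ε - 1)) := by
  have hN0 : (0 : ℝ) < N := by exact_mod_cast hN
  have e : (fun η => scrambledAverage G φ N η - ∫ z, digitFun φ z ∂coins (Fin d × ℕ)) =
      (1 / (N : ℝ)) • fun η => ∑ n ∈ Finset.range N, digitFun φ (scr (G.digit n) η)
        - N * ∫ z, digitFun φ z ∂coins (Fin d × ℕ) := by
    funext η
    simp only [scrambledAverage, Pi.smul_apply, smul_eq_mul]
    field_simp
  rw [e, eLpNorm_const_smul, Real.enorm_eq_ofReal (by positivity)]
  refine (mul_le_mul_right (h.eLpNorm_sum_digitFun_le G ha ha' hN hε) _).trans (le_of_eq ?_)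
  rw [← ENNReal.ofReal_mul (by positivity), Real.rpow_sub_one hN0.ne']
  congr 1
  ring

/-- The values of `φ` off the open cube are uncontrolled, but almost surely all scrambled points lie
inside it. -/
lemma average_scrambledPoint_ae_eq (G : SobolData d) (φ : (Fin d → ℝ) → ℝ) (N : ℕ) {Ω : Type*}
    [MeasurableSpace Ω] {P : Measure Ω} {ξ : Fin d × List (ZMod 2) → Ω → ZMod 2}
    (hξ : IsOwenScrambling ξ P) :
    (fun ω => (1 / (N : ℝ)) * ∑ n ∈ Finset.range N, φ (scrambledPoint G ξ n ω)) =ᵐ[P]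
      scrambledAverage G φ N ∘ fun ω i => ξ i ω := by
  have hgen : ∀ᵐ ω ∂P, ∀ n, IsGeneric (scr (G.digit n) fun i => ξ i ω) :=
    ae_all_iff.2 fun n => ((measurePreserving_scr (G.digit n)).comp
      hξ.measurePreserving).quasiMeasurePreserving.ae ae_isGeneric
  filter_upwards [hgen] with ω hω
  simp only [scrambledAverage, Function.comp_apply]
  congr 1
  refine Finset.sum_congr rfl fun n _ => ?_
  rw [(hω n).digitFun_eq]
  rfl

/-- The mean square error of averages over scrambled Sobol' points. -/
lemma GrowthBound.variance_average_le (G : SobolData d) (ha : 0 ≤ a) (ha' : a < 1 / 2)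
    (h : GrowthBound φ D b a) {N : ℕ} (hN : 1 ≤ N) {ε : ℝ} (hε : 0 < ε) {Ω : Type*}
    [MeasurableSpace Ω] {P : Measure Ω} [IsProbabilityMeasure P]
    {ξ : Fin d × List (ZMod 2) → Ω → ZMod 2} (hξ : IsOwenScrambling ξ P) :
    MemLp (fun ω => (1 / (N : ℝ)) * ∑ n ∈ Finset.range N, φ (scrambledPoint G ξ n ω)) 2 P ∧
    variance (fun ω => (1 / (N : ℝ)) * ∑ n ∈ Finset.range N, φ (scrambledPoint G ξ n ω)) P ≤
      (b * (haarConst a * geo (1 / 2 - a)) ^ d * (2 ^ (G.quality + d) * geo ε ^ d) *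
        (N : ℝ) ^ (a + ε - 1)) ^ 2 := by
  have hc := one_le_haarConst ha'
  have hb := h.nonneg
  have hg1 := one_le_geo hε
  have hg2 := one_le_geo (by linarith : 0 < 1 / 2 - a)
  have hae := average_scrambledPoint_ae_eq G φ N hξ
  have hFL := h.memLp_scrambledAverage G ha ha' N
  have hFξ : MemLp (scrambledAverage G φ N ∘ fun ω i => ξ i ω) 2 P :=
    hFL.comp_measurePreserving hξ.measurePreserving
  refine ⟨(memLp_congr_ae hae).2 hFξ, ?_⟩
  rw [variance_congr hae]
  refine variance_le_of_eLpNorm_le hFξ.aestronglyMeasurable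
    (∫ z, digitFun φ z ∂coins (Fin d × ℕ)) (by positivity) ?_
  refine le_trans (le_of_eq ?_) (h.eLpNorm_scrambledAverage_le G ha ha' hN hε)
  exact eLpNorm_comp_measurePreserving
    (g := fun η => scrambledAverage G φ N η - ∫ z, digitFun φ z ∂coins (Fin d × ℕ))
    (hFL.aestronglyMeasurable.sub aestronglyMeasurable_const) hξ.measurePreserving

end MLDLQMC

namespace MLDLQMC

/-! ### The star discrepancy of scrambled Sobol' points -/

variable {d : ℕ}

open Classical in
/-- The indicator function of the anchored dyadic box with corner `c / 2 ^ L`. -/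
noncomputable def boxFun (L : ℕ) (c : Fin d → ℕ) (x : Digits d) : ℝ :=
  if ∀ i, num (fun r => x (i, r)) L < c i then 1 else 0

lemma measurable_num (L : ℕ) : Measurable fun x : ℕ → ZMod 2 => num x L := by
  induction L with
  | zero => exact measurable_const
  | succ L ih =>
    exact (ih.const_mul 2).add
      ((measurable_of_countable (ZMod.val : ZMod 2 → ℕ)).comp (measurable_pi_apply L))

lemma measurable_boxFun (L : ℕ) (c : Fin d → ℕ) : Measurable (boxFun L c) := by
  refine Measurable.ite ?_ measurable_const measurable_const
  have : {x : Digits d | ∀ i, num (fun r => x (i, r)) L < c i} =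
      ⋂ i, (fun x : Digits d => num (fun r => x (i, r)) L) ⁻¹' Set.Iio (c i) := by
    ext x
    simp
  rw [this]
  exact MeasurableSet.iInter fun i =>
    ((measurable_num L).comp (measurable_coord i)) (Set.to_countable _).measurableSet

lemma abs_boxFun_le (L : ℕ) (c : Fin d → ℕ) (x : Digits d) : |boxFun L c x| ≤ 1 := by
  unfold boxFun
  split_ifs <;> simp

lemma integrable_boxFun (L : ℕ) (c : Fin d → ℕ) : Integrable (boxFun L c) (coins (Fin d × ℕ)) :=
  Integrable.of_bound (measurable_boxFun L c).aestronglyMeasurable 1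
    (Eventually.of_forall fun x => abs_boxFun_le L c x)

/-- Membership in the box is decided by the first `L` digits, so the Haar expansion is finite and
exact. -/
lemma cellMean_boxFun (L : ℕ) (c : Fin d → ℕ) (y : Digits d) :
    cellMean (boxFun L c) (fun _ => L) y = boxFun L c y := by
  have : ∀ z, boxFun L c (merge (fun _ => L) y z) = boxFun L c y := by
    intro z
    have h : ∀ i, num (fun r => merge (fun _ => L) y z (i, r)) L = num (fun r => y (i, r)) L :=
      fun i => num_congr fun r hr => by simp [merge, hr]
    simp only [boxFun, h]
  simp [cellMean, this]

lemma abs_haar_boxFun_le (L : ℕ) (c κ : Fin d → ℕ) (y : Digits d) :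
    |haar (boxFun L c) κ y| ≤ 2 ^ d := by
  refine (Finset.abs_sum_le_sum_abs _ _).trans ?_
  have h1 : ∀ v ∈ (levelSupport κ).powerset,
      |(-1) ^ v.card * cellMean (boxFun L c) (lower κ v) y| ≤ 1 := by
    intro v _
    rw [abs_mul, abs_pow, abs_neg, abs_one, one_pow, one_mul]
    have := norm_integral_le_of_norm_le_const (μ := coins (Fin d × ℕ)) (C := 1)
      (f := fun z => boxFun L c (merge (lower κ v) y z)) (Eventually.of_forall fun z => abs_boxFun_le L c (merge (lower κ v) y z))
    simpa [cellMean] using this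
  refine (Finset.sum_le_sum h1).trans ?_
  rw [Finset.sum_const, Finset.card_powerset, nsmul_eq_mul, mul_one]
  push_cast
  refine pow_le_pow_right₀ (by norm_num) ((Finset.card_le_univ _).trans ?_)
  simp

/-- A Haar component of a box is supported near the boundary of the box. -/
lemma num_eq_of_haar_boxFun_ne_zero {L : ℕ} {c κ : Fin d → ℕ} {y : Digits d}
    (h : haar (boxFun L c) κ y ≠ 0) {i : Fin d} (hi : κ i ≠ 0) (hL : κ i ≤ L) :
    num (fun r => y (i, r)) (κ i - 1) = c i / 2 ^ (L - (κ i - 1)) := by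
  by_contra hne
  apply h
  rw [haar_eq_sum_erase _ hi]
  refine Finset.sum_eq_zero fun v hv => ?_
  have hiv : i ∉ v := fun h => by simpa using Finset.mem_powerset.1 hv h
  suffices hz : ∀ z, boxFun L c (merge (lower κ v) y z) =
      boxFun L c (merge (lower κ (insert i v)) y z) by
    simp only [cellMean, hz, sub_self, mul_zero]
  intro z
  -- If the prefix of length `κ i - 1` differs from that of the corner, it already decides the
  -- condition in coordinate `i`. The finer and the coarser mean then coincide and the pairs cancel.
  have hk : ∀ x : ℕ → ZMod 2, (∀ r < κ i - 1, x r = y (i, r)) →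
      (num x L < c i ↔ num (fun r => y (i, r)) (κ i - 1) < c i / 2 ^ (L - (κ i - 1))) := by
    intro x hx
    have e : num x L / 2 ^ (L - (κ i - 1)) = num (fun r => y (i, r)) (κ i - 1) := by
      rw [num_div x (by omega), num_congr hx]
    rw [← e] at hne ⊢
    constructor
    · intro hlt
      exact lt_of_le_of_ne (Nat.div_le_div_right hlt.le) hne
    · intro hlt
      by_contra hge
      exact absurd (Nat.div_le_div_right (not_lt.1 hge)) (not_le.2 hlt)
  have hP : ∀ j, (num (fun r => merge (lower κ v) y z (j, r)) L < c j ↔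
      num (fun r => merge (lower κ (insert i v)) y z (j, r)) L < c j) := by
    intro j
    by_cases hj : j = i
    · subst hj
      rw [hk, hk]
      · intro r hr
        simp [merge, lower, hr]
      · intro r hr
        simp only [merge, lower, if_neg hiv]
        rw [if_pos (by omega)]
    · have : (fun r => merge (lower κ v) y z (j, r)) =
          fun r => merge (lower κ (insert i v)) y z (j, r) := by
        funext r
        simp only [merge, lower_insert_of_ne κ v hj]
      rw [this]
  simp only [boxFun, hP]

/-- As long as the original prefixes agree, both points receive the same bit, so equal scrambled
digits come from equal original digits. -/
lemma eq_of_scr_eq {a a' : Fin d → ℕ → ZMod 2} {η : Fin d × List (ZMod 2) → ZMod 2} {i : Fin d}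
    {k : ℕ} (h : ∀ r < k, scr a η (i, r) = scr a' η (i, r)) : ∀ r < k, a i r = a' i r := by
  intro r
  induction r using Nat.strong_induction_on with
  | _ r ih =>
    intro hr
    have hpre : (List.range r).map (a i) = (List.range r).map (a' i) :=
      List.map_congr_left fun s hs => ih s (List.mem_range.1 hs) ((List.mem_range.1 hs).trans hr)
    have := h r hr
    simp only [scr, hpre] at this
    exact add_right_cancel this

variable (G : SobolData d)

/-- All points of the incomplete block at which the component is nonzero share a parent cell after
scrambling, hence also before it. Boundedly many points of the block do so. -/
lemma abs_sum_haar_boxFun_le {L : ℕ} {c κ : Fin d → ℕ} (hκ : ∀ i, κ i ≤ L) {i : Fin d}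
    (hi : κ i ≠ 0) (N : ℕ) (η : Fin d × List (ZMod 2) → ZMod 2) :
    |∑ n ∈ Finset.range N, haar (boxFun L c) κ (scr (G.digit n) η)| ≤
      2 ^ (G.quality + d) * 2 ^ d := by
  classical
  obtain ⟨q, J, hJ, -, -, hsum⟩ := exists_remainder (∑ j, κ j + G.quality) N
  have hH := isHaar_haar (integrable_boxFun L c) κ
  rw [hsum (fun n => haar (boxFun L c) κ (scr (G.digit n) η))
    fun q => sum_block_eq_zero G hH hi le_rfl q η]
  set J' := J.filter fun n => haar (boxFun L c) κ (scr (G.digit n) η) ≠ 0 with hJ'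
  rw [← Finset.sum_filter_ne_zero]
  have hcard : J'.card ≤ 2 ^ (G.quality + d) := by
    rcases J'.eq_empty_or_nonempty with h0 | ⟨n₀, hn₀⟩
    · simp [h0]
    refine (Finset.card_le_card fun n hn => ?_).trans
      (card_filter_parent_le G κ q (G.digit n₀))
    have h1 := (Finset.mem_filter.1 hn).2
    have h2 := (Finset.mem_filter.1 hn₀).2
    refine Finset.mem_filter.2 ⟨hJ (Finset.mem_filter.1 hn).1, fun j => ?_⟩
    by_cases hj : κ j = 0
    · intro r hr
      omega
    · refine eq_of_scr_eq (η := η) (eq_of_num_eq (x := fun r => scr (G.digit n) η (j, r))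
        (y := fun r => scr (G.digit n₀) η (j, r)) ?_)
      rw [num_eq_of_haar_boxFun_ne_zero h1 hj (hκ j), num_eq_of_haar_boxFun_ne_zero h2 hj (hκ j)]
  calc |∑ n ∈ J', haar (boxFun L c) κ (scr (G.digit n) η)|
      ≤ ∑ n ∈ J', |haar (boxFun L c) κ (scr (G.digit n) η)| := Finset.abs_sum_le_sum_abs _ _
    _ ≤ ∑ _n ∈ J', (2 : ℝ) ^ d := Finset.sum_le_sum fun n _ => abs_haar_boxFun_le L c κ _
    _ = J'.card * 2 ^ d := by rw [Finset.sum_const, nsmul_eq_mul]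
    _ ≤ _ := by
      gcongr
      exact_mod_cast hcard

lemma abs_sum_boxFun_sub_le (L : ℕ) (c : Fin d → ℕ) (N : ℕ)
    (η : Fin d × List (ZMod 2) → ZMod 2) :
    |∑ n ∈ Finset.range N, boxFun L c (scr (G.digit n) η)
      - N * ∫ z, boxFun L c z ∂coins (Fin d × ℕ)| ≤
      ((L : ℝ) + 1) ^ d * (2 ^ (G.quality + d) * 2 ^ d) := by
  set box := Fintype.piFinset fun _ : Fin d => Finset.range (L + 1) with hbox
  have h0 : (fun _ => 0) ∈ box := by simp [hbox]
  have e : ∑ n ∈ Finset.range N, boxFun L c (scr (G.digit n) η)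
      - N * ∫ z, boxFun L c z ∂coins (Fin d × ℕ) =
      ∑ κ ∈ box.erase fun _ => 0,
        ∑ n ∈ Finset.range N, haar (boxFun L c) κ (scr (G.digit n) η) := by
    rw [Finset.sum_comm]
    have : ∀ n, ∑ κ ∈ box.erase fun _ => 0, haar (boxFun L c) κ (scr (G.digit n) η) =
        boxFun L c (scr (G.digit n) η) - ∫ z, boxFun L c z ∂coins (Fin d × ℕ) := fun n => by
      rw [← cellMean_boxFun, ← sum_haar, ← Finset.sum_erase_add _ _ h0, haar_zero,
        add_sub_cancel_right]
    simp only [this, Finset.sum_sub_distrib, Finset.sum_const, Finset.card_range, nsmul_eq_mul]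
  rw [e]
  refine (Finset.abs_sum_le_sum_abs _ _).trans ?_
  calc _ ≤ ∑ _κ ∈ box.erase fun _ => 0, (2 : ℝ) ^ (G.quality + d) * 2 ^ d := by
        refine Finset.sum_le_sum fun κ hκ => ?_
        obtain ⟨i, hi⟩ := Function.ne_iff.1 (Finset.ne_of_mem_erase hκ)
        refine abs_sum_haar_boxFun_le G (fun j => ?_) hi N η
        have := Fintype.mem_piFinset.1 (Finset.mem_of_mem_erase hκ) j
        exact Nat.lt_succ_iff.1 (Finset.mem_range.1 this)
    _ ≤ ∑ _κ ∈ box, (2 : ℝ) ^ (G.quality + d) * 2 ^ d :=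
        Finset.sum_le_sum_of_subset_of_nonneg (Finset.erase_subset _ _) fun _ _ _ => by positivity
    _ = _ := by
        rw [Finset.sum_const, nsmul_eq_mul, hbox, Fintype.card_piFinset_const, Finset.card_range]
        push_cast
        ring

/-! ### Volumes of dyadic boxes -/

lemma exists_num_eq (L : ℕ) : ∀ v < 2 ^ L, ∃ s, num s L = v := by
  induction L with
  | zero => intro v hv; exact ⟨0, by simp [num]; omega⟩
  | succ L ih =>
    intro v hv
    rw [pow_succ] at hv
    obtain ⟨s, hs⟩ := ih (v / 2) (by omega)
    refine ⟨Function.update s L v, ?_⟩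
    rw [num, Function.update_self, ZMod.val_natCast,
      num_congr (y := s) fun r hr => Function.update_of_ne hr.ne _ _, hs]
    omega

lemma coins_num_eq {L v : ℕ} (hv : v < 2 ^ L) : coins ℕ {x | num x L = v} = (1 / 2) ^ L := by
  obtain ⟨s, rfl⟩ := exists_num_eq L v hv
  have h := coins_cylinder (Finset.range L) s
  rw [Finset.card_range] at h
  rw [← h]
  congr 1
  ext x
  exact ⟨fun hx r hr => eq_of_num_eq hx r (Finset.mem_range.1 hr),
    fun hx => num_congr fun r hr => hx r (Finset.mem_range.2 hr)⟩

lemma coins_num_lt {L c : ℕ} (hc : c ≤ 2 ^ L) :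
    coins ℕ {x | num x L < c} = ENNReal.ofReal (c / 2 ^ L) := by
  have e : {x : ℕ → ZMod 2 | num x L < c} = ⋃ v ∈ Finset.range c, {x | num x L = v} := by
    ext x
    simp
  rw [e, measure_biUnion_finset]
  · rw [Finset.sum_congr rfl fun v hv => coins_num_eq ((Finset.mem_range.1 hv).trans_le hc),
      Finset.sum_const, Finset.card_range, nsmul_eq_mul,
      ENNReal.ofReal_div_of_pos (by positivity), ENNReal.ofReal_natCast,
      ENNReal.ofReal_pow (by positivity)]
    simp [div_eq_mul_inv, ENNReal.inv_pow]
  · intro v _ w _ hvw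
    exact Set.disjoint_left.2 fun x hx hx' => hvw (hx.symm.trans hx')
  · intro v _
    exact measurable_num L (measurableSet_singleton v)

lemma integral_boxFun {L : ℕ} {c : Fin d → ℕ} (hc : ∀ i, c i ≤ 2 ^ L) :
    ∫ x, boxFun L c x ∂coins (Fin d × ℕ) = ∏ i, ((c i : ℝ) / 2 ^ L) := by
  have hm : ∀ i, MeasurableSet {x : ℕ → ZMod 2 | num x L < c i} := fun i =>
    measurable_num L (Set.to_countable (Set.Iio (c i))).measurableSet
  rw [integral_eq_lintegral_of_nonneg_ae (Eventually.of_forall fun x => by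
    unfold boxFun
    split_ifs <;> simp) (measurable_boxFun L c).aestronglyMeasurable]
  have e : ∀ x : Digits d, ENNReal.ofReal (boxFun L c x) =
      ∏ i, {x : ℕ → ZMod 2 | num x L < c i}.indicator 1 (fun r => x (i, r)) := by
    intro x
    by_cases h : ∀ i, num (fun r => x (i, r)) L < c i
    · rw [boxFun, if_pos h, ENNReal.ofReal_one, Finset.prod_eq_one]
      intro i _
      exact Set.indicator_of_mem (h i) 1
    · rw [boxFun, if_neg h, ENNReal.ofReal_zero]
      push Not at h
      obtain ⟨i, hi⟩ := h
      refine (Finset.prod_eq_zero (Finset.mem_univ i) ?_).symm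
      exact Set.indicator_of_notMem (fun h' => absurd h' (not_lt.2 hi)) 1
  simp only [e]
  rw [lintegral_coins_prod _ fun i => measurable_one.indicator (hm i)]
  simp only [lintegral_indicator_one (hm _), coins_num_lt (hc _)]
  rw [← ENNReal.ofReal_prod_of_nonneg fun i _ => by positivity,
    ENNReal.toReal_ofReal (Finset.prod_nonneg fun i _ => by positivity)]

lemma abs_prod_sub_prod_le {ι : Type*} (s : Finset ι) {x y : ι → ℝ} {δ : ℝ}
    (hx : ∀ i, 0 ≤ x i ∧ x i ≤ 1) (hy : ∀ i, 0 ≤ y i ∧ y i ≤ 1) (h : ∀ i, |x i - y i| ≤ δ) :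
    |∏ i ∈ s, x i - ∏ i ∈ s, y i| ≤ s.card * δ := by
  classical
  induction s using Finset.induction_on with
  | empty => simp
  | insert j s hj ih =>
    rw [Finset.prod_insert hj, Finset.prod_insert hj, Finset.card_insert_of_notMem hj]
    have e : x j * ∏ i ∈ s, x i - y j * ∏ i ∈ s, y i =
        x j * (∏ i ∈ s, x i - ∏ i ∈ s, y i) + (x j - y j) * ∏ i ∈ s, y i := by ring
    rw [e]
    refine (abs_add_le _ _).trans ?_
    rw [abs_mul, abs_mul, abs_of_nonneg (hx j).1,
      abs_of_nonneg (Finset.prod_nonneg fun i _ => (hy i).1)]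
    have h1 : ∏ i ∈ s, y i ≤ 1 := Finset.prod_le_one (fun i _ => (hy i).1) fun i _ => (hy i).2
    have h2 : |x j - y j| * ∏ i ∈ s, y i ≤ δ :=
      (mul_le_of_le_one_right (abs_nonneg _) h1).trans (h j)
    have h3 : x j * |∏ i ∈ s, x i - ∏ i ∈ s, y i| ≤ s.card * δ :=
      (mul_le_of_le_one_left (abs_nonneg _) (hx j).2).trans ih
    push_cast
    linarith

/-! ### The discrepancy bound -/

-- The box with corner `z` lies between dyadic boxes of mesh `2 ^ (-L)`. Their counting errors are
-- controlled at all scramblings, and their volumes differ from that of the box by at most `d * 2 ^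
-- (-L)`.
open Classical in
lemma starDiscrepancy_scr_le (N L : ℕ) (hN : 1 ≤ N) (η : Fin d × List (ZMod 2) → ZMod 2) :
    starDiscrepancy N (fun n => realPoint (scr (G.digit n) η)) ≤
      ((L : ℝ) + 1) ^ d * (2 ^ (G.quality + d) * 2 ^ d) / N + d * (1 / 2) ^ L := by
  have hN0 : (0 : ℝ) < N := by exact_mod_cast hN
  unfold starDiscrepancy
  have : Nonempty (Set.Icc (0 : Fin d → ℝ) 1) := ⟨⟨0, by simp⟩⟩
  refine ciSup_le fun z => ?_
  obtain ⟨z, hz0, hz1⟩ := z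
  have h2L : (0 : ℝ) < 2 ^ L := by positivity
  set E := ((L : ℝ) + 1) ^ d * (2 ^ (G.quality + d) * 2 ^ d) with hE
  set c : Fin d → ℕ := fun i => ⌈2 ^ L * z i⌉₊ with hc
  have hc1 : ∀ i, c i ≤ 2 ^ L := fun i => by
    rw [hc, Nat.ceil_le]
    push_cast
    exact mul_le_of_le_one_right h2L.le (hz1 i)
  have hc2 : ∀ i, 2 ^ L * z i ≤ c i := fun i => Nat.le_ceil _
  have hc3 : ∀ i, (c i : ℝ) < 2 ^ L * z i + 1 := fun i =>
    Nat.ceil_lt_add_one (mul_nonneg h2L.le (hz0 i))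
  have hclose : ∀ c' : Fin d → ℕ, (∀ i, c' i ≤ c i) → (∀ i, c i ≤ c' i + 1) →
      |∫ x, boxFun L c' x ∂coins (Fin d × ℕ) - ∏ i, z i| ≤ d * (1 / 2) ^ L := by
    intro c' h1 h2
    rw [integral_boxFun fun i => (h1 i).trans (hc1 i)]
    have h3 := abs_prod_sub_prod_le Finset.univ (x := fun i => (c' i : ℝ) / 2 ^ L) (y := z)
      (δ := (1 / 2) ^ L) (fun i => ⟨by positivity, by
        rw [div_le_one h2L]
        exact_mod_cast (h1 i).trans (hc1 i)⟩) (fun i => ⟨hz0 i, hz1 i⟩) (fun i => by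
        have h4 : (c' i : ℝ) ≤ c i := by exact_mod_cast h1 i
        have h5 : (c i : ℝ) ≤ c' i + 1 := by exact_mod_cast h2 i
        have e : (c' i : ℝ) / 2 ^ L - z i = (c' i - 2 ^ L * z i) / 2 ^ L := by
          field_simp
        rw [e, abs_div, abs_of_pos h2L, one_div, inv_pow, ← one_div,
          div_le_div_iff_of_pos_right h2L, abs_le]
        exact ⟨by linarith [hc2 i], by linarith [hc3 i]⟩)
    rwa [Finset.card_univ, Fintype.card_fin] at h3
  have hcount : (((Finset.range N).filter fun n => ∀ i, 0 ≤ realPoint (scr (G.digit n) η) i ∧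
      realPoint (scr (G.digit n) η) i < z i).card : ℝ) = ∑ n ∈ Finset.range N,
      if ∀ i, 0 ≤ realPoint (scr (G.digit n) η) i ∧ realPoint (scr (G.digit n) η) i < z i
        then (1 : ℝ) else 0 := by
    rw [Finset.sum_ite, Finset.sum_const, Finset.sum_const_zero, add_zero, nsmul_eq_mul, mul_one]
  have hfloor : ∀ x : ℕ → ZMod 2, (num x L : ℝ) ≤ 2 ^ L * ofDigits x ∧
      2 ^ L * ofDigits x ≤ num x L + 1 := fun x => by
    rw [two_pow_mul_ofDigits]
    exact ⟨by linarith [ofDigits_nonneg fun r => x (r + L)],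
      by linarith [ofDigits_le_one fun r => x (r + L)]⟩
  have hup : ∀ x : Digits d, (if ∀ i, 0 ≤ realPoint x i ∧ realPoint x i < z i
      then (1 : ℝ) else 0) ≤ boxFun L c x := by
    intro x
    unfold boxFun
    split_ifs with h1 h2 h2
    · exact le_rfl
    · refine absurd (fun i => ?_) h2
      have h3 := (hfloor fun r => x (i, r)).1
      have h4 : 2 ^ L * ofDigits (fun r => x (i, r)) < 2 ^ L * z i :=
        mul_lt_mul_of_pos_left (h1 i).2 h2L
      have h5 : (num (fun r => x (i, r)) L : ℝ) < c i := by linarith [hc2 i]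
      exact_mod_cast h5
    · exact zero_le_one
    · exact le_rfl
  -- The inner corner is `c i - 1`, because an expansion ending in ones may reach the right end of
  -- its dyadic cell.
  have hlow : ∀ x : Digits d, boxFun L (fun i => c i - 1) x ≤
      if ∀ i, 0 ≤ realPoint x i ∧ realPoint x i < z i then (1 : ℝ) else 0 := by
    intro x
    unfold boxFun
    split_ifs with h1 h2 h2
    · exact le_rfl
    · refine absurd (fun i => ⟨ofDigits_nonneg _, ?_⟩) h2
      have h3 := (hfloor fun r => x (i, r)).2
      have h4 : num (fun r => x (i, r)) L + 2 ≤ c i := by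
        have := h1 i
        simp only at this
        omega
      have h5 : (num (fun r => x (i, r)) L : ℝ) + 2 ≤ c i := by exact_mod_cast h4
      have h6 : 2 ^ L * ofDigits (fun r => x (i, r)) < 2 ^ L * z i := by linarith [hc3 i]
      exact lt_of_mul_lt_mul_left h6 h2L.le
    · exact zero_le_one
    · exact le_rfl
  have hs1 := Finset.sum_le_sum fun n (_ : n ∈ Finset.range N) => hup (scr (G.digit n) η)
  have hs2 := Finset.sum_le_sum fun n (_ : n ∈ Finset.range N) => hlow (scr (G.digit n) η)
  have hb1 := abs_le.1 (abs_sum_boxFun_sub_le G L c N η)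
  have hb2 := abs_le.1 (abs_sum_boxFun_sub_le G L (fun i => c i - 1) N η)
  have hv1 := abs_le.1 (hclose c (fun _ => le_rfl) fun _ => Nat.le_succ _)
  have hv2 := abs_le.1 (hclose (fun i => c i - 1) (fun _ => Nat.sub_le _ _) fun i => by omega)
  rw [hcount]
  rw [abs_le]
  constructor
  · have : N * (∏ i, z i - d * (1 / 2) ^ L) - E ≤ ∑ n ∈ Finset.range N,
        if ∀ i, 0 ≤ realPoint (scr (G.digit n) η) i ∧ realPoint (scr (G.digit n) η) i < z i
        then (1 : ℝ) else 0 := by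
      have := mul_le_mul_of_nonneg_left hv2.1 hN0.le
      linarith [hb2.1]
    rw [neg_add, sub_eq_add_neg, ← sub_eq_add_neg _ (∏ i, z i), le_sub_iff_add_le,
      le_div_iff₀ hN0]
    have e : (-(E / N) + -(d * (1 / 2) ^ L) + ∏ i, z i) * N =
        N * (∏ i, z i - d * (1 / 2) ^ L) - E := by
      field_simp
      ring
    linarith
  · have : ∑ n ∈ Finset.range N,
        (if ∀ i, 0 ≤ realPoint (scr (G.digit n) η) i ∧ realPoint (scr (G.digit n) η) i < z i
        then (1 : ℝ) else 0) ≤ N * (∏ i, z i + d * (1 / 2) ^ L) + E := by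
      have := mul_le_mul_of_nonneg_left hv1.2 hN0.le
      linarith [hb1.2]
    rw [sub_le_iff_le_add, div_le_iff₀ hN0]
    have e : (E / N + d * (1 / 2) ^ L + ∏ i, z i) * N =
        N * (∏ i, z i + d * (1 / 2) ^ L) + E := by
      field_simp
      ring
    linarith

/-- Each of the `L + 1` terms `2 ^ (δ * (L - k))`, `k ≤ L`, is at least one. This turns powers of
`log N` into small powers of `N`. -/
lemma succ_le_geo {δ : ℝ} (hδ : 0 < δ) (L : ℕ) : (L : ℝ) + 1 ≤ ((2 : ℝ) ^ L) ^ δ * geo δ := by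
  refine le_trans ?_ (mul_le_mul_of_nonneg_left (sum_range_le_geo hδ (L + 1)) (by positivity))
  rw [Finset.mul_sum]
  have h : ∀ k ∈ Finset.range (L + 1), (1 : ℝ) ≤ ((2 : ℝ) ^ L) ^ δ * ((2 : ℝ) ^ (-δ)) ^ k := by
    intro k hk
    have hk' : (k : ℝ) ≤ L := by exact_mod_cast Nat.lt_succ_iff.1 (Finset.mem_range.1 hk)
    rw [← Real.rpow_natCast, ← Real.rpow_natCast, ← Real.rpow_mul (by norm_num),
      ← Real.rpow_mul (by norm_num), ← Real.rpow_add (by norm_num)]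
    refine Real.one_le_rpow (by norm_num) ?_
    nlinarith
  refine le_trans (le_of_eq ?_) (Finset.sum_le_sum h)
  simp

/-- The star discrepancy of scrambled Sobol' points is almost of the order `1 / N`. -/
lemma starDiscrepancy_scrambled_le (hd : 0 < d) {N : ℕ} (hN : 1 ≤ N) {ε : ℝ} (hε : 0 < ε)
    (η : Fin d × List (ZMod 2) → ZMod 2) :
    starDiscrepancy N (fun n => realPoint (scr (G.digit n) η)) ≤
      (2 ^ (G.quality + d) * 2 ^ d + d) * (2 ^ ε * geo (ε / d) ^ d) / (N : ℝ) ^ (1 - ε) := by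
  have hN0 : (0 : ℝ) < N := by exact_mod_cast hN
  have hd0 : (0 : ℝ) < d := by exact_mod_cast hd
  have hδ : 0 < ε / d := div_pos hε hd0
  -- This makes `N ≤ 2 ^ L ≤ 2 * N`: the volume error is at most `d / N`, and `L` is logarithmic in
  -- `N`.
  set L := N.size with hL
  have h1 : (N : ℝ) ≤ 2 ^ L := by exact_mod_cast (Nat.lt_size_self N).le
  have h2 : (2 : ℝ) ^ L ≤ 2 * N := by
    have hL1 : L - 1 < N.size := by
      have := Nat.size_pos.2 hN
      omega
    have h3 : 2 ^ (L - 1) ≤ N := Nat.lt_size.1 hL1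
    have h4 : 2 ^ L = 2 * 2 ^ (L - 1) := by
      rw [← pow_succ']
      congr 1
      omega
    have : 2 ^ L ≤ 2 * N := by omega
    exact_mod_cast this
  have h3 : ((L : ℝ) + 1) ^ d ≤ 2 ^ ε * geo (ε / d) ^ d * (N : ℝ) ^ ε := by
    have hg := one_le_geo hδ
    calc ((L : ℝ) + 1) ^ d ≤ ((2 * (N : ℝ)) ^ (ε / d) * geo (ε / d)) ^ d := by
          refine pow_le_pow_left₀ (by positivity) ((succ_le_geo hδ L).trans ?_) d
          gcongr
      _ = 2 ^ ε * geo (ε / d) ^ d * (N : ℝ) ^ ε := by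
          rw [mul_pow, ← Real.rpow_natCast ((2 * (N : ℝ)) ^ (ε / d)),
            ← Real.rpow_mul (by positivity), div_mul_cancel₀ _ hd0.ne',
            Real.mul_rpow (by norm_num) hN0.le]
          ring
  have h4 : (1 / 2 : ℝ) ^ L ≤ 1 / N := by
    rw [one_div, inv_pow, ← one_div]
    exact one_div_le_one_div_of_le hN0 h1
  have h5 : (1 : ℝ) ≤ ((L : ℝ) + 1) ^ d := one_le_pow₀ (by linarith [Nat.cast_nonneg (α := ℝ) L])
  refine (starDiscrepancy_scr_le G N L hN η).trans ?_
  calc ((L : ℝ) + 1) ^ d * (2 ^ (G.quality + d) * 2 ^ d) / N + d * (1 / 2) ^ L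
      ≤ ((L : ℝ) + 1) ^ d * (2 ^ (G.quality + d) * 2 ^ d) / N +
          d * (((L : ℝ) + 1) ^ d * (1 / N)) := by
        gcongr
        exact h4.trans (le_mul_of_one_le_left (by positivity) h5)
    _ = (2 ^ (G.quality + d) * 2 ^ d + d) * ((L : ℝ) + 1) ^ d / N := by ring
    _ ≤ (2 ^ (G.quality + d) * 2 ^ d + d) * (2 ^ ε * geo (ε / d) ^ d * (N : ℝ) ^ ε) / N := by
        gcongr
    _ = _ := by
        rw [Real.rpow_sub hN0, Real.rpow_one]
        field_simp

end MLDLQMC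

/-! ### The two error constants and the conclusion. -/

namespace MLDLQMC

variable {d : ℕ}

/-- The part of the error constant that depends on the growth exponents. -/
noncomputable def growthConst (A : Fin d → ℝ) : ℝ :=
  -- The middle summand is what the variance bound uses. The last one forces divergence as the
  -- smallest exponent tends to zero, and the leading `1` with the absolute values ensures
  -- positivity for arbitrary `A`.
  1 + |(haarConst (⨆ i, A i) * geo (1 / 2 - ⨆ i, A i)) ^ d| + |⨅ i, A i|⁻¹

lemma growthConst_pos (A : Fin d → ℝ) : 0 < growthConst A := by
  unfold growthConst
  positivity

lemma tendsto_growthConst :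
    Tendsto (growthConst (d := d)) (comap (fun A : Fin d → ℝ => ⨅ i, A i) (𝓝[≠] 0)) atTop := by
  have h : Tendsto (fun A : Fin d → ℝ => |⨅ i, A i|⁻¹)
      (comap (fun A : Fin d → ℝ => ⨅ i, A i) (𝓝[≠] 0)) atTop :=
    tendsto_inv_nhdsGT_zero.comp (tendsto_abs_nhdsNE_zero.comp tendsto_comap)
  refine tendsto_atTop_mono (fun A => ?_) h
  unfold growthConst
  have := abs_nonneg ((haarConst (⨆ i, A i) * geo (1 / 2 - ⨆ i, A i)) ^ d)
  linarith

/-- The part of the error constant that depends on the sequence and on the loss in the rate. -/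
noncomputable def SobolData.errorConst (G : SobolData d) (ε : ℝ) : ℝ :=
  -- One summand serves the discrepancy, one the variance, and `ε⁻¹` gives divergence as `ε` tends
  -- to zero.
  (2 ^ (G.quality + d) * 2 ^ d + d) * (2 ^ ε * geo (ε / d) ^ d) +
    2 ^ (G.quality + d) * geo ε ^ d + ε⁻¹

variable (G : SobolData d)

lemma geo_pow_nonneg {ε : ℝ} (hε : 0 < ε) : 0 ≤ geo ε ^ d ∧ 0 ≤ geo (ε / d) ^ d := by
  refine ⟨pow_nonneg (by linarith [one_le_geo hε]) _, ?_⟩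
  rcases Nat.eq_zero_or_pos d with rfl | hd
  · simp
  · have : (0 : ℝ) < d := by exact_mod_cast hd
    exact pow_nonneg (by linarith [one_le_geo (div_pos hε this)]) _

lemma SobolData.errorConst_bounds {ε : ℝ} (hε : 0 < ε) :
    (2 ^ (G.quality + d) * 2 ^ d + d) * (2 ^ ε * geo (ε / d) ^ d) ≤ G.errorConst ε ∧
      2 ^ (G.quality + d) * geo ε ^ d ≤ G.errorConst ε ∧ ε⁻¹ ≤ G.errorConst ε := by
  obtain ⟨h1, h2⟩ := geo_pow_nonneg (d := d) hε
  have h3 : 0 ≤ (2 ^ (G.quality + d) * 2 ^ d + d) * (2 ^ ε * geo (ε / d) ^ d) := by positivity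
  have h4 : 0 ≤ 2 ^ (G.quality + d) * geo ε ^ d := by positivity
  have h5 : 0 < ε⁻¹ := by positivity
  unfold errorConst
  exact ⟨by linarith, by linarith, by linarith⟩

lemma SobolData.errorConst_pos {ε : ℝ} (hε : 0 < ε) : 0 < G.errorConst ε :=
  lt_of_lt_of_le (by positivity) (G.errorConst_bounds hε).2.2

lemma SobolData.tendsto_errorConst : Tendsto G.errorConst (𝓝[>] 0) atTop := by
  refine tendsto_atTop_mono' _ ?_ tendsto_inv_nhdsGT_zero
  filter_upwards [self_mem_nhdsWithin] with ε hε
  exact (G.errorConst_bounds hε).2.2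

end MLDLQMC

theorem mainTheorem6 (d₁ : ℕ) (hd₁ : 0 < d₁) :
    ∃ B : (Fin d₁ → ℝ) → ℝ,
      (∀ A, 0 < B A) ∧
      Tendsto B (comap (fun A : Fin d₁ → ℝ => ⨅ i, A i) (𝓝[≠] 0)) atTop ∧
      ∀ G : MLDLQMC.SobolData d₁, ∃ C : ℝ → ℝ,
        (∀ ε, 0 < ε → 0 < C ε) ∧
        Tendsto C (𝓝[>] 0) atTop ∧
        ∀ (Ω : Type*) [MeasurableSpace Ω] (P : Measure Ω) [IsProbabilityMeasure P]
          (ξ : Fin d₁ × List (ZMod 2) → Ω → ZMod 2), MLDLQMC.IsOwenScrambling ξ P →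
          (∀ (N : ℕ) (ε : ℝ), 1 ≤ N → 0 < ε →
            ∫⁻ ω, ENNReal.ofReal
                (MLDLQMC.starDiscrepancy N fun n => MLDLQMC.scrambledPoint G ξ n ω) ∂P
              ≤ ENNReal.ofReal (C ε / (N : ℝ) ^ (1 - ε))) ∧
          ∀ (d₂ : ℕ) (H : MLDLQMC.SobolData d₂) (f : ℝ → ℝ)
            (g : ℝ → (Fin d₁ → ℝ) → (Fin d₂ → ℝ) → ℝ) (h₀ : ℝ) (M₀ : ℕ)
            (b : ℝ) (A : Fin d₁ → ℝ),
            0 < h₀ → 1 ≤ M₀ → 0 < b → 0 < (⨆ i, A i) → (⨆ i, A i) < 1 / 2 →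
            MLDLQMC.BoundaryGrowth (MLDLQMC.levelZeroIntegrand H f g h₀ M₀) b A →
            ∀ (N₀ : ℕ) (ε : ℝ), 1 ≤ N₀ → 0 < ε →
              MemLp (MLDLQMC.levelZeroEstimator G H ξ f g h₀ M₀ N₀) 2 P ∧
              variance (MLDLQMC.levelZeroEstimator G H ξ f g h₀ M₀ N₀) P
                ≤ b ^ 2 * B A ^ 2 * C ε ^ 2 / (N₀ : ℝ) ^ (2 - 2 * ε - 2 * ⨆ i, A i) := by
  classical
  refine ⟨MLDLQMC.growthConst, MLDLQMC.growthConst_pos, MLDLQMC.tendsto_growthConst, fun G =>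
    ⟨G.errorConst, fun ε hε => G.errorConst_pos hε, G.tendsto_errorConst, ?_⟩⟩
  intro Ω _ P _ ξ hξ
  refine ⟨fun N ε hN hε => ?_, ?_⟩
  · have hle : ∀ ω, ENNReal.ofReal
        (MLDLQMC.starDiscrepancy N fun n => MLDLQMC.scrambledPoint G ξ n ω) ≤
        ENNReal.ofReal (G.errorConst ε / (N : ℝ) ^ (1 - ε)) := by
      intro ω
      refine ENNReal.ofReal_le_ofReal ?_
      refine (MLDLQMC.starDiscrepancy_scrambled_le G hd₁ hN hε fun i => ξ i ω).trans ?_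
      exact div_le_div_of_nonneg_right (G.errorConst_bounds hε).1 (by positivity)
    refine (lintegral_mono hle).trans ?_
    rw [lintegral_const, measure_univ, mul_one]
  · intro d₂ H f g h₀ M₀ b A _ _ hb ha ha' hA N ε hN hε
    obtain ⟨D, hD⟩ := hA.growthBound hb.le
    obtain ⟨h1, h2⟩ := hD.variance_average_le G ha.le ha' hN hε hξ
    refine ⟨h1, h2.trans ?_⟩
    have hN0 : (0 : ℝ) < N := by exact_mod_cast hN
    have hc := MLDLQMC.one_le_haarConst ha'
    have hg1 := MLDLQMC.one_le_geo hε
    have hg2 := MLDLQMC.one_le_geo (by linarith : 0 < 1 / 2 - ⨆ i, A i)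
    have hB : (MLDLQMC.haarConst (⨆ i, A i) * MLDLQMC.geo (1 / 2 - ⨆ i, A i)) ^ d₁ ≤
        MLDLQMC.growthConst A := by
      unfold MLDLQMC.growthConst
      have h3 := le_abs_self
        ((MLDLQMC.haarConst (⨆ i, A i) * MLDLQMC.geo (1 / 2 - ⨆ i, A i)) ^ d₁)
      have h4 : 0 ≤ |⨅ i, A i|⁻¹ := by positivity
      linarith
    have hC := (G.errorConst_bounds hε).2.1
    have hB0 := MLDLQMC.growthConst_pos A
    have hpow : ((N : ℝ) ^ ((⨆ i, A i) + ε - 1)) ^ 2 =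
        ((N : ℝ) ^ (2 - 2 * ε - 2 * ⨆ i, A i))⁻¹ := by
      rw [← Real.rpow_natCast, ← Real.rpow_mul hN0.le, ← Real.rpow_neg hN0.le]
      congr 1
      push_cast
      ring
    calc _ ≤ (b * MLDLQMC.growthConst A * G.errorConst ε *
          (N : ℝ) ^ ((⨆ i, A i) + ε - 1)) ^ 2 := by gcongr
      _ = _ := by
        rw [mul_pow, mul_pow, mul_pow, hpow, div_eq_mul_inv]
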